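/- **Setting.** Let $\iota$ be a set of orbitals, each carried by a site at position $\mathrm{pos}(x)\in\mathbb R^2$, such that disks of radius one carry a bounded number of orbitals; let $H$ be a complex Hilbert space with an orthonormal basis $(b_x)_{x\in\iota}$, and write $T_{x,y}=\langle b_x,Tb_y\rangle$. Let $P$ be an orthogonal projection on $H$ with $|P_{x,y}|\le C_1e^{-C_2|\mathrm{pos}(x)-\mathrm{pos}(y)|}$ for all $x,y$, for some constants $C_1$ and $C_2>0$. Consider points $O_1,O_2\in\mathbb R^2$ that lie on no straight segment between two sites. For $F\subseteq\{O_1,O_2\}$, a choice of phases for half-fluxes at the points of $F$ is a family $s_{x,y}\in\mathbb C$, $|s_{x,y}|=1$, such that $s_{x,x}=1$, $s_{x,y}s_{y,x}=1$ and $s_{x,y}s_{y,z}s_{z,x}=(-1)^{k}$, where $k$ is the number of points of $F$ in the triangle with vertices $\mathrm{pos}(x),\mathrm{pos}(y),\mathrm{pos}(z)$ (so the product of the phases along a closed loop of sites is $-1$ for each flux inside the loop). Let $Q_1$, $Q_2$, $S$ be the operators with matrix elements $s_{x,y}P_{x,y}$, for phases with $F=\{O_1\}$, $F=\{O_2\}$,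 $F=\{O_1,O_2\}$ respectively (chosen arbitrarily and independently). For a bounded self-adjoint operator $Q$ let $\overline Q=\mathbf 1_{(1/2,\infty)}(Q)$ be its spectral flattening (eigenvalues $\le\frac12$ go to $0$, the others to $1$), and, if $Q-\overline Q$ is trace class, let $\mathrm{tr}^v(Q)=\mathrm{Tr}(Q-\overline Q)$. **Statement (additivity).** The bounded operators $Q_1,Q_2,S$ exist, and $Q_1-\overline{Q_1}$, $Q_2-\overline{Q_2}$, $S-\overline S$ are trace class. Put $D=\mathrm{tr}^v(S)-(\mathrm{tr}^v(Q_1)+\mathrm{tr}^v(Q_2))$. As $\mathrm{dist}(O_1,O_2)\to\infty$, uniformly in the positions $O_1,O_2$ and in the choices of phases: 1. $D\to0$ in $\mathbb R/\mathbb Z$; 2. if the system is time-reversal symmetric, i.e. $P$ commutes with an antiunitary $\Theta$ with $\Theta^2=-1$ that is on-site ($\langle b_x,\Theta b_y\rangle=0$ whenever $\mathrm{pos}(x)\ne\mathrm{pos}(y)$), then $D\to0$ in $\mathbb R/2\mathbb Z$; 3. there is $c>0$ (depending on the system) such that $D\to0$ in $\mathbb R$ along those configurations for which $Q_1$ and $Q_2$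 have no spectrum at distance less than $e^{-c\,\mathrm{dist}(O_1,O_2)}$ from the chemical potential $\frac12$. -/

import Mathlib

open Filter Topology

noncomputable section

namespace HalfFlux

/-- The Euclidean plane. -/
abbrev Plane : Type := EuclideanSpace ℝ (Fin 2)

section Operators

/- `H` is the one-particle Hilbert space, with an orthonormal (Hilbert) basis `b` labelled by the
set `ι` of orbitals (all internal degrees of freedom on all sites); up to the isometry given by `b`
it is `ℓ²(ι)`. -/
variable {ι H : Type*} [NormedAddCommGroup H] [InnerProductSpace ℂ H] [CompleteSpace H]

/-- The matrix element `T_{x,y} = ⟨b_x, T b_y⟩`. -/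
def entry (b : HilbertBasis ι ℂ H) (T : H →L[ℂ] H) (x y : ι) : ℂ := inner ℂ (b x) (T (b y))

/-- `T` is trace class: the positive operator `|T| = (T⋆ T)^{1/2}` has finite trace. -/
def IsTraceClass (b : HilbertBasis ι ℂ H) (T : H →L[ℂ] H) : Prop :=
  Summable fun x => (entry b (CFC.abs T) x x).re

/-- The trace, as the sum of the diagonal matrix elements (absolutely convergent for trace class
operators). -/
def trace (b : HilbertBasis ι ℂ H) (T : H →L[ℂ] H) : ℂ := ∑' x, entry b T x x

/-- Spectral flattening at `1/2` of a self-adjoint operator: the spectral projection of `Q` for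
the interval `(1/2, ∞)`, i.e. eigenvalues `≤ 1/2` are sent to `0`, the others to `1`.
The spectral subspace for `(-∞, 1/2]` is the kernel of the positive part of `Q - 1/2`, and the
spectral subspace for `(1/2, ∞)` is its orthogonal complement. -/
def flatten (Q : H →L[ℂ] H) : H →L[ℂ] H :=
  ((cfc (fun t : ℝ => max (t - 1 / 2) 0) Q).ker)ᗮ.starProjection

/-- The trace over vertex states, `tr^v(Q) = Tr (Q - flatten Q)`; for self-adjoint `Q` all the
diagonal elements are real. -/
def trv (b : HilbertBasis ι ℂ H) (Q : H →L[ℂ] H) : ℝ := (trace b (Q - flatten Q)).re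

open Classical in
/-- The Peierls substitution: the bounded operator with matrix elements `s_{x,y} P_{x,y}`
(and `0` if there is no such bounded operator). -/
def peierls (b : HilbertBasis ι ℂ H) (s : ι → ι → ℂ) (P : H →L[ℂ] H) : H →L[ℂ] H :=
  if h : ∃ T : H →L[ℂ] H, ∀ x y, entry b T x y = s x y * entry b P x y then h.choose else 0

end Operators

section Fluxes

variable {ι : Type*}

/-- `s` is a choice of Peierls phases (a gauge) for half a flux quantum inserted at each point
of `F`: going round a closed loop of sites, the phases multiply to `-1` for each flux point in the
loop.  The conditions for loops of one, two and three sites are listed; every longer loop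
`x₁ → x₂ → ⋯ → xₙ → x₁` is composed of the triangles `x₁ → xᵢ → xᵢ₊₁ → x₁`.
Here `pos x` is the position of the site that carries the orbital `x`. -/
structure IsFluxPhase (pos : ι → Plane) (F : Set Plane) (s : ι → ι → ℂ) : Prop where
  norm_eq_one : ∀ x y, ‖s x y‖ = 1
  self : ∀ x, s x x = 1
  swap : ∀ x y, s x y * s y x = 1
  triangle : ∀ x y z, s x y * s y z * s z x =
    (-1) ^ (F ∩ convexHull ℝ {pos x, pos y, pos z}).ncard

/-- Two flux points that lie on no straight segment between two sites, with a gauge for the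
half-flux at the first point only, at the second point only, and at both points. -/
structure TwoFlux (pos : ι → Plane) where
  O₁ : Plane
  O₂ : Plane
  generic₁ : ∀ x y, O₁ ∉ segment ℝ (pos x) (pos y)
  generic₂ : ∀ x y, O₂ ∉ segment ℝ (pos x) (pos y)
  s₁ : ι → ι → ℂ
  s₂ : ι → ι → ℂ
  s : ι → ι → ℂ
  isFluxPhase₁ : IsFluxPhase pos {O₁} s₁
  isFluxPhase₂ : IsFluxPhase pos {O₂} s₂
  isFluxPhase : IsFluxPhase pos {O₁, O₂} s

/-- The sites are uniformly locally finite: a disk of radius one carries a bounded number of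
orbitals. -/
def UniformlyLocallyFinite (pos : ι → Plane) : Prop :=
  ∃ M : ℕ, ∀ p : Plane, {x | dist (pos x) p ≤ 1}.encard ≤ M

end Fluxes

section System

variable {ι H : Type*} [NormedAddCommGroup H] [InnerProductSpace ℂ H] [CompleteSpace H]
  {pos : ι → Plane}

/-- The operator `Q₁`: one half-flux, at the first point. -/
def TwoFlux.Q₁ (Φ : TwoFlux pos) (b : HilbertBasis ι ℂ H) (P : H →L[ℂ] H) : H →L[ℂ] H :=
  peierls b Φ.s₁ P

/-- The operator `Q₂`: one half-flux, at the second point. -/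
def TwoFlux.Q₂ (Φ : TwoFlux pos) (b : HilbertBasis ι ℂ H) (P : H →L[ℂ] H) : H →L[ℂ] H :=
  peierls b Φ.s₂ P

/-- The operator `S`: half-fluxes at both points. -/
def TwoFlux.S (Φ : TwoFlux pos) (b : HilbertBasis ι ℂ H) (P : H →L[ℂ] H) : H →L[ℂ] H :=
  peierls b Φ.s P

/-- The defect of additivity, `tr^v(S) - (tr^v(Q₁) + tr^v(Q₂))`. -/
def TwoFlux.defect (Φ : TwoFlux pos) (b : HilbertBasis ι ℂ H) (P : H →L[ℂ] H) : ℝ :=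
  trv b (Φ.S b P) - (trv b (Φ.Q₁ b P) + trv b (Φ.Q₂ b P))

/-- The distance between the two fluxes goes to infinity. -/
def TwoFlux.farApart (pos : ι → Plane) : Filter (TwoFlux pos) :=
  comap (fun Φ : TwoFlux pos => dist Φ.O₁ Φ.O₂) atTop

/-- The spectra of `Q₁` and `Q₂` have a gap around the chemical potential `1/2`, of half-width
at least `exp (-c d)`, where `d` is the distance between the fluxes. -/
def TwoFlux.GapAtHalf (Φ : TwoFlux pos) (b : HilbertBasis ι ℂ H) (P : H →L[ℂ] H) (c : ℝ) : Prop :=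
  ∀ t ∈ spectrum ℝ (Φ.Q₁ b P) ∪ spectrum ℝ (Φ.Q₂ b P),
    Real.exp (-c * dist Φ.O₁ Φ.O₂) ≤ |t - 1 / 2|

/-- Exponential decay of the matrix elements, with respect to the distance of the sites. -/
def ExpDecay (pos : ι → Plane) (b : HilbertBasis ι ℂ H) (P : H →L[ℂ] H) : Prop :=
  ∃ C₁ C₂ : ℝ, 0 < C₂ ∧ ∀ x y, ‖entry b P x y‖ ≤ C₁ * Real.exp (-C₂ * dist (pos x) (pos y))

/-- Time-reversal symmetry with square `-1`: an on-site antiunitary `Θ` with `Θ² = -1` commutes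
with `P`. -/
def TimeReversalSymmetric (pos : ι → Plane) (b : HilbertBasis ι ℂ H) (P : H →L[ℂ] H) : Prop :=
  ∃ Θ : H ≃ₗᵢ⋆[ℂ] H, (∀ v, Θ (Θ v) = -v) ∧
    (∀ x y, pos x ≠ pos y → inner ℂ (b x) (Θ (b y)) = 0) ∧ ∀ v, Θ (P v) = P (Θ v)

end System

end HalfFlux

end

/-! Write Δ(Q) = Q² - Q (`idemDefect`). As P² = P, the entries of Δ(Q) are sums over y of (s_xy s_yz
- s_xz) P_xy P_yz, and the bracket vanishes unless the triangle xyz contains a flux. By the decay of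
P, Δ(Q) is concentrated near the fluxes. Its columns have summable norms, with bounds that depend
neither on the flux positions nor on the gauge.

Hence only boundedly many disjoint intervals of a given small size in [1/4, 3/4] can meet the
spectrum, and by pigeonhole some c above 1/2 lies in a gap of S, Q₁ and Q₂ at once
(`exists_common_gap`). Cutting at c instead of 1/2 is continuous on the spectrum: Q minus its
spectral projection above c is g(Q)Δ(Q) with g continuous. The price is an integer, the rank of the
spectral projection for (1/2, c].

In a suitable gauge S agrees with each Qᵢ on the half-plane around Oᵢ. Up to an exponentially small
error, Δ(S) is then Δ(Q₁) + Δ(Q₂), while (S - Qᵢ)Δ(Qᵢ) and Δ(Q₁)Δ(Q₂) vanish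
(`exists_superposition`). So g(S)Δ(S) is close to the sum of the g(Qᵢ)Δ(Qᵢ), first for polynomials
and then for continuous g (`exists_colSum_cfc_le`), and D is close to an integer combination of
three ranks (`exists_trv_additive`).

With time reversal the gauge can be taken real and site-dependent only. The symmetry then survives,
and Kramers degeneracy makes all three ranks even. With a gap at 1/2, a variational argument for the
form (S - a)(c - S) shows that the ranks of S just above and just below 1/2 are each at least the
sum of those of Q₁ and Q₂ (`finrank_add_le`). Their total is a trace that is additive up to an error
below one, so both inequalities are equalities and the integer vanishes. -/

open scoped ENNReal NNReal

namespace HalfFlux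

/-! ### Column sums, trace class operators and ranks -/

section ColSum

variable {ι H : Type*} [NormedAddCommGroup H] [InnerProductSpace ℂ H]
  {b : HilbertBasis ι ℂ H} {T T' A : H →L[ℂ] H}

/-- The sum of the norms of the columns of `T`; it dominates the trace norm. -/
noncomputable def colSum (b : HilbertBasis ι ℂ H) (T : H →L[ℂ] H) : ℝ≥0∞ := ∑' x, ‖T (b x)‖ₑ

lemma enorm_apply_le (b : HilbertBasis ι ℂ H) (T : H →L[ℂ] H) (v : H) :
    ‖T v‖ₑ ≤ ∑' y, ‖(inner ℂ (b y) v : ℂ)‖ₑ * ‖T (b y)‖ₑ := by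
  have h := T.hasSum (b.hasSum_repr v)
  rw [← h.tsum_eq]
  refine enorm_tsum_le_tsum_enorm.trans (ENNReal.tsum_le_tsum fun y => ?_)
  rw [map_smul, enorm_smul, b.repr_apply_apply]

lemma norm_basis (b : HilbertBasis ι ℂ H) (x : ι) : ‖b x‖ = 1 := b.orthonormal.1 x

lemma enorm_inner_basis_le (b : HilbertBasis ι ℂ H) (x : ι) (v : H) :
    ‖(inner ℂ (b x) v : ℂ)‖ₑ ≤ ‖v‖ₑ := by
  have h := norm_inner_le_norm (𝕜 := ℂ) (b x) v
  rw [norm_basis, one_mul] at h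
  exact enorm_le_iff_norm_le.mpr h

lemma colSum_mul_le (b : HilbertBasis ι ℂ H) (A T : H →L[ℂ] H) :
    colSum b (A * T) ≤ ‖A‖ₑ * colSum b T := by
  rw [colSum, colSum, ← ENNReal.tsum_mul_left]
  exact ENNReal.tsum_le_tsum fun x => A.le_opENorm (T (b x))

lemma colSum_add_le (b : HilbertBasis ι ℂ H) (T T' : H →L[ℂ] H) :
    colSum b (T + T') ≤ colSum b T + colSum b T' := by
  rw [colSum, colSum, colSum, ← ENNReal.tsum_add]
  exact ENNReal.tsum_le_tsum fun x => enorm_add_le _ _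

lemma colSum_neg (b : HilbertBasis ι ℂ H) (T : H →L[ℂ] H) : colSum b (-T) = colSum b T := by
  simp [colSum]

lemma colSum_sub_le (b : HilbertBasis ι ℂ H) (T T' : H →L[ℂ] H) :
    colSum b (T - T') ≤ colSum b T + colSum b T' := by
  rw [sub_eq_add_neg, ← colSum_neg b T']
  exact colSum_add_le b _ _

lemma colSum_zero (b : HilbertBasis ι ℂ H) : colSum b 0 = 0 := by simp [colSum]

lemma enorm_le_colSum (b : HilbertBasis ι ℂ H) (T : H →L[ℂ] H) : ‖T‖ₑ ≤ colSum b T := by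
  by_cases hT : colSum b T = ⊤
  · simp [hT]
  have key : ∀ v, ‖T v‖ₑ ≤ colSum b T * ‖v‖ₑ := fun v => by
    refine (enorm_apply_le b T v).trans ?_
    rw [colSum, mul_comm, ← ENNReal.tsum_mul_left]
    exact ENNReal.tsum_le_tsum fun y => mul_le_mul_left (enorm_inner_basis_le b y v) _
  have : ‖T‖ ≤ (colSum b T).toReal := by
    refine T.opNorm_le_bound ENNReal.toReal_nonneg fun v => ?_
    have h := ENNReal.toReal_mono (ENNReal.mul_ne_top hT enorm_ne_top) (key v)
    simpa [ENNReal.toReal_mul] using h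
  rw [← ofReal_norm, ← ENNReal.ofReal_toReal hT]
  exact ENNReal.ofReal_le_ofReal this

/-- The operator norm controls only multiplication from the left; on the right its role is played by
the absolute row sums of `Q`. -/
lemma colSum_mul_le_of_entry {L : ℝ≥0∞} {Q : H →L[ℂ] H}
    (hQ : ∀ y, ∑' x, ‖entry b Q y x‖ₑ ≤ L) (T : H →L[ℂ] H) :
    colSum b (T * Q) ≤ L * colSum b T := by
  calc colSum b (T * Q) ≤ ∑' x, ∑' y, ‖entry b Q y x‖ₑ * ‖T (b y)‖ₑ :=
        ENNReal.tsum_le_tsum fun x => enorm_apply_le b T (Q (b x))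
    _ = ∑' y, (∑' x, ‖entry b Q y x‖ₑ) * ‖T (b y)‖ₑ := by
        rw [ENNReal.tsum_comm]
        exact tsum_congr fun y => ENNReal.tsum_mul_right
    _ ≤ ∑' y, L * ‖T (b y)‖ₑ :=
        ENNReal.tsum_le_tsum fun y => mul_le_mul_left (hQ y) _
    _ = L * colSum b T := ENNReal.tsum_mul_left

lemma summable_norm_of_colSum (hT : colSum b T ≠ ⊤) : Summable fun x => ‖T (b x)‖ := by
  have h := ENNReal.summable_toReal hT
  simpa using h

lemma norm_entry_le (b : HilbertBasis ι ℂ H) (T : H →L[ℂ] H) (x y : ι) :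
    ‖entry b T x y‖ ≤ ‖T (b y)‖ := by
  have h := norm_inner_le_norm (𝕜 := ℂ) (b x) (T (b y))
  rwa [norm_basis, one_mul] at h

lemma summable_entry_of_colSum (hT : colSum b T ≠ ⊤) : Summable fun x => entry b T x x :=
  Summable.of_norm_bounded (summable_norm_of_colSum hT) fun x => norm_entry_le b T x x

lemma trace_sub (hT : colSum b T ≠ ⊤) (hT' : colSum b T' ≠ ⊤) :
    trace b (T - T') = trace b T - trace b T' := by
  rw [trace, trace, trace,
    ← (summable_entry_of_colSum hT).tsum_sub (summable_entry_of_colSum hT')]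
  simp [entry]

lemma norm_trace_le {r : ℝ} (hr : 0 ≤ r) (hT : colSum b T ≤ ENNReal.ofReal r) :
    ‖trace b T‖ ≤ r := by
  have h : ‖trace b T‖ₑ ≤ ENNReal.ofReal r := by
    refine enorm_tsum_le_tsum_enorm.trans (le_trans (ENNReal.tsum_le_tsum fun x => ?_) hT)
    exact enorm_inner_basis_le b x _
  rw [← ofReal_norm] at h
  exact (ENNReal.ofReal_le_ofReal_iff hr).mp h

lemma hasSum_norm_inner_sq (b : HilbertBasis ι ℂ H) (v : H) :
    HasSum (fun x => ‖(inner ℂ (b x) v : ℂ)‖ ^ 2) (‖v‖ ^ 2) := by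
  have h := (b.hasSum_inner_mul_inner v v).mapL Complex.reCLM
  simp only [Complex.reCLM_apply] at h
  convert h using 1
  · ext x
    rw [← inner_conj_symm v (b x), ← Complex.normSq_eq_conj_mul_self, Complex.ofReal_re,
      Complex.normSq_eq_norm_sq]
  · exact (inner_self_eq_norm_sq (𝕜 := ℂ) v).symm

lemma tsum_enorm_inner_sq (b : HilbertBasis ι ℂ H) (v : H) :
    ∑' x, ‖(inner ℂ (b x) v : ℂ)‖ₑ ^ 2 = ‖v‖ₑ ^ 2 := by
  have h := hasSum_norm_inner_sq b v
  have h2 := ENNReal.ofReal_tsum_of_nonneg (fun x => sq_nonneg ‖(inner ℂ (b x) v : ℂ)‖) h.summable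
  rw [h.tsum_eq] at h2
  simpa [ENNReal.ofReal_pow] using h2.symm

variable [CompleteSpace H]

/-- `T` and its absolute value have columns of equal norm, and a diagonal entry is at most the norm
of its column. -/
lemma isTraceClass_of_colSum (hT : colSum b T ≠ ⊤) : IsTraceClass b T := by
  have hpos : (CFC.abs T).IsPositive :=
    (ContinuousLinearMap.nonneg_iff_isPositive _).mp (CFC.abs_nonneg T)
  have hn : ∀ v, ‖CFC.abs T v‖ = ‖T v‖ := fun v => by
    have h1 : ‖CFC.abs T v‖ ^ 2 = ‖T v‖ ^ 2 := by
      rw [ContinuousLinearMap.apply_norm_sq_eq_inner_adjoint_left,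
        ContinuousLinearMap.apply_norm_sq_eq_inner_adjoint_left]
      have h2 : ContinuousLinearMap.adjoint (CFC.abs T) * CFC.abs T
          = ContinuousLinearMap.adjoint T * T := by
        rw [hpos.isSelfAdjoint.adjoint_eq]
        exact CFC.abs_mul_abs T
      exact congrArg (fun A : H →L[ℂ] H => RCLike.re (inner ℂ (A v) v : ℂ)) h2
    exact (pow_left_inj₀ (norm_nonneg _) (norm_nonneg _) two_ne_zero).mp h1
  refine Summable.of_nonneg_of_le (fun x => ?_) (fun x => ?_) (summable_norm_of_colSum hT)
  · exact hpos.re_inner_nonneg_right (b x)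
  · rw [← hn]
    exact (Complex.re_le_norm _).trans (norm_entry_le b _ x x)

/-- A projection with finite column sum has finite rank, and its trace is the rank. -/
lemma finiteDimensional_range_and_trace {R : H →L[ℂ] H} (hR : IsStarProjection R)
    (hc : colSum b R ≠ ⊤) :
    FiniteDimensional ℂ R.range ∧ trace b R = Module.finrank ℂ R.range := by
  have hidem : ∀ v, R (R v) = R v := fun v => congr($(hR.isIdempotentElem.eq) v)
  have hsymm : ∀ v w, (inner ℂ (R v) w : ℂ) = inner ℂ v (R w) := fun v w => by
    have := ContinuousLinearMap.adjoint_inner_left R w v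
    rwa [hR.isSelfAdjoint.adjoint_eq] at this
  have hclosed : IsClosed (R.range : Set H) := by
    have h2 : (R.range : Set H) = {v | R v = v} := by
      ext v
      exact ⟨fun ⟨u, hu⟩ => hu ▸ hidem u, fun hv => ⟨v, hv⟩⟩
    rw [h2]
    exact isClosed_eq R.continuous continuous_id
  have : CompleteSpace R.range := hclosed.completeSpace_coe
  obtain ⟨w, c, hcw⟩ := exists_hilbertBasis ℂ R.range
  -- Parseval in the range and then in `H`, with the sums exchanged: the squared column norms count
  -- a Hilbert basis of the range.
  have hsq : ∑' x, ‖R (b x)‖ₑ ^ 2 = ∑' _ : w, (1 : ℝ≥0∞) := by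
    have h1 : ∀ x, ‖R (b x)‖ₑ ^ 2 = ∑' j, ‖(inner ℂ (b x) (c j : H) : ℂ)‖ₑ ^ 2 := fun x => by
      have h2 := tsum_enorm_inner_sq c ⟨R (b x), ⟨b x, rfl⟩⟩
      have h3 : ‖(⟨R (b x), ⟨b x, rfl⟩⟩ : R.range)‖ₑ = ‖R (b x)‖ₑ := rfl
      rw [h3] at h2
      rw [← h2]
      refine tsum_congr fun j => ?_
      congr 1
      obtain ⟨u, hu⟩ := (c j).2
      rw [Submodule.coe_inner, ← hsymm, ← enorm_norm, norm_inner_symm, enorm_norm]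
      congr 2
      rw [← hu]
      exact hidem u
    simp_rw [h1]
    rw [ENNReal.tsum_comm]
    refine tsum_congr fun j => ?_
    rw [tsum_enorm_inner_sq b]
    have : ‖((c j : R.range) : H)‖ = 1 := norm_basis c j
    rw [← ofReal_norm, this]
    simp
  have hle : ∀ x, ‖R (b x)‖ ≤ 1 := fun x => by
    obtain ⟨_, h⟩ := isStarProjection_iff_eq_starProjection_range.mp hR
    rw [h, ← norm_basis b x]
    exact Submodule.norm_starProjection_apply_le _ _
  have hlt : ∑' x, ‖R (b x)‖ₑ ^ 2 ≠ ⊤ := by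
    refine ne_top_of_le_ne_top hc (ENNReal.tsum_le_tsum fun x => ?_)
    rw [sq]
    refine mul_le_of_le_one_left' ?_
    rw [← ofReal_norm, ← ENNReal.ofReal_one]
    exact ENNReal.ofReal_le_ofReal (hle x)
  have hfin : Finite w := by
    by_contra hw
    rw [not_finite_iff_infinite] at hw
    exact hlt (hsq.trans (ENNReal.tsum_const_eq_top_of_ne_zero one_ne_zero))
  have := Fintype.ofFinite w
  have hfd : FiniteDimensional ℂ R.range := c.toOrthonormalBasis.toBasis.finiteDimensional_of_finite
  refine ⟨hfd, ?_⟩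
  have hrank : Module.finrank ℂ R.range = Fintype.card w :=
    Module.finrank_eq_card_basis c.toOrthonormalBasis.toBasis
  have hre : ∑' x, ‖R (b x)‖ ^ 2 = Fintype.card w := by
    have := congrArg ENNReal.toReal hsq
    rw [ENNReal.tsum_toReal_eq (fun x => by simp)] at this
    simpa [tsum_fintype] using this
  rw [hrank, trace, ← Complex.ofReal_natCast, ← hre, Complex.ofReal_tsum]
  refine tsum_congr fun x => ?_
  rw [entry, ← hidem, ← hsymm, inner_self_eq_norm_sq_to_K, hidem]
  simp

end ColSum

/-- Kramers degeneracy. -/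
theorem even_finrank_of_antilinear {V : Type*} [AddCommGroup V] [Module ℂ V]
    [FiniteDimensional ℂ V] (Θ : V →ₛₗ[starRingEnd ℂ] V) (h : ∀ v, Θ (Θ v) = -v) :
    Even (Module.finrank ℂ V) := by
  classical
  let e := Module.finBasis ℂ V
  let A : Matrix (Fin (Module.finrank ℂ V)) (Fin (Module.finrank ℂ V)) ℂ :=
    Matrix.of fun i j => e.repr (Θ (e j)) i
  -- Antilinearity conjugates the second factor. Taking determinants gives |det A|² = (-1)ⁿ, which
  -- is impossible for odd n.
  have hA : A * A.map (starRingEnd ℂ) = -1 := by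
    ext i j
    have h1 : Θ (e j) = ∑ k, A k j • e k := (e.sum_repr (Θ (e j))).symm
    have h2 : e.repr (Θ (Θ (e j))) i = e.repr (-e j) i := by rw [h]
    rw [h1, map_sum, map_sum, Finsupp.finsetSum_apply] at h2
    simp only [map_smulₛₗ, Finsupp.smul_apply, map_neg, Finsupp.neg_apply, e.repr_self] at h2
    rw [Matrix.mul_apply, Matrix.neg_apply, Matrix.one_apply]
    rw [Finsupp.single_apply] at h2
    rw [show (if i = j then (1 : ℂ) else 0) = if j = i then 1 else 0 from
      if_congr eq_comm rfl rfl, ← h2]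
    exact Finset.sum_congr rfl fun k _ => mul_comm _ _
  have hd := congrArg Matrix.det hA
  have hm : (A.map (starRingEnd ℂ)).det = starRingEnd ℂ A.det :=
    ((starRingEnd ℂ).map_det A).symm
  rw [Matrix.det_mul, hm, Complex.mul_conj, Matrix.det_neg, Matrix.det_one, mul_one,
    Fintype.card_fin] at hd
  by_contra hodd
  rw [Nat.not_even_iff_odd] at hodd
  rw [hodd.neg_one_pow] at hd
  have h0 : Complex.normSq A.det = -1 := by exact_mod_cast hd
  linarith [Complex.normSq_nonneg A.det]

/-- The continuous step function that rises from `0` to `1` on `[c - δ, c + δ]`. -/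
noncomputable def step (c δ t : ℝ) : ℝ := max 0 (min 1 ((t - c + δ) / (2 * δ)))

lemma continuous_step (c δ : ℝ) : Continuous (step c δ) := by
  unfold step
  fun_prop

lemma step_of_le {c δ t : ℝ} (hδ : 0 < δ) (h : t ≤ c - δ) : step c δ t = 0 :=
  max_eq_left (min_le_of_right_le (div_nonpos_of_nonpos_of_nonneg (by linarith) (by linarith)))

lemma step_of_ge {c δ t : ℝ} (hδ : 0 < δ) (h : c + δ ≤ t) : step c δ t = 1 := by
  have : 1 ≤ (t - c + δ) / (2 * δ) := by
    rw [le_div_iff₀ (by linarith)]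
    linarith
  rw [step, min_eq_left this]
  exact max_eq_right zero_le_one

lemma step_cases {c δ t : ℝ} (hδ : 0 < δ) (h : δ ≤ |t - c|) :
    (t ≤ c - δ ∧ step c δ t = 0) ∨ (c + δ ≤ t ∧ step c δ t = 1) := by
  rcases le_abs.mp h with h | h
  · exact Or.inr ⟨by linarith, step_of_ge hδ (by linarith)⟩
  · exact Or.inl ⟨by linarith, step_of_le hδ (by linarith)⟩

/-! ### Spectral projections, flattening and the idempotency defect -/

section Spectral

variable {H : Type*} [NormedAddCommGroup H] [InnerProductSpace ℂ H] [CompleteSpace H]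
  {Q : H →L[ℂ] H}

/-- The spectrum of `Q` keeps the distance `δ` from `c`. -/
def HasGap (Q : H →L[ℂ] H) (c δ : ℝ) : Prop := ∀ t ∈ spectrum ℝ Q, δ ≤ |t - c|

/-- `Q² - Q`, which measures by how much `Q` fails to be idempotent. -/
def idemDefect (Q : H →L[ℂ] H) : H →L[ℂ] H := Q * Q - Q

/-- The spectral projection of `Q` for `[c, ∞)` if there is a gap of half-width `δ` at `c`. -/
noncomputable def specProj (Q : H →L[ℂ] H) (c δ : ℝ) : H →L[ℂ] H := cfc (step c δ) Q

/-- The positive part of `Q - 1/2`. -/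
noncomputable def posHalf (Q : H →L[ℂ] H) : H →L[ℂ] H := cfc (fun t : ℝ => max (t - 1 / 2) 0) Q

lemma inner_apply_left {T : H →L[ℂ] H} (hT : IsSelfAdjoint T) (v w : H) :
    (inner ℂ (T v) w : ℂ) = inner ℂ v (T w) := by
  have := ContinuousLinearMap.adjoint_inner_left T w v
  rwa [hT.adjoint_eq] at this

lemma isSelfAdjoint_cfc (f : ℝ → ℝ) (Q : H →L[ℂ] H) : IsSelfAdjoint (cfc f Q) :=
  cfc_predicate f Q

lemma idemDefect_eq_cfc (hQ : IsSelfAdjoint Q) :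
    idemDefect Q = cfc (fun t : ℝ => t * t - t) Q := by
  rw [cfc_sub (fun t : ℝ => t * t) (fun t => t) Q, cfc_mul (fun t : ℝ => t) (fun t => t) Q,
    cfc_id' ℝ Q, idemDefect]

lemma isSelfAdjoint_idemDefect (hQ : IsSelfAdjoint Q) : IsSelfAdjoint (idemDefect Q) := by
  rw [idemDefect_eq_cfc hQ]
  exact isSelfAdjoint_cfc _ _

/-- This factorization is how functions of `Q` acquire summable columns: everything to the left of
the defect only needs an operator norm bound. -/
lemma cfc_eq_mul_idemDefect (hQ : IsSelfAdjoint Q) {f g : ℝ → ℝ} (hg : Continuous g)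
    (h : ∀ t ∈ spectrum ℝ Q, f t = g t * (t * t - t)) : cfc f Q = cfc g Q * idemDefect Q := by
  rw [idemDefect_eq_cfc hQ, ← cfc_mul g (fun t => t * t - t) Q (hg.continuousOn)
    (by fun_prop)]
  exact cfc_congr h

lemma cfc_mul' {f g : ℝ → ℝ} (hf : Continuous f) (hg : Continuous g) (Q : H →L[ℂ] H) :
    cfc f Q * cfc g Q = cfc (fun t => f t * g t) Q :=
  (cfc_mul f g Q hf.continuousOn hg.continuousOn).symm

lemma re_inner_cfc_nonneg {f : ℝ → ℝ} (h : ∀ t ∈ spectrum ℝ Q, 0 ≤ f t) (v : H) :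
    0 ≤ (inner ℂ v (cfc f Q v) : ℂ).re :=
  ((ContinuousLinearMap.nonneg_iff_isPositive _).mp (cfc_nonneg h)).re_inner_nonneg_right v

lemma re_inner_cfc_nonpos {f : ℝ → ℝ} (h : ∀ t ∈ spectrum ℝ Q, f t ≤ 0) (v : H) :
    (inner ℂ v (cfc f Q v) : ℂ).re ≤ 0 := by
  have h2 := re_inner_cfc_nonneg (f := fun t => -f t) (Q := Q)
    (fun t ht => neg_nonneg.mpr (h t ht)) v
  rw [cfc_neg] at h2
  simpa using h2

lemma isStarProjection_flatten (Q : H →L[ℂ] H) : IsStarProjection (flatten Q) :=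
  isStarProjection_starProjection

lemma isSelfAdjoint_posHalf (Q : H →L[ℂ] H) : IsSelfAdjoint (posHalf Q) :=
  isSelfAdjoint_cfc _ _

/-- The range of the positive part is orthogonal to its kernel, and `flatten` projects onto the
orthogonal complement of that kernel. -/
lemma flatten_mul_posHalf_mul (Q T : H →L[ℂ] H) :
    flatten Q * (posHalf Q * T) = posHalf Q * T := by
  ext v
  refine Submodule.starProjection_eq_self_iff.mpr ?_
  rw [Submodule.mem_orthogonal]
  intro u hu
  have hu : posHalf Q u = 0 := hu
  change inner ℂ u (posHalf Q (T v)) = 0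
  rw [← inner_apply_left (isSelfAdjoint_posHalf Q), hu, inner_zero_left]

lemma posHalf_mul_flatten (Q : H →L[ℂ] H) : posHalf Q * flatten Q = posHalf Q := by
  have h := congrArg star (flatten_mul_posHalf_mul Q 1)
  rwa [mul_one, star_mul, (isSelfAdjoint_posHalf Q).star_eq,
    (isStarProjection_flatten Q).isSelfAdjoint.star_eq] at h

lemma flatten_mul_eq_zero {T : H →L[ℂ] H} (h : posHalf Q * T = 0) : flatten Q * T = 0 := by
  ext v
  refine (Submodule.starProjection_apply_eq_zero_iff _).mpr ?_
  refine Submodule.le_orthogonal_orthogonal _ ?_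
  exact congr($h v)

variable {c δ : ℝ}

lemma isSelfAdjoint_specProj (Q : H →L[ℂ] H) (c δ : ℝ) : IsSelfAdjoint (specProj Q c δ) :=
  isSelfAdjoint_cfc _ _

lemma specProj_mul_self (hδ : 0 < δ) (h : HasGap Q c δ) :
    specProj Q c δ * specProj Q c δ = specProj Q c δ := by
  rw [specProj, cfc_mul' (continuous_step c δ) (continuous_step c δ)]
  refine cfc_congr fun t ht => ?_
  rcases step_cases hδ (h t ht) with ⟨_, h⟩ | ⟨_, h⟩ <;> simp [h]

/-- For c ≥ 1/2 the projection above c factors through the positive part of Q - 1/2, whose range is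
fixed by `flatten Q`. -/
lemma flatten_mul_specProj (hδ : 0 < δ) (h : HasGap Q c δ) (hc : 1 / 2 ≤ c) :
    flatten Q * specProj Q c δ = specProj Q c δ := by
  -- The cutoff δ keeps the quotient continuous; at spectral points where the step is nonzero, the
  -- denominator is t - 1/2.
  have hcont : Continuous fun t : ℝ => step c δ t / max (t - 1 / 2) δ :=
    (continuous_step c δ).div (by fun_prop) fun t => (lt_max_of_lt_right hδ).ne'
  have : specProj Q c δ = posHalf Q * cfc (fun t : ℝ => step c δ t / max (t - 1 / 2) δ) Q := by
    rw [posHalf, cfc_mul' (by fun_prop) hcont]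
    refine cfc_congr fun t ht => ?_
    rcases step_cases hδ (h t ht) with ⟨_, h⟩ | ⟨h', h⟩
    · simp [h]
    · have h1 : δ ≤ t - 1 / 2 := by linarith
      have h2 : t - 1 / 2 ≠ 0 := by linarith
      simp only [h, max_eq_left h1, max_eq_left (hδ.le.trans h1)]
      exact (mul_div_cancel₀ 1 h2).symm
  rw [this, flatten_mul_posHalf_mul]

lemma specProj_mul_flatten (hδ : 0 < δ) (h : HasGap Q c δ) (hc : 1 / 2 ≤ c) :
    specProj Q c δ * flatten Q = specProj Q c δ := by
  have h := congrArg star (flatten_mul_specProj hδ h hc)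
  rwa [star_mul, (isSelfAdjoint_specProj Q c δ).star_eq,
    (isStarProjection_flatten Q).isSelfAdjoint.star_eq] at h

lemma one_sub_specProj (hQ : IsSelfAdjoint Q) (c δ : ℝ) :
    1 - specProj Q c δ = cfc (fun t => 1 - step c δ t) Q := by
  rw [cfc_sub (fun _ : ℝ => (1 : ℝ)) (step c δ) Q (by fun_prop) (continuous_step c δ).continuousOn,
    cfc_const_one ℝ Q, specProj]

/-- For c ≤ 1/2 the complementary projection lives where the positive part of Q - 1/2 vanishes, so
`flatten Q` annihilates it. -/
lemma flatten_mul_specProj' (hQ : IsSelfAdjoint Q) (hδ : 0 < δ) (h : HasGap Q c δ)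
    (hc : c ≤ 1 / 2) : flatten Q * specProj Q c δ = flatten Q := by
  have h0 : flatten Q * (1 - specProj Q c δ) = 0 := by
    refine flatten_mul_eq_zero ?_
    have hcont : Continuous fun t : ℝ => 1 - step c δ t :=
      continuous_const.sub (continuous_step c δ)
    rw [one_sub_specProj hQ, posHalf, cfc_mul' (by fun_prop) hcont]
    rw [← cfc_const_zero ℝ Q]
    refine cfc_congr fun t ht => ?_
    rcases step_cases hδ (h t ht) with ⟨h', h⟩ | ⟨h', h⟩
    · simp only [max_eq_right (show t - 1 / 2 ≤ 0 by linarith), zero_mul]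
    · simp [h]
  rw [mul_sub, mul_one, sub_eq_zero] at h0
  exact h0.symm

lemma specProj_mul_flatten' (hQ : IsSelfAdjoint Q) (hδ : 0 < δ) (h : HasGap Q c δ)
    (hc : c ≤ 1 / 2) : specProj Q c δ * flatten Q = flatten Q := by
  have h := congrArg star (flatten_mul_specProj' hQ hδ h hc)
  rwa [star_mul, (isSelfAdjoint_specProj Q c δ).star_eq,
    (isStarProjection_flatten Q).isSelfAdjoint.star_eq] at h

lemma flatten_eq_specProj (hQ : IsSelfAdjoint Q) (hδ : 0 < δ) (h : HasGap Q (1 / 2) δ) :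
    flatten Q = specProj Q (1 / 2) δ := by
  rw [← flatten_mul_specProj' hQ hδ h le_rfl, flatten_mul_specProj hδ h le_rfl]

/-- The spectral projection for `(1/2, c]`. -/
lemma isStarProjection_flatten_sub (hδ : 0 < δ) (h : HasGap Q c δ) (hc : 1 / 2 ≤ c) :
    IsStarProjection (flatten Q - specProj Q c δ) where
  isIdempotentElem := by
    rw [IsIdempotentElem, mul_sub, sub_mul, sub_mul, flatten_mul_specProj hδ h hc,
      specProj_mul_flatten hδ h hc, specProj_mul_self hδ h,
      (isStarProjection_flatten Q).isIdempotentElem.eq]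
    abel
  isSelfAdjoint := (isStarProjection_flatten Q).isSelfAdjoint.sub (isSelfAdjoint_specProj Q c δ)

/-- The spectral projection for `(c, 1/2]`. -/
lemma isStarProjection_sub_flatten (hQ : IsSelfAdjoint Q) (hδ : 0 < δ) (h : HasGap Q c δ)
    (hc : c ≤ 1 / 2) : IsStarProjection (specProj Q c δ - flatten Q) where
  isIdempotentElem := by
    rw [IsIdempotentElem, mul_sub, sub_mul, sub_mul, flatten_mul_specProj' hQ hδ h hc,
      specProj_mul_flatten' hQ hδ h hc, specProj_mul_self hδ h,
      (isStarProjection_flatten Q).isIdempotentElem.eq]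
    abel
  isSelfAdjoint := (isSelfAdjoint_specProj Q c δ).sub (isStarProjection_flatten Q).isSelfAdjoint

/-- A continuous function that agrees with `1 / (t² - t)` on `[1/4, 3/4]`. -/
noncomputable def invDefect (t : ℝ) : ℝ := 1 / min (t * t - t) (-(3 / 16))

lemma continuous_invDefect : Continuous invDefect :=
  continuous_const.div (by fun_prop) fun t => ((min_le_right _ _).trans_lt (by norm_num)).ne

lemma invDefect_mul {t : ℝ} (h1 : 1 / 4 ≤ t) (h2 : t ≤ 3 / 4) :
    invDefect t * (t * t - t) = 1 := by
  have h : t * t - t ≤ -(3 / 16) := by nlinarith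
  rw [invDefect, min_eq_left h]
  exact one_div_mul_cancel (by linarith)

lemma abs_invDefect_le (t : ℝ) : |invDefect t| ≤ 16 / 3 := by
  have h : min (t * t - t) (-(3 / 16)) ≤ -(3 / 16) := min_le_right _ _
  rw [invDefect, abs_div, abs_one, abs_of_nonpos (by linarith),
    div_le_iff₀ (by linarith)]
  linarith

/-- A continuous function with `(t - step c δ t) = defectQuot c δ t * (t² - t)` outside the
interval `(c - δ, c + δ)`. -/
noncomputable def defectQuot (c δ t : ℝ) : ℝ :=
  (1 - step c δ t) / (min t (3 / 4) - 1) + step c δ t / max t (1 / 4)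

lemma continuous_defectQuot (c δ : ℝ) : Continuous (defectQuot c δ) := by
  have := continuous_step c δ
  refine Continuous.add (Continuous.div (by fun_prop) (by fun_prop) fun t => ?_)
    (Continuous.div (by fun_prop) (by fun_prop) fun t => ?_)
  · have := min_le_right t (3 / 4)
    linarith
  · exact (lt_max_of_lt_right (by norm_num)).ne'

/-- Below the gap t = (t² - t)/(t - 1), and above it t - 1 = (t² - t)/t. The denominators stay away
from zero because the gap lies in [1/4, 3/4]. -/
lemma sub_specProj_eq (hQ : IsSelfAdjoint Q) (hδ : 0 < δ) (h : HasGap Q c δ)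
    (h1 : 1 / 4 ≤ c - δ) (h2 : c + δ ≤ 3 / 4) :
    Q - specProj Q c δ = cfc (defectQuot c δ) Q * idemDefect Q := by
  rw [← cfc_eq_mul_idemDefect (f := fun t => t - step c δ t) hQ (continuous_defectQuot c δ),
    cfc_sub (fun t : ℝ => t) (step c δ) Q (by fun_prop) (continuous_step c δ).continuousOn,
    cfc_id' ℝ Q, specProj]
  intro t ht
  rcases step_cases hδ (h t ht) with ⟨h', h⟩ | ⟨h', h⟩
  · have h3 : t ≤ 3 / 4 := by linarith
    have h4 : t - 1 ≠ 0 := by linarith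
    simp only [h, defectQuot, min_eq_left h3]
    field_simp
    ring
  · have h3 : 1 / 4 ≤ t := by linarith
    have h4 : t ≠ 0 := by linarith
    simp only [h, defectQuot, max_eq_left h3]
    field_simp
    ring

lemma specProj_sub_specProj (Q : H →L[ℂ] H) (a α c δ : ℝ) :
    specProj Q a α - specProj Q c δ = cfc (fun t => step a α t - step c δ t) Q :=
  (cfc_sub (step a α) (step c δ) Q (continuous_step a α).continuousOn
    (continuous_step c δ).continuousOn).symm

/-- The two steps differ only for t between the gaps, hence in [1/4, 3/4], where `invDefect` inverts
t² - t. -/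
lemma window_eq {a α c δ t : ℝ} (hα : 0 < α) (hδ : 0 < δ) (h1 : 1 / 4 ≤ a + α)
    (h2 : c - δ ≤ 3 / 4) (hac : a ≤ c) (ha : α ≤ |t - a|) (hc : δ ≤ |t - c|) :
    step a α t - step c δ t = (step a α t - step c δ t) * invDefect t * (t * t - t) := by
  rcases step_cases hα ha with ⟨h3, h4⟩ | ⟨h3, h4⟩ <;>
    rcases step_cases hδ hc with ⟨h5, h6⟩ | ⟨h5, h6⟩
  · simp [h4, h6]
  · linarith
  · rw [mul_assoc, invDefect_mul (by linarith) (by linarith), mul_one]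
  · simp [h4, h6]

lemma specProj_sub_specProj_eq (hQ : IsSelfAdjoint Q) {a α : ℝ} (hα : 0 < α) (hδ : 0 < δ)
    (ha : HasGap Q a α) (hc : HasGap Q c δ) (h1 : 1 / 4 ≤ a + α) (h2 : c - δ ≤ 3 / 4)
    (hac : a ≤ c) :
    specProj Q a α - specProj Q c δ =
      cfc (fun t => (step a α t - step c δ t) * invDefect t) Q * idemDefect Q := by
  rw [specProj_sub_specProj]
  exact cfc_eq_mul_idemDefect hQ
    (((continuous_step a α).sub (continuous_step c δ)).mul continuous_invDefect)
    fun t ht => window_eq hα hδ h1 h2 hac (ha t ht) (hc t ht)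

end Spectral

/-! ### Common spectral gaps and continuous functions of superpositions -/

section Admissible

variable {ι H : Type*} [NormedAddCommGroup H] [InnerProductSpace ℂ H] [CompleteSpace H]
  {b : HilbertBasis ι ℂ H} {L κ ε : ℝ≥0} {Q Q' S Q₁ Q₂ : H →L[ℂ] H} {c δ : ℝ}

/-- Uniform bounds on a self-adjoint operator that is idempotent up to a trace class operator. -/
structure Admissible (b : HilbertBasis ι ℂ H) (L κ : ℝ≥0) (Q : H →L[ℂ] H) : Prop where
  isSelfAdjoint : IsSelfAdjoint Q
  norm_le : ‖Q‖ ≤ L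
  colSum_mul_right_le : ∀ T, colSum b (T * Q) ≤ L * colSum b T
  colSum_defect_le : colSum b (idemDefect Q) ≤ κ

/-- Up to an error `ε`, the operator `S` is a superposition of `Q₁` and `Q₂`. -/
structure IsSuperposition (b : HilbertBasis ι ℂ H) (ε : ℝ≥0) (S Q₁ Q₂ : H →L[ℂ] H) : Prop where
  defect_le : colSum b (idemDefect S - idemDefect Q₁ - idemDefect Q₂) ≤ ε
  sub_mul_le₁ : colSum b ((S - Q₁) * idemDefect Q₁) ≤ ε
  sub_mul_le₂ : colSum b ((S - Q₂) * idemDefect Q₂) ≤ ε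
  mul_le : colSum b (idemDefect Q₁ * idemDefect Q₂) ≤ ε

lemma enorm_le_of_norm_le {E : Type*} [SeminormedAddCommGroup E] {v : E} {r : ℝ≥0}
    (h : ‖v‖ ≤ r) : ‖v‖ₑ ≤ r := by
  rw [enorm_eq_nnnorm]
  exact_mod_cast h

lemma Admissible.enorm_le (hQ : Admissible b L κ Q) : ‖Q‖ₑ ≤ L :=
  enorm_le_of_norm_le hQ.norm_le

lemma Admissible.colSum_cfc_mul_le (hQ : Admissible b L κ Q) {g : ℝ → ℝ} {r : ℝ≥0}
    (hg : ∀ t ∈ spectrum ℝ Q, |g t| ≤ r) : colSum b (cfc g Q * idemDefect Q) ≤ r * κ := by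
  refine (colSum_mul_le b _ _).trans (mul_le_mul' ?_ hQ.colSum_defect_le)
  exact enorm_le_of_norm_le (norm_cfc_le r.2 hg)

lemma Admissible.enorm_pow_le (hQ : Admissible b L κ Q) (m : ℕ) : ‖Q ^ m‖ₑ ≤ (L ^ m : ℝ≥0) := by
  refine enorm_le_of_norm_le ?_
  rw [NNReal.coe_pow]
  rcases m with _ | m
  · rw [pow_zero, pow_zero]
    exact ContinuousLinearMap.norm_id_le
  · exact (norm_pow_le' Q m.succ_pos).trans (pow_le_pow_left₀ (norm_nonneg _) hQ.norm_le _)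

lemma Admissible.abs_le (hQ : Admissible b L κ Q) {t : ℝ} (ht : t ∈ spectrum ℝ Q) : |t| ≤ L := by
  have := norm_cfc_le_iff (fun t : ℝ => t) Q (c := L) L.2 (by fun_prop) hQ.isSelfAdjoint
  rw [cfc_id' ℝ Q hQ.isSelfAdjoint] at this
  exact this.mp hQ.norm_le t ht

/-! ### Spectral gaps -/

/-- A failed gap puts spectrum into the interval, so a tent function of `Q` supported there is
nonzero and has a unit vector u_j in its range; disjoint tents give orthonormal vectors. As |t² - t|
≥ 3/16 on [1/4, 3/4], each ‖Δ u_j‖² is at least (3/16)² = 9/256, while their sum is at most the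
squared Hilbert–Schmidt norm of Δ, hence at most κ². -/
lemma card_mul_le_of_not_hasGap (hQ : Admissible b L κ Q) {J : Type*} [Fintype J] (cs : J → ℝ)
    (hsep : ∀ i j, i ≠ j → 2 * δ ≤ |cs i - cs j|)
    (h1 : ∀ j, 1 / 4 ≤ cs j - δ) (h2 : ∀ j, cs j + δ ≤ 3 / 4) (hgap : ∀ j, ¬ HasGap Q (cs j) δ) :
    Fintype.card J * (9 / 256 : ℝ) ≤ κ * κ := by
  classical
  let φ : J → ℝ → ℝ := fun j t => max 0 (δ - |t - cs j|)
  have hφ : ∀ j, Continuous (φ j) := fun j => by fun_prop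
  have hex : ∀ j, ∃ w, cfc (φ j) Q w ≠ 0 := fun j => by
    have := hgap j
    simp only [HasGap, not_forall, not_le] at this
    obtain ⟨t, ht, hlt⟩ := this
    by_contra! h0
    have h3 : cfc (φ j) Q = 0 := by ext w; simpa using h0 w
    have h4 := norm_apply_le_norm_cfc (φ j) Q ht (hφ j).continuousOn hQ.isSelfAdjoint
    rw [h3, norm_zero] at h4
    have h5 : φ j t = 0 := norm_le_zero_iff.mp h4
    have h6 : δ - |t - cs j| ≤ φ j t := le_max_right _ _
    linarith
  choose w hw using hex
  let u : J → H := fun j => ((‖cfc (φ j) Q (w j)‖⁻¹ : ℝ) : ℂ) • cfc (φ j) Q (w j)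
  have hu1 : ∀ j, ‖u j‖ = 1 := fun j => by
    simp only [u, norm_smul, Complex.norm_real, norm_inv, norm_norm]
    exact inv_mul_cancel₀ (norm_ne_zero_iff.mpr (hw j))
  have huo : Orthonormal ℂ u := by
    refine ⟨hu1, fun i j hij => ?_⟩
    simp only [u, inner_smul_left, inner_smul_right]
    rw [inner_apply_left (isSelfAdjoint_cfc _ _), ← mul_apply_eq_comp,
      cfc_mul' (hφ i) (hφ j)]
    have : cfc (fun t => φ i t * φ j t) Q = 0 := by
      rw [← cfc_const_zero ℝ Q]
      refine cfc_congr fun t _ => ?_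
      simp only [φ]
      rcases le_total (δ - |t - cs i|) 0 with h | h
      · simp [max_eq_left h]
      · rw [max_eq_left (a := (0 : ℝ)) (b := δ - |t - cs j|), mul_zero]
        have h3 := hsep i j hij
        have h4 : |cs i - cs j| ≤ |t - cs i| + |t - cs j| := by
          rw [abs_sub_comm t (cs i)]
          simpa using abs_add_le (cs i - t) (t - cs j)
        linarith
    simp [this]
  have hcont : Continuous fun t => invDefect t * (t * t - t) :=
    continuous_invDefect.mul (by fun_prop)
  have hinv : ∀ j, u j = cfc invDefect Q (idemDefect Q (u j)) := fun j => by
    have h3 : cfc invDefect Q * idemDefect Q * cfc (φ j) Q = cfc (φ j) Q := by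
      rw [← cfc_eq_mul_idemDefect (f := fun t => invDefect t * (t * t - t)) hQ.isSelfAdjoint
        continuous_invDefect (fun _ _ => rfl),
        cfc_mul' hcont (hφ j)]
      refine cfc_congr fun t _ => ?_
      simp only [φ]
      rcases le_total (δ - |t - cs j|) 0 with h | h
      · simp [max_eq_left h]
      · have h4 := abs_le.mp (show |t - cs j| ≤ δ by linarith)
        rw [invDefect_mul (by linarith [h1 j]) (by linarith [h2 j]), one_mul]
    simp only [u, map_smul]
    congr 1
    exact congr($h3 (w j)).symm
  have hlow : ∀ j, (9 / 256 : ℝ) ≤ ‖idemDefect Q (u j)‖ ^ 2 := fun j => by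
    have h3 : ‖cfc invDefect Q‖ ≤ 16 / 3 :=
      norm_cfc_le (by norm_num) fun t _ => abs_invDefect_le t
    have h4 : 1 ≤ 16 / 3 * ‖idemDefect Q (u j)‖ := by
      rw [← hu1 j]
      conv_lhs => rw [hinv j]
      exact (ContinuousLinearMap.le_opNorm _ _).trans
        (mul_le_mul_of_nonneg_right h3 (norm_nonneg _))
    nlinarith
  have hsum : ∑ j, ‖idemDefect Q (u j)‖ₑ ^ 2 ≤ (κ : ℝ≥0∞) * κ := by
    calc ∑ j, ‖idemDefect Q (u j)‖ₑ ^ 2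
        = ∑ j, ∑' x, ‖(inner ℂ (b x) (idemDefect Q (u j)) : ℂ)‖ₑ ^ 2 :=
          Finset.sum_congr rfl fun j _ => (tsum_enorm_inner_sq b _).symm
      _ = ∑' x, ∑ j, ‖(inner ℂ (b x) (idemDefect Q (u j)) : ℂ)‖ₑ ^ 2 :=
          (Summable.tsum_finsetSum fun _ _ => ENNReal.summable).symm
      -- Bessel's inequality for the u_j leaves ‖Δ b_x‖²; one of the two factors is bounded by the
      -- whole column sum κ.
      _ ≤ ∑' x, ‖idemDefect Q (b x)‖ₑ * κ := ENNReal.tsum_le_tsum fun x => by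
          have h3 := huo.sum_inner_products_le (idemDefect Q (b x)) (s := Finset.univ)
          have h4 : ∑ j, ‖(inner ℂ (b x) (idemDefect Q (u j)) : ℂ)‖ₑ ^ 2
              ≤ ‖idemDefect Q (b x)‖ₑ ^ 2 := by
            rw [← ofReal_norm (idemDefect Q (b x)), ← ENNReal.ofReal_pow (norm_nonneg _)]
            refine le_trans (le_of_eq ?_) (ENNReal.ofReal_le_ofReal h3)
            rw [ENNReal.ofReal_sum_of_nonneg fun _ _ => sq_nonneg _]
            refine Finset.sum_congr rfl fun j _ => ?_
            rw [ENNReal.ofReal_pow (norm_nonneg _), ofReal_norm,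
              ← inner_apply_left (isSelfAdjoint_idemDefect hQ.isSelfAdjoint), ← ofReal_norm,
              norm_inner_symm, ofReal_norm]
          refine h4.trans ?_
          rw [sq]
          refine mul_le_mul_right ?_ _
          exact (ENNReal.le_tsum x).trans hQ.colSum_defect_le
      _ = colSum b (idemDefect Q) * κ := ENNReal.tsum_mul_right
      _ ≤ κ * κ := mul_le_mul_left hQ.colSum_defect_le _
  have hreal : ∑ j, ‖idemDefect Q (u j)‖ ^ 2 ≤ (κ : ℝ) * κ := by
    have := ENNReal.toReal_mono (by finiteness) hsum
    rw [ENNReal.toReal_sum (fun _ _ => by finiteness)] at this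
    simpa using this
  refine le_trans ?_ hreal
  calc Fintype.card J * (9 / 256 : ℝ) = ∑ _j : J, (9 / 256 : ℝ) := by simp
    _ ≤ _ := Finset.sum_le_sum fun j _ => hlow j

/-- Among finitely many intervals inside a given one, there is a common gap of three admissible
operators. -/
lemma exists_common_gap (κ : ℝ≥0) {α β : ℝ} (hα : 1 / 4 ≤ α) (hαβ : α < β) (hβ : β ≤ 3 / 4) :
    ∃ (N : ℕ) (cs : Fin N → ℝ) (δ : ℝ), 0 < δ ∧ (∀ j, α ≤ cs j - δ ∧ cs j + δ ≤ β) ∧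
      ∀ {ι H : Type*} [NormedAddCommGroup H] [InnerProductSpace ℂ H] [CompleteSpace H]
        (b : HilbertBasis ι ℂ H) (L : ℝ≥0) (Q : Fin 3 → H →L[ℂ] H),
        (∀ i, Admissible b L κ (Q i)) → ∃ j, ∀ i, HasGap (Q i) (cs j) δ := by
  -- Each of the three operators can spoil at most (256/9) κ² intervals, so more than three times as
  -- many leave one free.
  obtain ⟨N, hN⟩ := exists_nat_gt (3 * ((κ : ℝ) * κ * (256 / 9)))
  have hN0 : (0 : ℝ) < N := lt_of_le_of_lt (by positivity) hN
  set δ : ℝ := (β - α) / (2 * N) with hδ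
  have hδ0 : 0 < δ := div_pos (by linarith) (by linarith)
  have hδN : 2 * δ * N = β - α := by rw [hδ]; field_simp
  have hcs : ∀ j : Fin N, α ≤ α + (2 * (j : ℝ) + 1) * δ - δ ∧
      α + (2 * (j : ℝ) + 1) * δ + δ ≤ β := fun j => by
    have h1 : (j : ℝ) + 1 ≤ N := by exact_mod_cast j.2
    have h2 : (0 : ℝ) ≤ j := Nat.cast_nonneg _
    constructor
    · nlinarith
    · nlinarith
  refine ⟨N, fun j => α + (2 * (j : ℝ) + 1) * δ, δ, hδ0, hcs, ?_⟩
  intro ι H _ _ _ b L Q hQ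
  classical
  by_contra! hno
  choose f hf using hno
  have hcard : ∀ i : Fin 3, (Fintype.card {j : Fin N // f j = i} : ℝ) ≤ κ * κ * (256 / 9) := by
    intro i
    have := card_mul_le_of_not_hasGap (hQ i)
      (fun j : {j : Fin N // f j = i} => α + (2 * ((j : Fin N) : ℝ) + 1) * δ) ?_
      (fun j => hα.trans (hcs j).1) (fun j => (hcs j).2.trans hβ) (fun j => by
        have := hf j
        rwa [j.2] at this)
    · linarith
    · intro j k hjk
      have h1 : (1 : ℝ) ≤ |((j : Fin N) : ℝ) - ((k : Fin N) : ℝ)| := by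
        have h2 : ((j : Fin N) : ℤ) - ((k : Fin N) : ℤ) ≠ 0 := by
          intro h
          apply hjk
          ext
          omega
        have := Int.one_le_abs h2
        exact_mod_cast this
      have h3 : α + (2 * ((j : Fin N) : ℝ) + 1) * δ - (α + (2 * ((k : Fin N) : ℝ) + 1) * δ)
          = 2 * δ * (((j : Fin N) : ℝ) - ((k : Fin N) : ℝ)) := by ring
      rw [h3, abs_mul, abs_of_pos (by linarith : 0 < 2 * δ)]
      nlinarith
  have hsum : (N : ℝ) = ∑ i : Fin 3, (Fintype.card {j : Fin N // f j = i} : ℝ) := by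
    rw [← Nat.cast_sum, ← Fintype.card_sigma, Fintype.card_congr (Equiv.sigmaFiberEquiv f),
      Fintype.card_fin]
  have h3 := Finset.sum_le_sum fun i (_ : i ∈ Finset.univ) => hcard i
  rw [← hsum] at h3
  simp at h3
  linarith

/-! ### Functional calculus of a superposition -/

lemma exists_polynomial_near_cfc {h : ℝ → ℝ} (hh : Continuous h) (R : ℝ) {η : ℝ} (hη : 0 < η) :
    ∃ p : Polynomial ℝ, ∀ t, |t| ≤ R → |h t - p.eval t| ≤ η := by
  obtain ⟨p, hp⟩ := exists_polynomial_near_of_continuousOn (-R) R h hh.continuousOn η hη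
  refine ⟨p, fun t ht => ?_⟩
  rw [abs_sub_comm]
  exact (hp t (abs_le.mp ht)).le

/-- Telescoping: S^(m+1) - Q^(m+1) = S(S^m - Q^m) + (S - Q)Q^m. Since `Q` commutes with its defect,
Q^m moves to the right of (S - Q)Δ(Q), where `colSum_mul_right_le` applies. -/
lemma Admissible.colSum_pow_le (hS : Admissible b L κ S) (hQ : Admissible b L κ Q)
    (h : colSum b ((S - Q) * idemDefect Q) ≤ ε) (m : ℕ) :
    colSum b ((S ^ m - Q ^ m) * idemDefect Q) ≤ (m * L ^ (m - 1) : ℝ≥0) * ε := by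
  have hcomm : Commute Q (idemDefect Q) :=
    ((Commute.refl Q).mul_right (Commute.refl Q)).sub_right (Commute.refl Q)
  have hpow : ∀ (T : H →L[ℂ] H) (m : ℕ), colSum b (T * Q ^ m) ≤ (L : ℝ≥0∞) ^ m * colSum b T := by
    intro T m
    induction m with
    | zero => simp
    | succ m ih =>
      rw [pow_succ, ← mul_assoc, pow_succ', mul_assoc (L : ℝ≥0∞)]
      exact (hQ.colSum_mul_right_le _).trans (mul_le_mul_right ih _)
  induction m with
  | zero => simp [colSum_zero]
  | succ m ih =>
    have h1 : (S ^ (m + 1) - Q ^ (m + 1)) * idemDefect Q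
        = S * ((S ^ m - Q ^ m) * idemDefect Q) + (S - Q) * idemDefect Q * Q ^ m := by
      rw [mul_assoc (S - Q), ← (hcomm.pow_left m).eq, pow_succ', pow_succ']
      simp only [sub_mul, mul_sub, mul_assoc]
      abel
    rw [h1]
    calc _ ≤ (L : ℝ≥0∞) * ((m * L ^ (m - 1) : ℝ≥0) * ε) + (L : ℝ≥0∞) ^ m * ε := by
          refine (colSum_add_le b _ _).trans (add_le_add ?_ ?_)
          · exact (colSum_mul_le b _ _).trans (mul_le_mul' hS.enorm_le ih)
          · exact (hpow _ m).trans (mul_le_mul_right h _)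
      _ = ((m + 1 : ℕ) * L ^ (m + 1 - 1) : ℝ≥0) * ε := by
          norm_cast
          rcases m with _ | m
          · simp
          · simp only [Nat.add_sub_cancel]
            push_cast
            ring

/-- For a monomial the difference splits into S^m times the mismatch of the defects and the two
terms (S^m - Qᵢ^m)Δ(Qᵢ). The constant is chosen before the operators, which is what makes the final
limit uniform. -/
lemma exists_colSum_aeval_le (L κ : ℝ≥0) (p : Polynomial ℝ) : ∃ C : ℝ≥0,
    ∀ {ι H : Type*} [NormedAddCommGroup H] [InnerProductSpace ℂ H] [CompleteSpace H]
      (b : HilbertBasis ι ℂ H) (S Q₁ Q₂ : H →L[ℂ] H) (ε : ℝ≥0), Admissible b L κ S →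
      Admissible b L κ Q₁ → Admissible b L κ Q₂ → IsSuperposition b ε S Q₁ Q₂ →
      colSum b (Polynomial.aeval S p * idemDefect S - Polynomial.aeval Q₁ p * idemDefect Q₁
        - Polynomial.aeval Q₂ p * idemDefect Q₂) ≤ C * ε := by
  induction p using Polynomial.induction_on' with
  | add p q hp hq =>
    obtain ⟨C, hC⟩ := hp
    obtain ⟨C', hC'⟩ := hq
    refine ⟨C + C', fun b S Q₁ Q₂ ε hS h₁ h₂ h => ?_⟩
    have := (colSum_add_le b _ _).trans
      (add_le_add (hC b S Q₁ Q₂ ε hS h₁ h₂ h) (hC' b S Q₁ Q₂ ε hS h₁ h₂ h))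
    push_cast
    rw [add_mul]
    refine le_of_eq_of_le ?_ this
    congr 1
    simp only [map_add, add_mul]
    abel
  | monomial m a =>
    refine ⟨‖a‖₊ * (L ^ m + 2 * (m * L ^ (m - 1))), fun b S Q₁ Q₂ ε hS h₁ h₂ h => ?_⟩
    have h3 : Polynomial.aeval S (Polynomial.monomial m a) * idemDefect S
        - Polynomial.aeval Q₁ (Polynomial.monomial m a) * idemDefect Q₁
        - Polynomial.aeval Q₂ (Polynomial.monomial m a) * idemDefect Q₂
        = a • (S ^ m * (idemDefect S - idemDefect Q₁ - idemDefect Q₂)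
          + (S ^ m - Q₁ ^ m) * idemDefect Q₁ + (S ^ m - Q₂ ^ m) * idemDefect Q₂) := by
      simp only [Polynomial.aeval_monomial, Algebra.algebraMap_eq_smul_one, smul_mul_assoc, one_mul,
        smul_add, smul_sub, mul_sub, sub_mul]
      abel
    have h4 : ∀ T : _ →L[ℂ] _, colSum b (a • T) ≤ ‖a‖₊ * colSum b T := fun T => by
      have := colSum_mul_le b (a • 1) T
      rw [smul_mul_assoc, one_mul] at this
      refine this.trans (mul_le_mul_left ?_ _)
      refine enorm_le_iff_norm_le.mpr ?_
      rw [norm_smul]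
      refine (mul_le_mul_of_nonneg_left ContinuousLinearMap.norm_id_le (norm_nonneg a)).trans ?_
      simp
    rw [h3]
    refine (h4 _).trans ?_
    push_cast
    rw [mul_assoc]
    refine mul_le_mul_right ?_ _
    refine (colSum_add_le b _ _).trans ?_
    refine (add_le_add ((colSum_add_le b _ _).trans (add_le_add
      ((colSum_mul_le b _ _).trans (mul_le_mul' (hS.enorm_pow_le m) h.defect_le))
      (hS.colSum_pow_le h₁ h.sub_mul_le₁ m))) (hS.colSum_pow_le h₂ h.sub_mul_le₂ m)).trans
      (le_of_eq ?_)
    push_cast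
    ring

/-- For a continuous function `h`, the operator `h(S)(S² - S)` is approximately the sum of
`h(Q₁)(Q₁² - Q₁)` and `h(Q₂)(Q₂² - Q₂)`. -/
lemma exists_colSum_cfc_le (L κ : ℝ≥0) {h : ℝ → ℝ} (hh : Continuous h) {η : ℝ≥0} (hη : 0 < η) :
    ∃ ε₀ : ℝ≥0, 0 < ε₀ ∧
    ∀ {ι H : Type*} [NormedAddCommGroup H] [InnerProductSpace ℂ H] [CompleteSpace H]
      (b : HilbertBasis ι ℂ H) (S Q₁ Q₂ : H →L[ℂ] H) (ε : ℝ≥0), Admissible b L κ S →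
      Admissible b L κ Q₁ → Admissible b L κ Q₂ → IsSuperposition b ε S Q₁ Q₂ → ε ≤ ε₀ →
      colSum b (cfc h S * idemDefect S - cfc h Q₁ * idemDefect Q₁
        - cfc h Q₂ * idemDefect Q₂) ≤ η := by
  -- Half of η pays for three polynomial approximations at cost rκ each, the other half for the
  -- polynomial estimate C ε.
  obtain ⟨r, hr, hrκ⟩ : ∃ r : ℝ≥0, 0 < r ∧ 3 * (r * κ) ≤ η / 2 := by
    refine ⟨η / (6 * (κ + 1)), by positivity, ?_⟩
    rw [← NNReal.coe_le_coe]
    push_cast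
    rw [div_mul_eq_mul_div, mul_div_assoc', div_le_div_iff₀ (by positivity) (by positivity)]
    nlinarith [η.2, κ.2, mul_nonneg η.2 κ.2]
  obtain ⟨p, hp⟩ := exists_polynomial_near_cfc hh L (NNReal.coe_pos.mpr hr)
  obtain ⟨C, hC⟩ := exists_colSum_aeval_le L κ p
  refine ⟨η / (2 * (C + 1)), by positivity, fun b S Q₁ Q₂ ε hS h₁ h₂ hsup hε => ?_⟩
  have key : ∀ Q : _ →L[ℂ] _, Admissible b L κ Q →
      colSum b (cfc h Q * idemDefect Q - Polynomial.aeval Q p * idemDefect Q) ≤ r * κ := by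
    intro Q hQ
    rw [← cfc_polynomial p Q hQ.isSelfAdjoint, ← sub_mul,
      ← cfc_sub h p.eval Q hh.continuousOn p.continuous.continuousOn]
    exact hQ.colSum_cfc_mul_le fun t ht => hp t (hQ.abs_le ht)
  have hsplit : cfc h S * idemDefect S - cfc h Q₁ * idemDefect Q₁ - cfc h Q₂ * idemDefect Q₂
      = (cfc h S * idemDefect S - Polynomial.aeval S p * idemDefect S)
        - (cfc h Q₁ * idemDefect Q₁ - Polynomial.aeval Q₁ p * idemDefect Q₁)
        - (cfc h Q₂ * idemDefect Q₂ - Polynomial.aeval Q₂ p * idemDefect Q₂)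
        + (Polynomial.aeval S p * idemDefect S - Polynomial.aeval Q₁ p * idemDefect Q₁
          - Polynomial.aeval Q₂ p * idemDefect Q₂) := by abel
  rw [hsplit]
  calc _ ≤ (r * κ + r * κ + r * κ : ℝ≥0∞) + C * ε :=
        (colSum_add_le b _ _).trans (add_le_add ((colSum_sub_le b _ _).trans
          (add_le_add ((colSum_sub_le b _ _).trans (add_le_add (key S hS) (key Q₁ h₁)))
            (key Q₂ h₂))) (hC b S Q₁ Q₂ ε hS h₁ h₂ hsup))
    _ ≤ η := by
        norm_cast
        have h6 : C * ε ≤ η / 2 := by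
          refine (mul_le_mul_right hε C).trans ?_
          rw [← NNReal.coe_le_coe]
          push_cast
          rw [mul_div_assoc', div_le_div_iff₀ (by positivity) (by positivity)]
          nlinarith [η.2, C.2, mul_nonneg η.2 C.2]
        calc r * κ + r * κ + r * κ + C * ε = 3 * (r * κ) + C * ε := by ring
          _ ≤ η / 2 + η / 2 := add_le_add hrκ h6
          _ = η := add_halves η

end Admissible

/-! ### Vertex traces as continuous traces minus ranks; comparison of ranks -/

section Ranks

variable {ι H : Type*} [NormedAddCommGroup H] [InnerProductSpace ℂ H] [CompleteSpace H]
  {b : HilbertBasis ι ℂ H} {L κ ε : ℝ≥0} {Q S Q₁ Q₂ : H →L[ℂ] H} {a α c δ : ℝ}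

omit [CompleteSpace H] in
lemma colSum_mul_ne_top {T A : H →L[ℂ] H} (hT : colSum b T ≠ ⊤) : colSum b (A * T) ≠ ⊤ :=
  ne_top_of_le_ne_top (ENNReal.mul_ne_top enorm_ne_top hT) (colSum_mul_le b A T)

lemma Admissible.colSum_mul_defect_ne_top (hQ : Admissible b L κ Q) (A : H →L[ℂ] H) :
    colSum b (A * idemDefect Q) ≠ ⊤ :=
  colSum_mul_ne_top (ne_top_of_le_ne_top ENNReal.coe_ne_top hQ.colSum_defect_le)

/-- Gaps of the spectrum at a point `a` below `1/2` and at a point `c` above `1/2`. -/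
structure HasGaps (Q : H →L[ℂ] H) (a α c δ : ℝ) : Prop where
  pos_lower : 0 < α
  pos_upper : 0 < δ
  quarter_le : 1 / 4 ≤ a - α
  lower_le : a + α ≤ 1 / 2
  le_upper : 1 / 2 ≤ c - δ
  upper_le : c + δ ≤ 3 / 4
  lower : HasGap Q a α
  upper : HasGap Q c δ

/-- Since 1/2 may belong to the spectrum, `flatten Q` need not be a continuous function of `Q`. The
projection for (1/2, c] is therefore treated as a subprojection of the window (a, c], which has gaps
at both ends and carries a factor `idemDefect Q`. -/
lemma HasGaps.flatten_sub_eq (h : HasGaps Q a α c δ) (hQ : IsSelfAdjoint Q) :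
    flatten Q - specProj Q c δ =
      (flatten Q - specProj Q c δ) * (specProj Q a α - specProj Q c δ) := by
  obtain ⟨hα, hδ, h1, h2, h3, h4, ha, hc⟩ := h
  have e1 := flatten_mul_specProj hδ hc (by linarith)
  have e2 := specProj_mul_flatten hδ hc (by linarith)
  have e3 := flatten_mul_specProj' hQ hα ha (by linarith)
  have e4 := specProj_mul_self hδ hc
  have e5 : specProj Q c δ * specProj Q a α = specProj Q c δ := by
    rw [← e2, mul_assoc, e3]
  rw [mul_sub, sub_mul, sub_mul, e1, e3, e4, e5]
  abel

lemma HasGaps.sub_flatten_eq (h : HasGaps Q a α c δ) (hQ : IsSelfAdjoint Q) :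
    specProj Q a α - flatten Q =
      (specProj Q a α - flatten Q) * (specProj Q a α - specProj Q c δ) := by
  obtain ⟨hα, hδ, h1, h2, h3, h4, ha, hc⟩ := h
  have e1 := flatten_mul_specProj hδ hc (by linarith)
  have e3 := flatten_mul_specProj' hQ hα ha (by linarith)
  have e4 := specProj_mul_self hα ha
  have e5 : specProj Q a α * specProj Q c δ = specProj Q c δ := by
    rw [← e1, ← mul_assoc, specProj_mul_flatten' hQ hα ha (by linarith)]
  rw [mul_sub, sub_mul, sub_mul, e1, e3, e4, e5]
  abel

lemma HasGaps.window_eq (h : HasGaps Q a α c δ) (hQ : IsSelfAdjoint Q) :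
    specProj Q a α - specProj Q c δ =
      cfc (fun t => (step a α t - step c δ t) * invDefect t) Q * idemDefect Q := by
  obtain ⟨hα, hδ, h1, h2, h3, h4, ha, hc⟩ := h
  exact specProj_sub_specProj_eq hQ hα hδ ha hc (by linarith) (by linarith) (by linarith)

lemma HasGaps.colSum_flatten_sub (h : HasGaps Q a α c δ) (hQ : Admissible b L κ Q) :
    colSum b (flatten Q - specProj Q c δ) ≠ ⊤ := by
  rw [h.flatten_sub_eq hQ.isSelfAdjoint, h.window_eq hQ.isSelfAdjoint, ← mul_assoc]
  exact hQ.colSum_mul_defect_ne_top _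

lemma HasGaps.colSum_sub_flatten (h : HasGaps Q a α c δ) (hQ : Admissible b L κ Q) :
    colSum b (specProj Q a α - flatten Q) ≠ ⊤ := by
  rw [h.sub_flatten_eq hQ.isSelfAdjoint, h.window_eq hQ.isSelfAdjoint, ← mul_assoc]
  exact hQ.colSum_mul_defect_ne_top _

lemma HasGaps.finrank_upper (h : HasGaps Q a α c δ) (hQ : Admissible b L κ Q) :
    FiniteDimensional ℂ (flatten Q - specProj Q c δ).range ∧
      trace b (flatten Q - specProj Q c δ) =
        Module.finrank ℂ (flatten Q - specProj Q c δ).range :=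
  finiteDimensional_range_and_trace
    (isStarProjection_flatten_sub h.pos_upper h.upper (by linarith [h.le_upper, h.pos_upper]))
    (h.colSum_flatten_sub hQ)

lemma HasGaps.finrank_lower (h : HasGaps Q a α c δ) (hQ : Admissible b L κ Q) :
    FiniteDimensional ℂ (specProj Q a α - flatten Q).range ∧
      trace b (specProj Q a α - flatten Q) =
        Module.finrank ℂ (specProj Q a α - flatten Q).range :=
  finiteDimensional_range_and_trace
    (isStarProjection_sub_flatten hQ.isSelfAdjoint h.pos_lower h.lower
      (by linarith [h.lower_le, h.pos_lower]))
    (h.colSum_sub_flatten hQ)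

lemma HasGaps.sub_specProj_eq (h : HasGaps Q a α c δ) (hQ : IsSelfAdjoint Q) :
    Q - specProj Q c δ = cfc (defectQuot c δ) Q * idemDefect Q :=
  HalfFlux.sub_specProj_eq hQ h.pos_upper h.upper (by linarith [h.le_upper, h.pos_upper])
    h.upper_le

lemma HasGaps.colSum_sub_specProj (h : HasGaps Q a α c δ) (hQ : Admissible b L κ Q) :
    colSum b (Q - specProj Q c δ) ≠ ⊤ := by
  rw [h.sub_specProj_eq hQ.isSelfAdjoint]
  exact hQ.colSum_mul_defect_ne_top _

lemma HasGaps.colSum_sub_flat (h : HasGaps Q a α c δ) (hQ : Admissible b L κ Q) :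
    colSum b (Q - flatten Q) ≠ ⊤ := by
  rw [show Q - flatten Q = (Q - specProj Q c δ) - (flatten Q - specProj Q c δ) by abel]
  exact ne_top_of_le_ne_top (ENNReal.add_ne_top.mpr
    ⟨h.colSum_sub_specProj hQ, h.colSum_flatten_sub hQ⟩) (colSum_sub_le b _ _)

/-- The first term is stable under superposition; all discontinuity of the flattening is in the
integer. -/
lemma HasGaps.trv_eq (h : HasGaps Q a α c δ) (hQ : Admissible b L κ Q) :
    trv b Q = (trace b (cfc (defectQuot c δ) Q * idemDefect Q)).re
      - Module.finrank ℂ (flatten Q - specProj Q c δ).range := by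
  rw [← h.sub_specProj_eq hQ.isSelfAdjoint, trv,
    show Q - flatten Q = (Q - specProj Q c δ) - (flatten Q - specProj Q c δ) by abel,
    trace_sub (h.colSum_sub_specProj hQ) (h.colSum_flatten_sub hQ), (h.finrank_upper hQ).2]
  simp

/-- The rank of the whole window (a, c] is again the trace of a continuous function times the
defect, so it is almost additive even though its two parts, split at 1/2, need not be. -/
lemma HasGaps.finrank_add_finrank (h : HasGaps Q a α c δ) (hQ : Admissible b L κ Q) :
    (trace b (cfc (fun t => (step a α t - step c δ t) * invDefect t) Q * idemDefect Q)).re =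
      Module.finrank ℂ (specProj Q a α - flatten Q).range +
        Module.finrank ℂ (flatten Q - specProj Q c δ).range := by
  have h1 : specProj Q a α - flatten Q = (specProj Q a α - specProj Q c δ) -
    (flatten Q - specProj Q c δ) := by abel
  have h2 : colSum b (specProj Q a α - specProj Q c δ) ≠ ⊤ := by
    rw [h.window_eq hQ.isSelfAdjoint]
    exact hQ.colSum_mul_defect_ne_top _
  have h3 := trace_sub h2 (h.colSum_flatten_sub hQ)
  rw [← h1, (h.finrank_lower hQ).2, (h.finrank_upper hQ).2,
    h.window_eq hQ.isSelfAdjoint] at h3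
  have h4 := congrArg Complex.re h3
  simp only [Complex.natCast_re, Complex.sub_re] at h4
  linarith

/-! ### Comparison of ranks -/

/-- If the form `B` is nonpositive on the kernel of `R`, but approximately positive on the sum of
the almost orthogonal ranges of `R₁` and `R₂`, then `R` has at least the rank of `R₁` and `R₂`
together. -/
lemma finrank_add_le {R R₁ R₂ B B₁ B₂ : H →L[ℂ] H} [FiniteDimensional ℂ R.range]
    [FiniteDimensional ℂ R₁.range] [FiniteDimensional ℂ R₂.range] {γ η : ℝ}
    (hB : IsSelfAdjoint B)
    (hneg : ∀ v, R v = 0 → (inner ℂ v (B v) : ℂ).re ≤ 0)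
    (hpos₁ : ∀ v ∈ R₁.range, γ * ‖v‖ ^ 2 ≤ (inner ℂ v (B₁ v) : ℂ).re)
    (hpos₂ : ∀ v ∈ R₂.range, γ * ‖v‖ ^ 2 ≤ (inner ℂ v (B₂ v) : ℂ).re)
    (hclose₁ : ∀ v ∈ R₁.range, ‖B v - B₁ v‖ ≤ η * ‖v‖)
    (hclose₂ : ∀ v ∈ R₂.range, ‖B v - B₂ v‖ ≤ η * ‖v‖)
    (hcross : ∀ v ∈ R₁.range, ∀ w ∈ R₂.range, ‖(inner ℂ v (B w) : ℂ)‖ ≤ η * ‖v‖ * ‖w‖)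
    (hγ : 2 * η < γ) :
    Module.finrank ℂ R₁.range + Module.finrank ℂ R₂.range ≤ Module.finrank ℂ R.range := by
  have hform : ∀ {B' : H →L[ℂ] H} {v : H}, γ * ‖v‖ ^ 2 ≤ (inner ℂ v (B' v) : ℂ).re →
      ‖B v - B' v‖ ≤ η * ‖v‖ → (γ - η) * ‖v‖ ^ 2 ≤ (inner ℂ v (B v) : ℂ).re := by
    intro B' v h1 h2
    have h3 : (inner ℂ v (B v) : ℂ) = inner ℂ v (B' v) + inner ℂ v (B v - B' v) := by
      rw [← inner_add_right, add_sub_cancel]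
    have h4 := (Complex.abs_re_le_norm (inner ℂ v (B v - B' v) : ℂ)).trans
      ((norm_inner_le_norm _ _).trans (mul_le_mul_of_nonneg_left h2 (norm_nonneg v)))
    rw [h3, Complex.add_re]
    nlinarith [abs_le.mp h4]
  -- The map (v, w) ↦ R(v + w) is injective: on its kernel the form is nonpositive, but also at
  -- least (γ - 2η)(‖v‖² + ‖w‖²).
  let f : (R₁.range × R₂.range) →ₗ[ℂ] R.range :=
    (R.toLinearMap.rangeRestrict).comp
      (LinearMap.coprod R₁.range.subtype R₂.range.subtype)
  have hf : Function.Injective f := by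
    rw [← LinearMap.ker_eq_bot, LinearMap.ker_eq_bot']
    rintro ⟨⟨v, hv⟩, ⟨w, hw⟩⟩ h0
    have h1 : R (v + w) = 0 := congrArg Subtype.val h0
    have h2 := hneg _ h1
    have h3 := hform (hpos₁ v hv) (hclose₁ v hv)
    have h4 := hform (hpos₂ w hw) (hclose₂ w hw)
    have h5 := abs_le.mp ((Complex.abs_re_le_norm _).trans (hcross v hv w hw))
    have h6 : (inner ℂ w (B v) : ℂ).re = (inner ℂ v (B w) : ℂ).re := by
      rw [← inner_apply_left hB, ← inner_conj_symm, Complex.conj_re]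
    rw [map_add, inner_add_left, inner_add_right, inner_add_right] at h2
    simp only [Complex.add_re, h6] at h2
    have h7 : (γ - η) * ‖v‖ ^ 2 + (γ - η) * ‖w‖ ^ 2 - 2 * (η * ‖v‖ * ‖w‖) ≤ 0 := by linarith
    -- This square absorbs the cross term. If η is negative, the closeness hypotheses force both
    -- vectors to vanish.
    have hη : 0 ≤ η * (‖v‖ - ‖w‖) ^ 2 ∨ v = 0 ∧ w = 0 := by
      by_cases hη0 : 0 ≤ η
      · exact Or.inl (mul_nonneg hη0 (sq_nonneg _))
      · right
        constructor
        · by_contra hne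
          have := (norm_nonneg _).trans (hclose₁ v hv)
          nlinarith [norm_pos_iff.mpr hne]
        · by_contra hne
          have := (norm_nonneg _).trans (hclose₂ w hw)
          nlinarith [norm_pos_iff.mpr hne]
    have hvw : v = 0 ∧ w = 0 := by
      rcases hη with hη | h
      · have h8 : (γ - 2 * η) * (‖v‖ ^ 2 + ‖w‖ ^ 2) ≤ 0 := by nlinarith
        have h9 : ‖v‖ ^ 2 + ‖w‖ ^ 2 ≤ 0 := by
          by_contra! h
          nlinarith
        constructor
        · rw [← norm_eq_zero, ← sq_eq_zero_iff]
          nlinarith [sq_nonneg ‖v‖, sq_nonneg ‖w‖]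
        · rw [← norm_eq_zero, ← sq_eq_zero_iff]
          nlinarith [sq_nonneg ‖v‖, sq_nonneg ‖w‖]
      · exact h
    obtain ⟨rfl, rfl⟩ := hvw
    rfl
  have := LinearMap.finrank_le_finrank_of_injective hf
  rwa [Module.finrank_prod] at this

/-- The operator `(Q - a)(c - Q)`. -/
noncomputable def windowForm (a c : ℝ) (Q : H →L[ℂ] H) : H →L[ℂ] H := (a + c) • Q - Q * Q - (a * c) • 1

lemma windowForm_eq_cfc (hQ : IsSelfAdjoint Q) (a c : ℝ) :
    windowForm a c Q = cfc (fun t : ℝ => (t - a) * (c - t)) Q := by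
  rw [show (fun t : ℝ => (t - a) * (c - t)) = fun t => (a + c) * t - t * t - a * c by
    ext; ring]
  rw [cfc_sub (fun t : ℝ => (a + c) * t - t * t) (fun _ => a * c) Q (by fun_prop) (by fun_prop),
    cfc_sub (fun t : ℝ => (a + c) * t) (fun t => t * t) Q (by fun_prop) (by fun_prop),
    cfc_mul (fun t : ℝ => t) (fun t => t) Q, cfc_const_mul (a + c) (fun t : ℝ => t) Q,
    cfc_id' ℝ Q, cfc_const (a * c) Q, windowForm, Algebra.algebraMap_eq_smul_one]

lemma isSelfAdjoint_windowForm (hQ : IsSelfAdjoint Q) (a c : ℝ) :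
    IsSelfAdjoint (windowForm a c Q) := by
  rw [windowForm_eq_cfc hQ]
  exact isSelfAdjoint_cfc _ _

/-- On the window t - a ≥ α and c - t ≥ δ, so the form is bounded below by the product of the two
half-widths. -/
lemma re_inner_windowForm_nonneg (hQ : IsSelfAdjoint Q) (hα : 0 < α) (hδ : 0 < δ) (hac : a ≤ c)
    (ha : HasGap Q a α) (hc : HasGap Q c δ) {v : H}
    (hv : v ∈ (specProj Q a α - specProj Q c δ).range) :
    α * δ * ‖v‖ ^ 2 ≤ (inner ℂ v (windowForm a c Q v) : ℂ).re := by
  have hidem : (specProj Q a α - specProj Q c δ) * (specProj Q a α - specProj Q c δ)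
      = specProj Q a α - specProj Q c δ := by
    have hcont : Continuous fun t => step a α t - step c δ t :=
      (continuous_step a α).sub (continuous_step c δ)
    rw [specProj_sub_specProj, cfc_mul' hcont hcont]
    refine cfc_congr fun t ht => ?_
    rcases step_cases hα (ha t ht) with ⟨_, h1⟩ | ⟨_, h1⟩ <;>
      rcases step_cases hδ (hc t ht) with ⟨_, h2⟩ | ⟨_, h2⟩ <;> simp [h1, h2]
    linarith
  have hv' : (specProj Q a α - specProj Q c δ) v = v := by
    obtain ⟨u, rfl⟩ := hv
    exact congr($hidem u)
  have h1 := re_inner_cfc_nonneg (Q := Q)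
    (f := fun t => ((t - a) * (c - t) - α * δ) * (step a α t - step c δ t)) (fun t ht => by
      rcases step_cases hα (ha t ht) with ⟨h3, h1⟩ | ⟨h3, h1⟩ <;>
        rcases step_cases hδ (hc t ht) with ⟨h4, h2⟩ | ⟨h4, h2⟩
      · simp [h1, h2]
      · linarith
      · rw [h1, h2]
        nlinarith
      · simp [h1, h2]) v
  have hcont : Continuous fun t => step a α t - step c δ t :=
    (continuous_step a α).sub (continuous_step c δ)
  rw [cfc_mul (fun t : ℝ => (t - a) * (c - t) - α * δ) (fun t => step a α t - step c δ t) Q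
    (by fun_prop) hcont.continuousOn, ← specProj_sub_specProj, mul_apply_eq_comp, hv',
    cfc_sub (fun t : ℝ => (t - a) * (c - t)) (fun _ => α * δ) Q (by fun_prop) (by fun_prop),
    ← windowForm_eq_cfc hQ, cfc_const (α * δ) Q, Algebra.algebraMap_eq_smul_one] at h1
  have h2 : (inner ℂ v (((α * δ : ℝ) • (1 : H →L[ℂ] H)) v) : ℂ).re = α * δ * ‖v‖ ^ 2 := by
    rw [smul_apply, one_apply_eq_self,
      ← Complex.coe_smul, inner_smul_right, inner_self_eq_norm_sq_to_K, Complex.re_ofReal_mul]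
    norm_cast
  rw [sub_apply, inner_sub_right, Complex.sub_re, h2] at h1
  linarith

end Ranks

/-! ### Variational comparison at 1/2 and additivity of the vertex trace -/

section Ranks

variable {ι H : Type*} [NormedAddCommGroup H] [InnerProductSpace ℂ H] [CompleteSpace H]
  {b : HilbertBasis ι ℂ H} {L κ ε : ℝ≥0} {Q S Q₁ Q₂ : H →L[ℂ] H} {a α c δ γ : ℝ}

/-- Without a component in (1/2, c], only t ≤ 1/2 and t > c are tested, where (t - 1/2)(c - t) ≤ 0.
No gap of `S` at 1/2 is available, so the split there uses positive and negative parts instead of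
continuous projections. -/
lemma re_inner_windowForm_upper_nonpos (hS : IsSelfAdjoint S) (hδ : 0 < δ) (hc : HasGap S c δ)
    (hcδ : 1 / 2 ≤ c) {v : H} (hv : (flatten S - specProj S c δ) v = 0) :
    (inner ℂ v (windowForm (1 / 2) c S v) : ℂ).re ≤ 0 := by
  have hstep := continuous_step c δ
  have h1 : posHalf S v = posHalf S (specProj S c δ v) := by
    rw [← posHalf_mul_flatten, mul_apply_eq_comp, mul_apply_eq_comp]
    rw [sub_apply, sub_eq_zero] at hv
    have h2 := congr($(flatten_mul_specProj hδ hc hcδ) v)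
    rw [mul_apply_eq_comp] at h2
    rw [h2, hv]
  have h2 : windowForm (1 / 2) c S v =
      cfc (fun t : ℝ => -(max (1 / 2 - t) 0 * (c - t))) S v +
        cfc (fun t : ℝ => (c - t) * (max (t - 1 / 2) 0 * step c δ t)) S v := by
    rw [windowForm_eq_cfc hS,
      cfc_mul (fun t : ℝ => c - t) (fun t => max (t - 1 / 2) 0 * step c δ t) S (by fun_prop)
        (by fun_prop),
      cfc_mul (fun t : ℝ => max (t - 1 / 2) 0) (step c δ) S (by fun_prop) (by fun_prop),
      mul_apply_eq_comp, mul_apply_eq_comp, ← specProj, ← posHalf, ← h1, posHalf,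
      ← mul_apply_eq_comp, cfc_mul' (f := fun t => c - t) (by fun_prop) (by fun_prop), ← add_apply,
      ← cfc_add S (fun t : ℝ => -(max (1 / 2 - t) 0 * (c - t)))
        (fun t => (c - t) * max (t - 1 / 2) 0) (by fun_prop) (by fun_prop)]
    congr 2
    ext t
    rcases le_total t (1 / 2) with h | h
    · rw [max_eq_right (by linarith : t - 1 / 2 ≤ 0), max_eq_left (by linarith : 0 ≤ 1 / 2 - t)]
      ring
    · rw [max_eq_left (by linarith : 0 ≤ t - 1 / 2), max_eq_right (by linarith : 1 / 2 - t ≤ 0)]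
      ring
  rw [h2, inner_add_right, Complex.add_re]
  refine add_nonpos (re_inner_cfc_nonpos (fun t _ => ?_) v) (re_inner_cfc_nonpos (fun t ht => ?_) v)
  · rcases le_total t (1 / 2) with h | h
    · rw [max_eq_left (by linarith : 0 ≤ 1 / 2 - t)]
      nlinarith
    · rw [max_eq_right (by linarith : 1 / 2 - t ≤ 0)]
      simp
  · rcases step_cases hδ (hc t ht) with ⟨_, h⟩ | ⟨h', h⟩
    · simp [h]
    · rw [h, max_eq_left (by linarith)]
      nlinarith

lemma negHalf_mul_flatten (S : H →L[ℂ] H) :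
    cfc (fun t : ℝ => max (1 / 2 - t) 0) S * flatten S = 0 := by
  have h : flatten S * cfc (fun t : ℝ => max (1 / 2 - t) 0) S = 0 := by
    refine flatten_mul_eq_zero ?_
    rw [posHalf, cfc_mul' (by fun_prop) (by fun_prop), ← cfc_const_zero ℝ S]
    refine cfc_congr fun t _ => ?_
    rcases le_total t (1 / 2) with h | h
    · simp only [max_eq_right (by linarith : t - 1 / 2 ≤ 0), zero_mul]
    · simp only [max_eq_right (by linarith : 1 / 2 - t ≤ 0), mul_zero]
  have h2 := congrArg star h
  rwa [star_mul, star_zero, (isSelfAdjoint_cfc _ _).star_eq,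
    (isStarProjection_flatten S).isSelfAdjoint.star_eq] at h2

/-- Mirror image of the upper case, with the positive part of 1/2 - S in place of `posHalf` and the
spectrum in (a, 1/2] excluded. -/
lemma re_inner_windowForm_lower_nonpos (hS : IsSelfAdjoint S) (hα : 0 < α) (ha : HasGap S a α)
    (haα : a ≤ 1 / 2) {v : H} (hv : (specProj S a α - flatten S) v = 0) :
    (inner ℂ v (windowForm a (1 / 2) S v) : ℂ).re ≤ 0 := by
  have hstep := continuous_step a α
  have h1 : cfc (fun t : ℝ => max (1 / 2 - t) 0) S v =
      cfc (fun t : ℝ => max (1 / 2 - t) 0) S ((1 - specProj S a α) v) := by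
    have h2 := congr($(negHalf_mul_flatten S) v)
    rw [sub_apply, sub_eq_zero] at hv
    rw [sub_apply, hv, one_apply_eq_self, map_sub, ← mul_apply_eq_comp _ (flatten S), h2]
    simp
  have h2 : windowForm a (1 / 2) S v =
      cfc (fun t : ℝ => -(max (t - 1 / 2) 0 * (t - a))) S v +
        cfc (fun t : ℝ => (t - a) * (max (1 / 2 - t) 0 * (1 - step a α t))) S v := by
    rw [windowForm_eq_cfc hS,
      cfc_mul (fun t : ℝ => t - a) (fun t => max (1 / 2 - t) 0 * (1 - step a α t)) S
        (by fun_prop) (by fun_prop),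
      cfc_mul (fun t : ℝ => max (1 / 2 - t) 0) (fun t => 1 - step a α t) S
        (by fun_prop) (by fun_prop),
      mul_apply_eq_comp, mul_apply_eq_comp, ← one_sub_specProj hS, ← h1,
      ← mul_apply_eq_comp, cfc_mul' (f := fun t => t - a) (by fun_prop) (by fun_prop), ← add_apply,
      ← cfc_add S (fun t : ℝ => -(max (t - 1 / 2) 0 * (t - a)))
        (fun t => (t - a) * max (1 / 2 - t) 0) (by fun_prop) (by fun_prop)]
    congr 2
    ext t
    rcases le_total t (1 / 2) with h | h
    · rw [max_eq_right (by linarith : t - 1 / 2 ≤ 0), max_eq_left (by linarith : 0 ≤ 1 / 2 - t)]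
      ring
    · rw [max_eq_left (by linarith : 0 ≤ t - 1 / 2), max_eq_right (by linarith : 1 / 2 - t ≤ 0)]
      ring
  rw [h2, inner_add_right, Complex.add_re]
  refine add_nonpos (re_inner_cfc_nonpos (fun t _ => ?_) v) (re_inner_cfc_nonpos (fun t ht => ?_) v)
  · rcases le_total t (1 / 2) with h | h
    · rw [max_eq_right (by linarith : t - 1 / 2 ≤ 0)]
      simp
    · rw [max_eq_left (by linarith : 0 ≤ t - 1 / 2)]
      nlinarith
  · rcases step_cases hα (ha t ht) with ⟨h', h⟩ | ⟨h', h⟩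
    · rw [h, max_eq_left (by linarith)]
      nlinarith
    · simp [h]

/-- A vector of the window is in the range of the defect with a controlled preimage, since |1/(t² -
t)| ≤ 16/3 there. This turns bounds on operators of the form T Δ(Q) into bounds for T on the window.
-/
lemma mem_range_window (hQ : IsSelfAdjoint Q) (hα : 0 < α) (hδ : 0 < δ) (ha : HasGap Q a α)
    (hc : HasGap Q c δ) (h1 : 1 / 4 ≤ a + α) (h2 : c - δ ≤ 3 / 4) (hac : a ≤ c) {v : H}
    (hv : v ∈ (specProj Q a α - specProj Q c δ).range) :
    ∃ u, v = idemDefect Q u ∧ ‖u‖ ≤ 16 / 3 * ‖v‖ := by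
  have hw : Continuous fun t => step a α t - step c δ t :=
    (continuous_step a α).sub (continuous_step c δ)
  have hw' : Continuous fun t => invDefect t * (step a α t - step c δ t) :=
    continuous_invDefect.mul hw
  have h : specProj Q a α - specProj Q c δ =
      idemDefect Q * (cfc invDefect Q * (specProj Q a α - specProj Q c δ)) := by
    rw [specProj_sub_specProj, idemDefect_eq_cfc hQ, cfc_mul' continuous_invDefect hw,
      cfc_mul' (by fun_prop) hw']
    refine cfc_congr fun t ht => ?_
    have := window_eq hα hδ h1 h2 hac (ha t ht) (hc t ht)
    linear_combination this
  obtain ⟨w, rfl⟩ := hv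
  refine ⟨cfc invDefect Q ((specProj Q a α - specProj Q c δ) w), congr($h w), ?_⟩
  exact (ContinuousLinearMap.le_opNorm _ _).trans (mul_le_mul_of_nonneg_right
    (norm_cfc_le (by norm_num) fun t _ => abs_invDefect_le t) (norm_nonneg _))

omit [CompleteSpace H] in
lemma norm_le_of_colSum_le {T : H →L[ℂ] H} {r : ℝ≥0} (h : colSum b T ≤ r) : ‖T‖ ≤ r := by
  have h1 := (enorm_le_colSum b T).trans h
  rw [enorm_eq_nnnorm] at h1
  exact_mod_cast h1

omit [CompleteSpace H] in
lemma commute_idemDefect (Q : H →L[ℂ] H) : Commute Q (idemDefect Q) :=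
  ((Commute.refl Q).mul_right (Commute.refl Q)).sub_right (Commute.refl Q)

omit [CompleteSpace H] in
lemma commute_windowForm {T : H →L[ℂ] H} (h : Commute Q T) (a c : ℝ) :
    Commute (windowForm a c Q) T :=
  ((h.smul_left _).sub_left (h.mul_left h)).sub_left ((Commute.one_left T).smul_left _)

lemma Admissible.norm_windowForm_le (hQ : Admissible b L κ Q) (ha : 0 ≤ a) (ha' : a ≤ 1)
    (hc : 0 ≤ c) (hc' : c ≤ 1) : ‖windowForm a c Q‖ ≤ ((L : ℝ) + 1) ^ 2 := by
  have h1 : ‖(a + c) • Q‖ ≤ 2 * L := by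
    rw [norm_smul, Real.norm_of_nonneg (by linarith)]
    exact mul_le_mul (by linarith) hQ.norm_le (norm_nonneg _) (by norm_num)
  have h2 : ‖Q * Q‖ ≤ L * L :=
    (norm_mul_le Q Q).trans (mul_le_mul hQ.norm_le hQ.norm_le (norm_nonneg _) L.2)
  have h3 : ‖(a * c) • (1 : H →L[ℂ] H)‖ ≤ 1 := by
    rw [norm_smul, Real.norm_of_nonneg (by positivity)]
    exact mul_le_one₀ (mul_le_one₀ ha' hc hc') (norm_nonneg _) ContinuousLinearMap.norm_id_le
  calc _ ≤ 2 * (L : ℝ) + L * L + 1 := (norm_sub_le _ _).trans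
        (add_le_add ((norm_sub_le _ _).trans (add_le_add h1 h2)) h3)
    _ = ((L : ℝ) + 1) ^ 2 := by ring

/-- With v = Δ(Q)u both (S - Q)v and (S - Q)Qv are small, the latter because `Q` commutes with its
defect; then S² - Q² = S(S - Q) + (S - Q)Q. -/
lemma norm_windowForm_sub_le (hS : Admissible b L κ S) (hQ : Admissible b L κ Q)
    (h : colSum b ((S - Q) * idemDefect Q) ≤ ε) (ha : 0 ≤ a) (ha' : a ≤ 1)
    (hc : 0 ≤ c) (hc' : c ≤ 1) {v u : H} (hvu : v = idemDefect Q u) (hu : ‖u‖ ≤ 16 / 3 * ‖v‖) :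
    ‖windowForm a c S v - windowForm a c Q v‖ ≤ 32 / 3 * (L + 1) * ε * ‖v‖ := by
  have hn := norm_le_of_colSum_le h
  have hε : (0 : ℝ) ≤ ε := ε.2
  have hL : (0 : ℝ) ≤ L := L.2
  have h0 : ∀ w, ‖(S - Q) (idemDefect Q w)‖ ≤ ε * ‖w‖ := fun w =>
    (((S - Q) * idemDefect Q).le_opNorm w).trans
      (mul_le_mul_of_nonneg_right hn (norm_nonneg _))
  have h1 : ‖(S - Q) v‖ ≤ ε * (16 / 3 * ‖v‖) := by
    conv_lhs => rw [hvu]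
    exact (h0 u).trans (mul_le_mul_of_nonneg_left hu hε)
  have h2 : ‖(S - Q) (Q v)‖ ≤ ε * (L * (16 / 3 * ‖v‖)) := by
    have h3 : Q v = idemDefect Q (Q u) := by
      rw [hvu]
      exact congr($((commute_idemDefect Q).eq) u)
    rw [h3]
    refine (h0 _).trans (mul_le_mul_of_nonneg_left ?_ hε)
    exact (Q.le_opNorm u).trans (mul_le_mul hQ.norm_le hu (norm_nonneg _) hL)
  have h4 : ‖S ((S - Q) v)‖ ≤ L * (ε * (16 / 3 * ‖v‖)) :=
    (S.le_opNorm _).trans (mul_le_mul hS.norm_le h1 (norm_nonneg _) hL)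
  have h5 : windowForm a c S v - windowForm a c Q v
      = (a + c) • (S - Q) v - (S ((S - Q) v) + (S - Q) (Q v)) := by
    simp only [windowForm, sub_apply, smul_apply, mul_apply_eq_comp, map_sub, smul_sub]
    abel
  have h6 : ‖(a + c) • (S - Q) v‖ ≤ 2 * (ε * (16 / 3 * ‖v‖)) := by
    rw [norm_smul, Real.norm_of_nonneg (by linarith)]
    exact mul_le_mul (by linarith) h1 (norm_nonneg _) (by norm_num)
  rw [h5]
  calc _ ≤ 2 * (ε * (16 / 3 * ‖v‖)) + (L * (ε * (16 / 3 * ‖v‖)) + ε * (L * (16 / 3 * ‖v‖))) :=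
        (norm_sub_le _ _).trans (add_le_add h6 ((norm_add_le _ _).trans (add_le_add h4 h2)))
    _ = _ := by ring

/-- On w the operator `S` may be replaced by `Q₂`, whose form commutes with Δ(Q₂). What remains is
⟨Δ(Q₁)u, Δ(Q₂)z'⟩ = ⟨u, Δ(Q₁)Δ(Q₂)z'⟩, which is small. The constants add up to 256/9 + 32/3 < 40. -/
lemma norm_inner_windowForm_le (hS : Admissible b L κ S) (h₁ : Admissible b L κ Q₁)
    (h₂ : Admissible b L κ Q₂) (h : IsSuperposition b ε S Q₁ Q₂) (ha : 0 ≤ a) (ha' : a ≤ 1)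
    (hc : 0 ≤ c) (hc' : c ≤ 1) {v u w z : H} (hvu : v = idemDefect Q₁ u)
    (hu : ‖u‖ ≤ 16 / 3 * ‖v‖) (hwz : w = idemDefect Q₂ z) (hz : ‖z‖ ≤ 16 / 3 * ‖w‖) :
    ‖(inner ℂ v (windowForm a c S w) : ℂ)‖ ≤ 40 * (L + 1) ^ 2 * ε * ‖v‖ * ‖w‖ := by
  have hε : (0 : ℝ) ≤ ε := ε.2
  have hL : (0 : ℝ) ≤ L := L.2
  have h3 := norm_windowForm_sub_le hS h₂ h.sub_mul_le₂ ha ha' hc hc' hwz hz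
  have h4 : windowForm a c Q₂ w = idemDefect Q₂ (windowForm a c Q₂ z) := by
    rw [hwz]
    exact congr($((commute_windowForm (commute_idemDefect Q₂) a c).eq) z)
  have h5 : ‖(inner ℂ v (windowForm a c Q₂ w) : ℂ)‖
      ≤ (16 / 3 * ‖v‖) * (ε * ((L + 1) ^ 2 * (16 / 3 * ‖w‖))) := by
    rw [h4, hvu, inner_apply_left (isSelfAdjoint_idemDefect h₁.isSelfAdjoint), ← hvu]
    refine (norm_inner_le_norm _ _).trans (mul_le_mul hu ?_ (norm_nonneg _) (by positivity))
    refine ((idemDefect Q₁ * idemDefect Q₂).le_opNorm _).trans ?_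
    refine mul_le_mul (norm_le_of_colSum_le h.mul_le) ?_ (norm_nonneg _) hε
    exact (ContinuousLinearMap.le_opNorm _ _).trans
      (mul_le_mul (h₂.norm_windowForm_le ha ha' hc hc') hz (norm_nonneg _) (by positivity))
  have h6 : (inner ℂ v (windowForm a c S w) : ℂ) = inner ℂ v (windowForm a c Q₂ w) +
      inner ℂ v (windowForm a c S w - windowForm a c Q₂ w) := by
    rw [← inner_add_right, add_sub_cancel]
  rw [h6]
  calc _ ≤ (16 / 3 * ‖v‖) * (ε * ((L + 1) ^ 2 * (16 / 3 * ‖w‖)))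
        + ‖v‖ * (32 / 3 * (L + 1) * ε * ‖w‖) := (norm_add_le _ _).trans (add_le_add h5
          ((norm_inner_le_norm _ _).trans (mul_le_mul_of_nonneg_left h3 (norm_nonneg _))))
    _ = (256 / 9 * (L + 1) ^ 2 + 32 / 3 * (L + 1)) * (ε * ‖v‖ * ‖w‖) := by ring
    _ ≤ (40 * (L + 1) ^ 2) * (ε * ‖v‖ * ‖w‖) :=
        mul_le_mul_of_nonneg_right (by nlinarith) (by positivity)
    _ = _ := by ring

/-- The rank of a spectral window of a superposition, compared with the sum of the ranks. -/
lemma IsSuperposition.finrank_add_le (hS : Admissible b L κ S) (h₁ : Admissible b L κ Q₁)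
    (h₂ : Admissible b L κ Q₂) (h : IsSuperposition b ε S Q₁ Q₂)
    (hα : 0 < α) (hδ : 0 < δ) (ha : 1 / 4 ≤ a) (hac : a ≤ c) (hc : c ≤ 3 / 4)
    (ha₁ : HasGap Q₁ a α) (hc₁ : HasGap Q₁ c δ) (ha₂ : HasGap Q₂ a α) (hc₂ : HasGap Q₂ c δ)
    {R : H →L[ℂ] H} [FiniteDimensional ℂ R.range]
    [FiniteDimensional ℂ (specProj Q₁ a α - specProj Q₁ c δ).range]
    [FiniteDimensional ℂ (specProj Q₂ a α - specProj Q₂ c δ).range]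
    (hR : ∀ v, R v = 0 → (inner ℂ v (windowForm a c S v) : ℂ).re ≤ 0)
    (hε : 80 * ((L : ℝ) + 1) ^ 2 * ε < α * δ) :
    Module.finrank ℂ (specProj Q₁ a α - specProj Q₁ c δ).range +
      Module.finrank ℂ (specProj Q₂ a α - specProj Q₂ c δ).range ≤
        Module.finrank ℂ R.range := by
  have hε0 : (0 : ℝ) ≤ ε := ε.2
  have hL : (0 : ℝ) ≤ L := L.2
  have hle : 32 / 3 * ((L : ℝ) + 1) * ε ≤ 40 * ((L : ℝ) + 1) ^ 2 * ε :=
    mul_le_mul_of_nonneg_right (by nlinarith) hε0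
  refine HalfFlux.finrank_add_le (γ := α * δ) (η := 40 * ((L : ℝ) + 1) ^ 2 * ε)
    (isSelfAdjoint_windowForm hS.isSelfAdjoint a c) hR
    (fun v hv => re_inner_windowForm_nonneg h₁.isSelfAdjoint hα hδ hac ha₁ hc₁ hv)
    (fun v hv => re_inner_windowForm_nonneg h₂.isSelfAdjoint hα hδ hac ha₂ hc₂ hv)
    (fun v hv => ?_) (fun v hv => ?_) (fun v hv w hw => ?_) (by linarith)
  · obtain ⟨u, h3, h4⟩ := mem_range_window h₁.isSelfAdjoint hα hδ ha₁ hc₁ (by linarith)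
      (by linarith) hac hv
    exact (norm_windowForm_sub_le hS h₁ h.sub_mul_le₁ (by linarith) (by linarith) (by linarith)
      (by linarith) h3 h4).trans (mul_le_mul_of_nonneg_right hle (norm_nonneg _))
  · obtain ⟨u, h3, h4⟩ := mem_range_window h₂.isSelfAdjoint hα hδ ha₂ hc₂ (by linarith)
      (by linarith) hac hv
    exact (norm_windowForm_sub_le hS h₂ h.sub_mul_le₂ (by linarith) (by linarith) (by linarith)
      (by linarith) h3 h4).trans (mul_le_mul_of_nonneg_right hle (norm_nonneg _))
  · obtain ⟨u, h3, h4⟩ := mem_range_window h₁.isSelfAdjoint hα hδ ha₁ hc₁ (by linarith)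
      (by linarith) hac hv
    obtain ⟨z, h5, h6⟩ := mem_range_window h₂.isSelfAdjoint hα hδ ha₂ hc₂ (by linarith)
      (by linarith) hac hw
    exact norm_inner_windowForm_le hS h₁ h₂ h (by linarith) (by linarith) (by linarith)
      (by linarith) h3 h4 h5 h6

lemma exists_pos_forall_le {J : Type*} [Finite J] (f : J → ℝ≥0) (hf : ∀ j, 0 < f j) :
    ∃ ε : ℝ≥0, 0 < ε ∧ ∀ j, ε ≤ f j := by
  rcases isEmpty_or_nonempty J with h | h
  · exact ⟨1, one_pos, fun j => h.elim j⟩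
  · obtain ⟨j, hj⟩ := Finite.exists_min f
    exact ⟨f j, hf j, hj⟩

omit [CompleteSpace H] in
lemma abs_trace_sub_le {T T₁ T₂ : H →L[ℂ] H} (hT : colSum b T ≠ ⊤) (h₁ : colSum b T₁ ≠ ⊤)
    (h₂ : colSum b T₂ ≠ ⊤) {r : ℝ≥0} (h : colSum b (T - T₁ - T₂) ≤ r) :
    |(trace b T).re - (trace b T₁).re - (trace b T₂).re| ≤ r := by
  have h3 : colSum b (T - T₁) ≠ ⊤ :=
    ne_top_of_le_ne_top (ENNReal.add_ne_top.mpr ⟨hT, h₁⟩) (colSum_sub_le b _ _)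
  have h4 := norm_trace_le (b := b) r.2 (h.trans_eq (ENNReal.ofReal_coe_nnreal (p := r)).symm)
  rw [trace_sub h3 h₂, trace_sub hT h₁] at h4
  exact (Complex.abs_re_le_norm _).trans h4

/-- **Additivity of the vertex trace for superpositions**: up to integers, which count the
eigenvalues between `1/2` and a gap `c`. -/
theorem exists_trv_additive (L κ : ℝ≥0) : ∃ ν : ℝ, 0 < ν ∧ ∀ η : ℝ≥0, 0 < η →
    ∃ ε₀ : ℝ≥0, 0 < ε₀ ∧
    ∀ {ι H : Type*} [NormedAddCommGroup H] [InnerProductSpace ℂ H] [CompleteSpace H]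
      (b : HilbertBasis ι ℂ H) (S Q₁ Q₂ : H →L[ℂ] H) (ε : ℝ≥0), Admissible b L κ S →
      Admissible b L κ Q₁ → Admissible b L κ Q₂ → IsSuperposition b ε S Q₁ Q₂ → ε ≤ ε₀ →
      ∃ a α c δ : ℝ, HasGaps S a α c δ ∧ HasGaps Q₁ a α c δ ∧ HasGaps Q₂ a α c δ ∧
        |trv b S - (trv b Q₁ + trv b Q₂) -
          ((Module.finrank ℂ (flatten Q₁ - specProj Q₁ c δ).range : ℝ)
            + Module.finrank ℂ (flatten Q₂ - specProj Q₂ c δ).range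
            - Module.finrank ℂ (flatten S - specProj S c δ).range)| ≤ η ∧
        ∀ γ : ℝ, 0 < γ → HasGap Q₁ (1 / 2) γ → HasGap Q₂ (1 / 2) γ →
          80 * ((L : ℝ) + 1) ^ 2 * ε < γ * ν →
          Module.finrank ℂ (flatten S - specProj S c δ).range =
            Module.finrank ℂ (flatten Q₁ - specProj Q₁ c δ).range +
            Module.finrank ℂ (flatten Q₂ - specProj Q₂ c δ).range := by
  -- The candidates for the gaps form finite lists fixed by κ alone, so a single ε₀ serves all of
  -- them.
  obtain ⟨N, cs, δ, hδ, hcs, hgap⟩ :=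
    exists_common_gap κ (α := 1 / 2) (β := 3 / 4) (by norm_num) (by norm_num) le_rfl
  obtain ⟨M, as, α, hα, has, hgap'⟩ :=
    exists_common_gap κ (α := 1 / 4) (β := 1 / 2) le_rfl (by norm_num) (by norm_num)
  refine ⟨min α δ, lt_min hα hδ, fun η hη => ?_⟩
  choose f hf0 hf using fun j => exists_colSum_cfc_le L κ (continuous_defectQuot (cs j) δ) hη
  have hcont : ∀ p : Fin M × Fin N, Continuous fun t =>
      (step (as p.1) α t - step (cs p.2) δ t) * invDefect t := fun p =>
    ((continuous_step _ _).sub (continuous_step _ _)).mul continuous_invDefect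
  -- The traces to be compared are integers, so any tolerance below one is enough.
  choose g hg0 hg using fun p => exists_colSum_cfc_le L κ (hcont p) (η := 1 / 2) (by simp)
  obtain ⟨ε₁, hε₁, hf'⟩ := exists_pos_forall_le f hf0
  obtain ⟨ε₂, hε₂, hg'⟩ := exists_pos_forall_le g hg0
  refine ⟨min ε₁ ε₂, lt_min hε₁ hε₂, ?_⟩
  intro ι H _ _ _ b S Q₁ Q₂ ε hS h₁ h₂ h hε
  have hadm : ∀ i, Admissible b L κ (![S, Q₁, Q₂] i) := fun i => by
    fin_cases i
    exacts [hS, h₁, h₂]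
  obtain ⟨j, hj⟩ := hgap b L ![S, Q₁, Q₂] hadm
  obtain ⟨i, hi⟩ := hgap' b L ![S, Q₁, Q₂] hadm
  have hgaps : ∀ k, HasGaps (![S, Q₁, Q₂] k) (as i) α (cs j) δ := fun k =>
    ⟨hα, hδ, (has i).1, (has i).2, (hcs j).1, (hcs j).2, hi k, hj k⟩
  have gS : HasGaps S (as i) α (cs j) δ := hgaps 0
  have g₁ : HasGaps Q₁ (as i) α (cs j) δ := hgaps 1
  have g₂ : HasGaps Q₂ (as i) α (cs j) δ := hgaps 2
  refine ⟨as i, α, cs j, δ, gS, g₁, g₂, ?_, fun γ hγ hγ₁ hγ₂ hlt => ?_⟩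
  · have h3 := abs_trace_sub_le (hS.colSum_mul_defect_ne_top _) (h₁.colSum_mul_defect_ne_top _)
      (h₂.colSum_mul_defect_ne_top _)
      (hf j b S Q₁ Q₂ ε hS h₁ h₂ h ((hε.trans (min_le_left _ _)).trans (hf' j)))
    rw [gS.trv_eq hS, g₁.trv_eq h₁, g₂.trv_eq h₂]
    refine le_of_eq_of_le ?_ h3
    congr 1
    ring
  · have h3 := abs_trace_sub_le (hS.colSum_mul_defect_ne_top _) (h₁.colSum_mul_defect_ne_top _)
      (h₂.colSum_mul_defect_ne_top _)
      (hg (i, j) b S Q₁ Q₂ ε hS h₁ h₂ h ((hε.trans (min_le_right _ _)).trans (hg' (i, j))))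
    rw [gS.finrank_add_finrank hS, g₁.finrank_add_finrank h₁, g₂.finrank_add_finrank h₂] at h3
    have dS := (gS.finrank_upper hS).1
    have d₁ := (g₁.finrank_upper h₁).1
    have d₂ := (g₂.finrank_upper h₂).1
    have dS' := (gS.finrank_lower hS).1
    have d₁' := (g₁.finrank_lower h₁).1
    have d₂' := (g₂.finrank_lower h₂).1
    -- With a gap at 1/2 the windows (a, 1/2] and (1/2, c] of `Q₁` and `Q₂` are bounded by gaps on
    -- both sides, as the variational comparison requires.
    have e₁ := flatten_eq_specProj h₁.isSelfAdjoint hγ hγ₁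
    have e₂ := flatten_eq_specProj h₂.isSelfAdjoint hγ hγ₂
    have hup : Module.finrank ℂ (flatten Q₁ - specProj Q₁ (cs j) δ).range +
        Module.finrank ℂ (flatten Q₂ - specProj Q₂ (cs j) δ).range ≤
        Module.finrank ℂ (flatten S - specProj S (cs j) δ).range := by
      rw [e₁] at d₁ ⊢
      rw [e₂] at d₂ ⊢
      refine IsSuperposition.finrank_add_le hS h₁ h₂ h hγ hδ (by norm_num)
        (by linarith [gS.le_upper]) (by linarith [gS.upper_le]) hγ₁ g₁.upper hγ₂ g₂.upper
        (fun v hv => re_inner_windowForm_upper_nonpos hS.isSelfAdjoint hδ gS.upper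
          (by linarith [gS.le_upper]) hv)
        (hlt.trans_le (mul_le_mul_of_nonneg_left (min_le_right _ _) hγ.le))
    have hlow : Module.finrank ℂ (specProj Q₁ (as i) α - flatten Q₁).range +
        Module.finrank ℂ (specProj Q₂ (as i) α - flatten Q₂).range ≤
        Module.finrank ℂ (specProj S (as i) α - flatten S).range := by
      rw [e₁] at d₁' ⊢
      rw [e₂] at d₂' ⊢
      refine IsSuperposition.finrank_add_le hS h₁ h₂ h hα hγ (by linarith [gS.quarter_le])
        (by linarith [gS.lower_le]) (by norm_num) g₁.lower hγ₁ g₂.lower hγ₂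
        (fun v hv => re_inner_windowForm_lower_nonpos hS.isSelfAdjoint hα gS.lower
          (by linarith [gS.lower_le]) hv) ?_
      rw [mul_comm α]
      exact hlt.trans_le (mul_le_mul_of_nonneg_left (min_le_left _ _) hγ.le)
    -- An excess of one above 1/2, together with the inequality below 1/2, would break the
    -- additivity of the total rank up to 1/2.
    by_contra hne
    have hlt' : Module.finrank ℂ (flatten Q₁ - specProj Q₁ (cs j) δ).range +
        Module.finrank ℂ (flatten Q₂ - specProj Q₂ (cs j) δ).range + 1 ≤
        Module.finrank ℂ (flatten S - specProj S (cs j) δ).range :=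
      lt_of_le_of_ne hup (Ne.symm hne)
    have h4 := (abs_le.mp h3).2
    have h5 : (_ : ℝ) ≤ _ := Nat.cast_le.mpr hlow
    have h6 : (_ : ℝ) ≤ _ := Nat.cast_le.mpr hlt'
    push_cast at h4 h5 h6
    linarith

end Ranks

/-! ### Time reversal and gauge transformations -/

section Symmetry

variable {ι H : Type*} [NormedAddCommGroup H] [InnerProductSpace ℂ H] [CompleteSpace H]
  {b : HilbertBasis ι ℂ H} {Q Q' : H →L[ℂ] H} {c δ : ℝ}

/-- Real linearity of `U` suffices because only polynomials with real coefficients occur; unitary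
and antiunitary symmetries are thus covered together. -/
lemma intertwine_cfc (hQ : IsSelfAdjoint Q) (hQ' : IsSelfAdjoint Q') (U : H ≃ₗᵢ[ℝ] H)
    (hU : ∀ v, U (Q v) = Q' (U v)) {f : ℝ → ℝ} (hf : Continuous f) (v : H) :
    U (cfc f Q v) = cfc f Q' (U v) := by
  have hpoly : ∀ (p : Polynomial ℝ) (v : H),
      U (Polynomial.aeval Q p v) = Polynomial.aeval Q' p (U v) := by
    intro p
    induction p using Polynomial.induction_on' with
    | add p q hp hq => intro v; simp only [map_add, add_apply, hp, hq]
    | monomial m a =>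
      intro v
      have hpow : ∀ (m : ℕ) (v : H), U ((Q ^ m) v) = (Q' ^ m) (U v) := by
        intro m
        induction m with
        | zero => intro v; simp
        | succ m ih => intro v; rw [pow_succ, pow_succ, mul_apply_eq_comp, mul_apply_eq_comp, ih, hU]
      simp only [Polynomial.aeval_monomial, Algebra.algebraMap_eq_smul_one, smul_mul_assoc,
        one_mul, smul_apply, map_smul, hpow]
  have hkey : ∀ η : ℝ, 0 < η → ‖U (cfc f Q v) - cfc f Q' (U v)‖ ≤ η * (2 * ‖v‖) := by
    intro η hη
    obtain ⟨p, hp⟩ := exists_polynomial_near_cfc hf (max ‖Q‖ ‖Q'‖) hη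
    have h1 : ∀ T : H →L[ℂ] H, IsSelfAdjoint T → ‖T‖ ≤ max ‖Q‖ ‖Q'‖ →
        ‖cfc f T - Polynomial.aeval T p‖ ≤ η := fun T hT hle => by
      rw [← cfc_polynomial p T hT, ← cfc_sub f p.eval T hf.continuousOn p.continuous.continuousOn]
      exact norm_cfc_le hη.le fun t ht => hp t ((IsometricContinuousFunctionalCalculus.norm_spectrum_le T ht hT).trans hle)
    have h2 : U (cfc f Q v) - cfc f Q' (U v) =
        U ((cfc f Q - Polynomial.aeval Q p) v) - (cfc f Q' - Polynomial.aeval Q' p) (U v) := by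
      rw [sub_apply, sub_apply, map_sub, hpoly]
      abel
    rw [h2]
    calc _ ≤ η * ‖v‖ + η * ‖v‖ := by
          refine (norm_sub_le _ _).trans (add_le_add ?_ ?_)
          · rw [U.norm_map]
            exact (ContinuousLinearMap.le_opNorm _ _).trans
              (mul_le_mul_of_nonneg_right (h1 Q hQ (le_max_left _ _)) (norm_nonneg _))
          · refine (ContinuousLinearMap.le_opNorm _ _).trans ?_
            rw [U.norm_map]
            exact mul_le_mul_of_nonneg_right (h1 Q' hQ' (le_max_right _ _)) (norm_nonneg _)
      _ = _ := by ring
  have hlim : ‖U (cfc f Q v) - cfc f Q' (U v)‖ ≤ 0 := by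
    refine le_of_forall_pos_le_add fun r hr => ?_
    rw [zero_add]
    refine (hkey (r / (2 * ‖v‖ + 1)) (by positivity)).trans ?_
    rw [div_mul_eq_mul_div, div_le_iff₀ (by positivity)]
    nlinarith
  exact sub_eq_zero.mp (norm_le_zero_iff.mp hlim)

/-- Flattening is reached through the kernel of `posHalf`, which is a continuous function of `Q`. A
real isometry preserves only the real part of the inner product; testing with I • u in the complex
subspace recovers the imaginary part. -/
lemma intertwine_flatten (hQ : IsSelfAdjoint Q) (hQ' : IsSelfAdjoint Q') (U : H ≃ₗᵢ[ℝ] H)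
    (hU : ∀ v, U (Q v) = Q' (U v)) (v : H) : U (flatten Q v) = flatten Q' (U v) := by
  have hY : ∀ w, U (posHalf Q w) = posHalf Q' (U w) :=
    intertwine_cfc hQ hQ' U hU (by fun_prop)
  let W := (posHalf Q).ker
  let W' := (posHalf Q').ker
  have hmem : ∀ {w}, w ∈ W → U w ∈ W' := fun {w} hw => by
    change posHalf Q' (U w) = 0
    rw [← hY, show posHalf Q w = 0 from hw, map_zero]
  have hmem' : ∀ {w}, U w ∈ W' → w ∈ W := fun {w} hw => by
    have h : posHalf Q' (U w) = 0 := hw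
    rw [← hY] at h
    exact (map_eq_zero_iff U U.injective).mp h
  have hre : ∀ x y : H, (inner ℂ (U x) (U y) : ℂ).re = (inner ℂ x y : ℂ).re := fun x y => by
    have h1 := norm_add_sq (𝕜 := ℂ) (U x) (U y)
    rw [← map_add, U.norm_map, U.norm_map, U.norm_map, norm_add_sq (𝕜 := ℂ) x y] at h1
    simp only [RCLike.re_to_complex] at h1
    linarith
  have horth : ∀ {w}, w ∈ Wᗮ → U w ∈ W'ᗮ := fun {w} hw => by
    have hzero : ∀ u ∈ W', (inner ℂ u (U w) : ℂ).re = 0 := fun u hu => by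
      obtain ⟨u, rfl⟩ := U.surjective u
      rw [hre, (Submodule.mem_orthogonal _ _).mp hw u (hmem' hu), Complex.zero_re]
    rw [Submodule.mem_orthogonal]
    intro u hu
    apply Complex.ext (hzero u hu)
    have := hzero (Complex.I • u) (W'.smul_mem _ hu)
    simpa [inner_smul_left] using this
  have hclosed : W.orthogonal.orthogonal = W := by
    have : CompleteSpace W := (posHalf Q).isClosed_ker.completeSpace_coe
    exact Submodule.orthogonal_orthogonal W
  refine (Submodule.eq_starProjection_of_mem_of_inner_eq_zero
    (horth (Submodule.starProjection_apply_mem _ v)) fun w hw => ?_).symm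
  rw [← map_sub]
  have h1 : v - Wᗮ.starProjection v ∈ Wᗮᗮ := Submodule.sub_starProjection_mem_orthogonal v
  rw [hclosed] at h1
  exact (Submodule.mem_orthogonal _ _).mp hw _ (hmem h1)

/-- An antiunitary operator, as a real linear isometry. -/
noncomputable def antiunitaryToReal (Θ : H ≃ₗᵢ⋆[ℂ] H) : H ≃ₗᵢ[ℝ] H where
  toFun := Θ
  invFun := Θ.symm
  left_inv := Θ.left_inv
  right_inv := Θ.right_inv
  map_add' := map_add Θ
  map_smul' r v := by
    simp only [RingHom.id_apply]
    rw [← Complex.coe_smul, ← Complex.coe_smul, map_smulₛₗ, Complex.conj_ofReal]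
  norm_map' := Θ.norm_map

/-- Kramers degeneracy of the spectral subspaces of a time-reversal symmetric operator. -/
lemma even_finrank_flatten_sub (hQ : IsSelfAdjoint Q) (Θ : H ≃ₗᵢ⋆[ℂ] H)
    (hΘ : ∀ v, Θ (Θ v) = -v) (hcomm : ∀ v, Θ (Q v) = Q (Θ v))
    [FiniteDimensional ℂ (flatten Q - specProj Q c δ).range] :
    Even (Module.finrank ℂ (flatten Q - specProj Q c δ).range) := by
  have h1 : ∀ v, Θ (flatten Q v) = flatten Q (Θ v) :=
    intertwine_flatten hQ hQ (antiunitaryToReal Θ) hcomm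
  have h2 : ∀ v, Θ (specProj Q c δ v) = specProj Q c δ (Θ v) :=
    intertwine_cfc hQ hQ (antiunitaryToReal Θ) hcomm (continuous_step c δ)
  have hmem : ∀ v ∈ (flatten Q - specProj Q c δ).range,
      Θ v ∈ (flatten Q - specProj Q c δ).range := by
    rintro _ ⟨v, rfl⟩
    refine ⟨Θ v, ?_⟩
    change (flatten Q - specProj Q c δ) (Θ v) = Θ ((flatten Q - specProj Q c δ) v)
    rw [sub_apply, sub_apply, map_sub, h1, h2]
  let T : (flatten Q - specProj Q c δ).range →ₛₗ[starRingEnd ℂ]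
      (flatten Q - specProj Q c δ).range :=
    { toFun := fun v => ⟨Θ v, hmem v v.2⟩
      map_add' := fun v w => Subtype.ext (map_add Θ _ _)
      map_smul' := fun r v => Subtype.ext (map_smulₛₗ Θ r _) }
  exact even_finrank_of_antilinear T fun v => Subtype.ext (hΘ v)

/-! ### Gauge transformations -/

omit [CompleteSpace H] in
lemma ext_inner_basis (b : HilbertBasis ι ℂ H) {v w : H}
    (h : ∀ x, (inner ℂ (b x) v : ℂ) = inner ℂ (b x) w) : v = w := by
  apply b.repr.injective
  ext x
  rw [b.repr_apply_apply, b.repr_apply_apply, h]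

omit [CompleteSpace H] in
lemma ext_basis (b : HilbertBasis ι ℂ H) {T T' : H →L[ℂ] H} (h : ∀ x, T (b x) = T' (b x)) :
    T = T' := by
  ext v
  refine (T.hasSum (b.hasSum_repr v)).unique ?_
  simp only [map_smul, h]
  simpa only [map_smul] using T'.hasSum (b.hasSum_repr v)

omit [CompleteSpace H] in
lemma ext_entry (b : HilbertBasis ι ℂ H) {T T' : H →L[ℂ] H}
    (h : ∀ x y, entry b T x y = entry b T' x y) : T = T' :=
  ext_basis b fun y => ext_inner_basis b fun x => h x y

lemma exists_diagonal_unitary (b : HilbertBasis ι ℂ H) {u : ι → ℂ} (hu : ∀ x, ‖u x‖ = 1) :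
    ∃ U : H ≃ₗᵢ[ℂ] H, ∀ x, U (b x) = u x • b x := by
  classical
  have hon : Orthonormal ℂ fun x => u x • b x := by
    refine ⟨fun x => by rw [norm_smul, hu, norm_basis, one_mul], fun x y hxy => ?_⟩
    simp only [inner_smul_left, inner_smul_right]
    rw [b.orthonormal.2 hxy, mul_zero, mul_zero]
  have hspan : ⊤ ≤ (Submodule.span ℂ (Set.range fun x => u x • b x)).topologicalClosure := by
    rw [← b.dense_span]
    refine Submodule.topologicalClosure_mono (Submodule.span_le.mpr ?_)
    rintro _ ⟨x, rfl⟩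
    have h0 : u x ≠ 0 := fun h => by simpa [h] using hu x
    have h1 : b x = (u x)⁻¹ • (u x • b x) := by rw [smul_smul, inv_mul_cancel₀ h0, one_smul]
    rw [SetLike.mem_coe, h1]
    exact Submodule.smul_mem _ _ (Submodule.subset_span ⟨x, rfl⟩)
  let b' := HilbertBasis.mk hon hspan
  refine ⟨b.repr.trans b'.repr.symm, fun x => ?_⟩
  rw [LinearIsometryEquiv.trans_apply, b.repr_self, b'.repr_symm_single]
  exact congrFun (HilbertBasis.coe_mk hon hspan) x

omit [CompleteSpace H] in
lemma inner_diagonal_unitary {u : ι → ℂ} (hu : ∀ x, ‖u x‖ = 1) {U : H ≃ₗᵢ[ℂ] H}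
    (hU : ∀ x, U (b x) = u x • b x) (x : ι) (v : H) :
    (inner ℂ (b x) (U v) : ℂ) = u x * inner ℂ (b x) v := by
  have h := U.inner_map_map (b x) v
  rw [hU, inner_smul_left] at h
  rw [← h, ← mul_assoc, Complex.mul_conj, Complex.normSq_eq_norm_sq, hu]
  simp

/-- Gauge equivalent operators have the same vertex trace and the same spectrum. -/
lemma gauge_invariance (hQ : IsSelfAdjoint Q) (hQ' : IsSelfAdjoint Q') {u : ι → ℂ}
    (hu : ∀ x, ‖u x‖ = 1)
    (h : ∀ x y, entry b Q' x y = u x * entry b Q x y * starRingEnd ℂ (u y)) :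
    trv b Q' = trv b Q ∧ spectrum ℝ Q' = spectrum ℝ Q := by
  obtain ⟨U, hU⟩ := exists_diagonal_unitary b hu
  have hUQ : U.toContinuousLinearEquiv.toContinuousLinearMap * Q =
      Q' * U.toContinuousLinearEquiv.toContinuousLinearMap := by
    refine ext_entry b fun x y => ?_
    change (inner ℂ (b x) (U (Q (b y))) : ℂ) = inner ℂ (b x) (Q' (U (b y)))
    rw [inner_diagonal_unitary hu hU, hU, map_smul, inner_smul_right]
    change u x * entry b Q x y = u y * entry b Q' x y
    rw [h]
    have h1 : u y * starRingEnd ℂ (u y) = 1 := by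
      rw [Complex.mul_conj, Complex.normSq_eq_norm_sq, hu]
      simp
    linear_combination (-(u x * entry b Q x y)) * h1
  have hcomm : ∀ v, U (Q v) = Q' (U v) := fun v => congr($hUQ v)
  constructor
  · have hfl := intertwine_flatten hQ hQ'
      ({ U.toLinearEquiv.restrictScalars ℝ with norm_map' := U.norm_map } : H ≃ₗᵢ[ℝ] H) hcomm
    rw [trv, trv]
    congr 1
    refine tsum_congr fun x => ?_
    have h1 : (Q' - flatten Q') (U (b x)) = U ((Q - flatten Q) (b x)) := by
      rw [sub_apply, sub_apply, map_sub, hcomm]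
      congr 1
      exact (hfl _).symm
    rw [hU, map_smul] at h1
    have h2 := congrArg (fun v => (inner ℂ (b x) v : ℂ)) h1
    simp only [inner_smul_right] at h2
    rw [inner_diagonal_unitary hu hU] at h2
    exact mul_left_cancel₀ (fun h => by simpa [h] using hu x) h2
  · have h1 : Q' = U.conjStarAlgEquiv Q := by
      ext v
      rw [LinearIsometryEquiv.conjStarAlgEquiv_apply_apply, hcomm, U.apply_symm_apply]
    rw [← spectrum.preimage_algebraMap ℂ, ← spectrum.preimage_algebraMap (R := ℝ) ℂ, h1]
    congr 1
    exact AlgEquiv.spectrum_eq (U.conjStarAlgEquiv) Q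

end Symmetry

/-! ### The Schur test -/

section Schur

variable {ι H : Type*} [NormedAddCommGroup H] [InnerProductSpace ℂ H]

/-- Cauchy–Schwarz with weight `f`, to be used with the absolute values of a matrix row as the
weight. -/
lemma sq_tsum_mul_le (f g : ι → ℝ≥0) :
    (∑' x, (f x * g x : ℝ≥0∞)) ^ 2 ≤ (∑' x, (f x : ℝ≥0∞)) * ∑' x, (f x * (g x) ^ 2 : ℝ≥0∞) := by
  rw [ENNReal.tsum_eq_iSup_sum, ENNReal.iSup_pow]
  refine iSup_le fun s => ?_
  refine le_trans ?_ (mul_le_mul' (ENNReal.sum_le_tsum s) (ENNReal.sum_le_tsum s))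
  have := Finset.sum_sq_le_sum_mul_sum_of_sq_le_mul s (r := fun x => f x * g x) (f := f)
    (g := fun x => f x * g x ^ 2) (fun _ _ => zero_le) (fun _ _ => zero_le)
    (fun x _ => le_of_eq (by ring))
  exact_mod_cast this

/-- The Schur test. -/
theorem exists_operator_of_matrix (b : HilbertBasis ι ℂ H) {m : ι → ι → ℂ} {L : ℝ≥0}
    (hrow : ∀ x, ∑' y, ‖m x y‖ₑ ≤ L) (hcol : ∀ y, ∑' x, ‖m x y‖ₑ ≤ L) :
    ∃ T : H →L[ℂ] H, (∀ x y, entry b T x y = m x y) ∧ ‖T‖ ≤ L := by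
  classical
  have hsummable : ∀ x (v : H), Summable fun y => m x y * inner ℂ (b y) v := fun x v => by
    have h1 : Summable fun y => ‖m x y‖ := by
      have := ENNReal.summable_toReal (ne_top_of_le_ne_top ENNReal.coe_ne_top (hrow x))
      simpa using this
    refine Summable.of_norm_bounded (h1.mul_right ‖v‖) fun y => ?_
    rw [norm_mul]
    refine mul_le_mul_of_nonneg_left ?_ (norm_nonneg _)
    simpa [norm_basis] using norm_inner_le_norm (𝕜 := ℂ) (b y) v
  let coord : H → ι → ℂ := fun v x => ∑' y, m x y * inner ℂ (b y) v
  have hbound : ∀ v, ∑' x, ‖coord v x‖ₑ ^ 2 ≤ (L : ℝ≥0∞) ^ 2 * ‖v‖ₑ ^ 2 := fun v => by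
    calc ∑' x, ‖coord v x‖ₑ ^ 2
        ≤ ∑' x, L * ∑' y, ‖m x y‖ₑ * ‖(inner ℂ (b y) v : ℂ)‖ₑ ^ 2 := by
          refine ENNReal.tsum_le_tsum fun x => ?_
          have h1 : ‖coord v x‖ₑ ≤ ∑' y, ‖m x y‖ₑ * ‖(inner ℂ (b y) v : ℂ)‖ₑ := by
            refine enorm_tsum_le_tsum_enorm.trans (le_of_eq (tsum_congr fun y => ?_))
            rw [enorm_mul]
          refine (pow_le_pow_left' h1 2).trans ?_
          refine (sq_tsum_mul_le (fun y => ‖m x y‖₊)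
            (fun y => ‖(inner ℂ (b y) v : ℂ)‖₊)).trans ?_
          exact mul_le_mul_left (hrow x) _
      _ = L * ∑' y, (∑' x, ‖m x y‖ₑ) * ‖(inner ℂ (b y) v : ℂ)‖ₑ ^ 2 := by
          rw [ENNReal.tsum_mul_left, ENNReal.tsum_comm]
          simp_rw [ENNReal.tsum_mul_right]
      _ ≤ L * ∑' y, L * ‖(inner ℂ (b y) v : ℂ)‖ₑ ^ 2 :=
          mul_le_mul_right (ENNReal.tsum_le_tsum fun y => mul_le_mul_left (hcol y) _) _
      _ = (L : ℝ≥0∞) ^ 2 * ‖v‖ₑ ^ 2 := by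
          rw [ENNReal.tsum_mul_left, tsum_enorm_inner_sq, ← mul_assoc, sq (L : ℝ≥0∞)]
  have hmem : ∀ v, Memℓp (coord v) 2 := fun v => by
    refine memℓp_gen ?_
    have h := ENNReal.summable_toReal (ne_top_of_le_ne_top (by finiteness) (hbound v))
    simpa using h
  let T₀ : H →ₗ[ℂ] H :=
    { toFun := fun v => b.repr.symm ⟨coord v, hmem v⟩
      map_add' := fun v w => by
        rw [← map_add]
        congr 1
        ext x
        change coord (v + w) x = coord v x + coord w x
        simp only [coord, inner_add_right, mul_add]
        exact (hsummable x v).tsum_add (hsummable x w)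
      map_smul' := fun r v => by
        rw [RingHom.id_apply, ← map_smul]
        congr 1
        ext x
        change coord (r • v) x = r * coord v x
        simp only [coord, inner_smul_right]
        rw [← tsum_mul_left]
        exact tsum_congr fun y => by ring }
  have hT₀ : ∀ v x, (inner ℂ (b x) (T₀ v) : ℂ) = coord v x := fun v x => by
    rw [← b.repr_apply_apply]
    change (b.repr (b.repr.symm ⟨coord v, hmem v⟩) : ι → ℂ) x = _
    rw [LinearIsometryEquiv.apply_symm_apply]
  have hnorm : ∀ v, ‖T₀ v‖ ≤ L * ‖v‖ := fun v => by
    have h1 : ‖T₀ v‖ₑ ^ 2 ≤ (L * ‖v‖ₑ) ^ 2 := by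
      rw [← tsum_enorm_inner_sq b, mul_pow]
      simp_rw [hT₀]
      exact hbound v
    have h2 : ‖T₀ v‖ₑ ≤ L * ‖v‖ₑ := (ENNReal.pow_le_pow_left_iff two_ne_zero).mp h1
    rw [enorm_eq_nnnorm, enorm_eq_nnnorm] at h2
    exact_mod_cast h2
  refine ⟨T₀.mkContinuous L hnorm, fun x y => ?_, T₀.mkContinuous_norm_le L.2 hnorm⟩
  change (inner ℂ (b x) (T₀ (b y)) : ℂ) = m x y
  rw [hT₀]
  simp only [coord]
  rw [tsum_eq_single y]
  · rw [inner_self_eq_norm_sq_to_K, norm_basis]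
    simp
  · intro z hz
    rw [b.orthonormal.2 hz, mul_zero]

end Schur

/-! ### Exponential weights in the plane -/

section Decay

/-- The exponential weight `exp (-a r)`, in `[0, ∞]`. -/
noncomputable def expWeight (a r : ℝ) : ℝ≥0∞ := ENNReal.ofReal (Real.exp (-a * r))

lemma expWeight_le {a r r' : ℝ} (ha : 0 ≤ a) (h : r' ≤ r) : expWeight a r ≤ expWeight a r' :=
  ENNReal.ofReal_le_ofReal (Real.exp_le_exp.mpr (by nlinarith))

lemma expWeight_mul (a r r' : ℝ) : expWeight a r * expWeight a r' = expWeight a (r + r') := by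
  rw [expWeight, expWeight, expWeight, ← ENNReal.ofReal_mul (Real.exp_nonneg _), ← Real.exp_add]
  ring_nf

lemma expWeight_smul (a r t : ℝ) : expWeight (t * a) r = expWeight a (t * r) := by
  rw [expWeight, expWeight]
  ring_nf

lemma tsum_int_expWeight_ne_top {a : ℝ} (ha : 0 < a) : ∑' n : ℤ, expWeight a |(n : ℝ)| ≠ ⊤ := by
  have hnat : Summable fun n : ℕ => Real.exp (-a * n) := by
    have h := summable_geometric_of_lt_one (Real.exp_nonneg (-a))
      (by simpa using ha)
    refine h.congr fun n => ?_
    rw [← Real.exp_nat_mul]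
    ring_nf
  have hint : Summable fun n : ℤ => Real.exp (-a * |(n : ℝ)|) := by
    refine Summable.of_nat_of_neg ?_ ?_ <;> simpa using hnat
  unfold expWeight
  rw [← ENNReal.ofReal_tsum_of_nonneg (fun n => Real.exp_nonneg _) hint]
  exact ENNReal.ofReal_ne_top

variable {ι : Type*} {pos : ι → Plane}

lemma abs_coord_sub_le_dist (p q : Plane) (i : Fin 2) : |p i - q i| ≤ dist p q := by
  rw [dist_eq_norm]
  exact PiLp.norm_apply_le (p - q) i

/-- In a uniformly locally finite system, exponential weights have uniformly bounded sums. -/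
lemma exists_tsum_expWeight_le (hpos : UniformlyLocallyFinite pos) {a : ℝ} (ha : 0 < a) :
    ∃ M : ℝ≥0, ∀ p : Plane, ∑' x, expWeight a (dist (pos x) p) ≤ M := by
  obtain ⟨N, hN⟩ := hpos
  set Z : ℝ≥0∞ := ∑' n : ℤ, expWeight (a / 2) |(n : ℝ)| with hZ
  have hZtop : Z ≠ ⊤ := tsum_int_expWeight_ne_top (by linarith)
  set B : ℝ≥0∞ := expWeight (a / 2) (-1) * (Z * Z) * N with hB
  have hBtop : B ≠ ⊤ :=
    ENNReal.mul_ne_top (ENNReal.mul_ne_top ENNReal.ofReal_ne_top (ENNReal.mul_ne_top hZtop hZtop))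
      (ENNReal.natCast_ne_top N)
  refine ⟨B.toNNReal, fun p => ?_⟩
  rw [ENNReal.coe_toNNReal hBtop]
  -- Unit disks about p + ℤ² cover the plane and carry at most N orbitals each. Rounding costs at
  -- most 1/2 per coordinate, which the factor exp(a/2) in `wt` makes up for.
  let shift : ℤ × ℤ → Plane := fun k => p + !₂[(k.1 : ℝ), (k.2 : ℝ)]
  let wt : ℤ × ℤ → ℝ≥0∞ := fun k =>
    expWeight (a / 2) (-1) * (expWeight (a / 2) |(k.1 : ℝ)| * expWeight (a / 2) |(k.2 : ℝ)|)
  have hpoint : ∀ x, expWeight a (dist (pos x) p) ≤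
      ∑' k, wt k * Set.indicator {x | dist (pos x) (shift k) ≤ 1} 1 x := fun x => by
    let k : ℤ × ℤ := (round (pos x 0 - p 0), round (pos x 1 - p 1))
    have h0 : |pos x 0 - p 0 - k.1| ≤ 1 / 2 := abs_sub_round _
    have h1 : |pos x 1 - p 1 - k.2| ≤ 1 / 2 := abs_sub_round _
    have hmem : dist (pos x) (shift k) ≤ 1 := by
      rw [EuclideanSpace.dist_eq, Fin.sum_univ_two, Real.dist_eq, Real.dist_eq, sq_abs, sq_abs]
      have e0 : pos x 0 - shift k 0 = pos x 0 - p 0 - k.1 := by simp [shift]; ring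
      have e1 : pos x 1 - shift k 1 = pos x 1 - p 1 - k.2 := by simp [shift]; ring
      rw [e0, e1, Real.sqrt_le_iff]
      refine ⟨zero_le_one, ?_⟩
      nlinarith [abs_le.mp h0, abs_le.mp h1]
    refine le_trans ?_ (ENNReal.le_tsum k)
    rw [Set.indicator_of_mem (by exact hmem), Pi.one_apply, mul_one]
    simp only [wt]
    rw [expWeight_mul, expWeight_mul, show a = 2 * (a / 2) by ring, expWeight_smul,
      show 2 * (a / 2) / 2 = a / 2 by ring]
    refine expWeight_le (by linarith) ?_
    have h2 := abs_coord_sub_le_dist (pos x) p 0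
    have h3 := abs_coord_sub_le_dist (pos x) p 1
    have h4 : |(k.1 : ℝ)| ≤ |pos x 0 - p 0| + 1 / 2 := by
      have := abs_sub_abs_le_abs_sub (k.1 : ℝ) (pos x 0 - p 0)
      rw [abs_sub_comm (k.1 : ℝ)] at this
      linarith
    have h5 : |(k.2 : ℝ)| ≤ |pos x 1 - p 1| + 1 / 2 := by
      have := abs_sub_abs_le_abs_sub (k.2 : ℝ) (pos x 1 - p 1)
      rw [abs_sub_comm (k.2 : ℝ)] at this
      linarith
    linarith
  calc ∑' x, expWeight a (dist (pos x) p)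
      ≤ ∑' x, ∑' k, wt k * Set.indicator {x | dist (pos x) (shift k) ≤ 1} 1 x :=
        ENNReal.tsum_le_tsum hpoint
    _ = ∑' k, wt k * ∑' x, Set.indicator {x | dist (pos x) (shift k) ≤ 1} 1 x := by
        rw [ENNReal.tsum_comm]
        exact tsum_congr fun k => ENNReal.tsum_mul_left
    _ ≤ ∑' k, wt k * N := by
        refine ENNReal.tsum_le_tsum fun k => mul_le_mul_right ?_ _
        rw [← tsum_subtype]
        simp only [Pi.one_apply]
        rw [ENNReal.tsum_set_one]
        exact_mod_cast hN (shift k)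
    _ = B := by
        rw [ENNReal.tsum_mul_right, ENNReal.tsum_mul_left,
          ENNReal.tsum_prod (f := fun m n : ℤ => expWeight (a / 2) |(m : ℝ)| *
            expWeight (a / 2) |(n : ℝ)|)]
        simp_rw [ENNReal.tsum_mul_left]
        rw [ENNReal.tsum_mul_right]

/-- The vertices are pairwise within the length of the path X → Y → Z, so the closed ball of that
radius about any of them contains the triangle by convexity. -/
lemma dist_le_of_mem_triangle {O X Y Z : Plane} (h : O ∈ convexHull ℝ {X, Y, Z}) :
    dist X O ≤ dist X Y + dist Y Z ∧ dist Y O ≤ dist X Y + dist Y Z ∧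
      dist Z O ≤ dist X Y + dist Y Z := by
  have key : ∀ W : Plane, dist X W ≤ dist X Y + dist Y Z → dist Y W ≤ dist X Y + dist Y Z →
      dist Z W ≤ dist X Y + dist Y Z → dist W O ≤ dist X Y + dist Y Z := by
    intro W h1 h2 h3
    rw [dist_comm]
    refine convexHull_min (s := {X, Y, Z}) ?_ (convex_closedBall W _) h
    rintro _ (rfl | rfl | rfl)
    exacts [h1, h2, h3]
  have h1 := dist_nonneg (x := X) (y := Y)
  have h2 := dist_nonneg (x := Y) (y := Z)
  have h3 := dist_triangle X Y Z
  have h4 := dist_comm Y X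
  have h5 := dist_comm Z X
  have h6 := dist_comm Z Y
  have h7 : ∀ W : Plane, dist W W ≤ dist X Y + dist Y Z := fun W => by
    rw [dist_self]
    linarith
  exact ⟨key X (h7 X) (by linarith) (by linarith), key Y (by linarith) (h7 Y) (by linarith),
    key Z (by linarith) (by linarith) (h7 Z)⟩

/-- The weight of a triangle that contains `O`. -/
lemma expWeight_triangle_le {a : ℝ} (ha : 0 ≤ a) {O X Y Z : Plane}
    (h : O ∈ convexHull ℝ {X, Y, Z}) {r : ℝ} (hr : r ≤ dist X Y + dist Y Z) :
    expWeight (4 * a) (dist X Y + dist Y Z) ≤ expWeight a r *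
      (expWeight a (dist X O) * expWeight a (dist Y O) * expWeight a (dist Z O)) := by
  -- The rate 4a is spent in four equal parts, on r and on the distances of the three vertices from
  -- O, none of which exceeds the path length.
  obtain ⟨h1, h2, h3⟩ := dist_le_of_mem_triangle h
  rw [expWeight_mul, expWeight_mul, expWeight_mul, expWeight_smul]
  exact expWeight_le ha (by linarith)

end Decay

/-! ### Operators with a kernel of triangle type -/

section Kernel

variable {ι H : Type*} [NormedAddCommGroup H] [InnerProductSpace ℂ H] [CompleteSpace H]
  {b : HilbertBasis ι ℂ H} {P Q T : H →L[ℂ] H} {pos : ι → Plane} {s : ι → ι → ℂ}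

lemma hasSum_entry_mul (b : HilbertBasis ι ℂ H) (A B : H →L[ℂ] H) (x z : ι) :
    HasSum (fun y => entry b A x y * entry b B y z) (entry b (A * B) x z) := by
  have h := b.hasSum_inner_mul_inner (ContinuousLinearMap.adjoint A (b x)) (B (b z))
  simp only [ContinuousLinearMap.adjoint_inner_left] at h
  exact h

omit [CompleteSpace H] in
lemma entry_sub (b : HilbertBasis ι ℂ H) (A B : H →L[ℂ] H) (x z : ι) :
    entry b (A - B) x z = entry b A x z - entry b B x z := by
  simp [entry, sub_apply]

lemma entry_adjoint (b : HilbertBasis ι ℂ H) (A : H →L[ℂ] H) (x z : ι) :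
    entry b (star A) x z = starRingEnd ℂ (entry b A z x) := by
  rw [entry, entry, inner_conj_symm]
  exact ContinuousLinearMap.adjoint_inner_right A (b x) (b z)

lemma norm_entry_symm (hQ : IsSelfAdjoint Q) (x z : ι) :
    ‖entry b Q x z‖ₑ = ‖entry b Q z x‖ₑ := by
  have h := entry_adjoint b Q x z
  rw [hQ.star_eq] at h
  rw [h, ← ofReal_norm, ← ofReal_norm, RCLike.norm_conj]

/-- Idempotency of `P` also writes the linear term s_xz P_xz as a sum over an intermediate site, so
that it combines with the quadratic one. -/
lemma hasSum_entry_idemDefect (hP : IsStarProjection P)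
    (hQ : ∀ x y, entry b Q x y = s x y * entry b P x y) (x z : ι) :
    HasSum (fun y => (s x y * s y z - s x z) * (entry b P x y * entry b P y z))
      (entry b (idemDefect Q) x z) := by
  have h1 := hasSum_entry_mul b Q Q x z
  have h2 := (hasSum_entry_mul b P P x z).mul_left (s x z)
  rw [hP.isIdempotentElem.eq, ← hQ] at h2
  have h3 := h1.sub h2
  rw [← entry_sub] at h3
  refine h3.congr_fun fun y => ?_
  rw [hQ, hQ]
  ring

omit [CompleteSpace H] in
lemma enorm_le_tsum_inner (b : HilbertBasis ι ℂ H) (v : H) :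
    ‖v‖ₑ ≤ ∑' x, ‖(inner ℂ (b x) v : ℂ)‖ₑ := by
  have h := enorm_apply_le b (1 : H →L[ℂ] H) v
  refine h.trans (le_of_eq (tsum_congr fun y => ?_))
  rw [one_apply_eq_self, ← ofReal_norm (b y), norm_basis]
  simp

omit [CompleteSpace H] in
lemma colSum_mul_le_tsum (b : HilbertBasis ι ℂ H) (A B : H →L[ℂ] H) :
    colSum b (A * B) ≤ ∑' x, (∑' z, ‖entry b B x z‖ₑ) * ‖A (b x)‖ₑ := by
  calc colSum b (A * B) ≤ ∑' z, ∑' x, ‖entry b B x z‖ₑ * ‖A (b x)‖ₑ :=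
        ENNReal.tsum_le_tsum fun z => enorm_apply_le b A (B (b z))
    _ = _ := by
        rw [ENNReal.tsum_comm]
        exact tsum_congr fun x => ENNReal.tsum_mul_right

variable {a : ℝ} {M C : ℝ≥0}

/-- A system with exponential decay: `C` and `a` control the decay of the matrix elements, and `M`
the number of sites. -/
structure DecayBounds (pos : ι → Plane) (b : HilbertBasis ι ℂ H) (P : H →L[ℂ] H) (a : ℝ)
    (M C : ℝ≥0) : Prop where
  isStarProjection : IsStarProjection P
  rate_pos : 0 < a
  tsum_le : ∀ p : Plane, ∑' x, expWeight a (dist (pos x) p) ≤ M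
  entry_le : ∀ x y, ‖entry b P x y‖ₑ ≤ C * expWeight (4 * a) (dist (pos x) (pos y))

lemma exists_decayBounds (hpos : UniformlyLocallyFinite pos) (hP : IsStarProjection P)
    (hdecay : ExpDecay pos b P) : ∃ a M C, DecayBounds pos b P a M C := by
  obtain ⟨C₁, C₂, hC₂, h⟩ := hdecay
  obtain ⟨M, hM⟩ := exists_tsum_expWeight_le hpos (a := C₂ / 4) (by linarith)
  refine ⟨C₂ / 4, M, C₁.toNNReal, hP, by linarith, hM, fun x y => ?_⟩
  rw [← ofReal_norm, expWeight, ← ENNReal.ofReal_coe_nnreal, ← ENNReal.ofReal_mul NNReal.zero_le_coe]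
  refine ENNReal.ofReal_le_ofReal ((h x y).trans ?_)
  rw [show 4 * (C₂ / 4) = C₂ by ring]
  exact mul_le_mul_of_nonneg_right (Real.le_coe_toNNReal C₁) (Real.exp_nonneg _)

/-- The product of the weights of three sites, with respect to the point `O`. -/
noncomputable def tripleWeight (pos : ι → Plane) (a : ℝ) (O : Plane) (x y z : ι) : ℝ≥0∞ :=
  expWeight a (dist (pos x) O) * expWeight a (dist (pos y) O) * expWeight a (dist (pos z) O)

namespace DecayBounds

variable (hb : DecayBounds pos b P a M C)
include hb

lemma entry_mul_entry_le (x y z : ι) : ‖entry b P x y‖ₑ * ‖entry b P y z‖ₑ ≤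
    C ^ 2 * expWeight (4 * a) (dist (pos x) (pos y) + dist (pos y) (pos z)) := by
  refine (mul_le_mul' (hb.entry_le x y) (hb.entry_le y z)).trans (le_of_eq ?_)
  rw [← expWeight_mul]
  ring

lemma tsum_entry_le (y : ι) : ∑' x, (C * expWeight (4 * a) (dist (pos x) (pos y)) : ℝ≥0∞)
    ≤ C * M := by
  rw [ENNReal.tsum_mul_left]
  refine mul_le_mul_right (le_trans (ENNReal.tsum_le_tsum fun x => ?_) (hb.tsum_le (pos y))) _
  rw [expWeight_smul]
  refine expWeight_le hb.rate_pos.le ?_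
  linarith [dist_nonneg (x := pos x) (y := pos y)]

lemma tsum_tripleWeight_le (O : Plane) : ∑' z, ∑' x, ∑' y, tripleWeight pos a O x y z ≤ M ^ 3 := by
  have h : ∀ z, ∑' x, ∑' y, tripleWeight pos a O x y z =
      (∑' x, expWeight a (dist (pos x) O)) * (∑' y, expWeight a (dist (pos y) O)) *
        expWeight a (dist (pos z) O) := fun z => by
    simp only [tripleWeight]
    simp_rw [ENNReal.tsum_mul_right, ENNReal.tsum_mul_left]
    rw [ENNReal.tsum_mul_right]
  simp_rw [h]
  rw [ENNReal.tsum_mul_left]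
  refine (mul_le_mul' (mul_le_mul' (hb.tsum_le O) (hb.tsum_le O)) (hb.tsum_le O)).trans
    (le_of_eq ?_)
  ring

/-- A kernel that decays in all three sites around a point is absolutely summable, uniformly in the
point. Two points allow for two fluxes, and `A` carries any additional smallness. -/
lemma colSum_le_of_kernel {q : ι → ι → ι → ℂ}
    (hT : ∀ x z, HasSum (fun y => q x y z * (entry b P x y * entry b P y z)) (entry b T x z))
    {O₁ O₂ : Plane} {A : ℝ≥0∞}
    (hq : ∀ x y z, ‖q x y z‖ₑ *
      expWeight (4 * a) (dist (pos x) (pos y) + dist (pos y) (pos z)) ≤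
        A * (tripleWeight pos a O₁ x y z + tripleWeight pos a O₂ x y z)) :
    colSum b T ≤ 2 * C ^ 2 * M ^ 3 * A := by
  calc colSum b T ≤ ∑' z, ∑' x, ‖entry b T x z‖ₑ :=
        ENNReal.tsum_le_tsum fun z => enorm_le_tsum_inner b _
    _ ≤ ∑' z, ∑' x, ∑' y, C ^ 2 * A *
          (tripleWeight pos a O₁ x y z + tripleWeight pos a O₂ x y z) := by
        refine ENNReal.tsum_le_tsum fun z => ENNReal.tsum_le_tsum fun x => ?_
        rw [← (hT x z).tsum_eq]
        refine enorm_tsum_le_tsum_enorm.trans (ENNReal.tsum_le_tsum fun y => ?_)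
        rw [enorm_mul, enorm_mul]
        refine (mul_le_mul_right (hb.entry_mul_entry_le x y z) _).trans ?_
        rw [mul_left_comm, mul_assoc]
        exact mul_le_mul_right (hq x y z) _
    _ ≤ C ^ 2 * A * (M ^ 3 + M ^ 3) := by
        simp_rw [ENNReal.tsum_mul_left, ENNReal.tsum_add]
        exact mul_le_mul_right (add_le_add (hb.tsum_tripleWeight_le O₁)
          (hb.tsum_tripleWeight_le O₂)) _
    _ = _ := by ring

/-- The sum over x is left open and two powers of the weight at x are kept: one to make a later sum
over x converge, one to gain smallness from a second operator. -/
lemma tsum_entry_le_of_kernel {q : ι → ι → ι → ℂ}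
    (hT : ∀ x z, HasSum (fun y => q x y z * (entry b P x y * entry b P y z)) (entry b T x z))
    {O : Plane} (hq : ∀ x y z, ‖q x y z‖ₑ *
      expWeight (4 * a) (dist (pos x) (pos y) + dist (pos y) (pos z)) ≤
        2 * (expWeight a (dist (pos x) O) * tripleWeight pos a O x y z)) (x : ι) :
    ∑' z, ‖entry b T x z‖ₑ ≤ 2 * C ^ 2 * M ^ 2 * expWeight a (dist (pos x) O) ^ 2 := by
  calc ∑' z, ‖entry b T x z‖ₑ ≤ ∑' z, ∑' y, 2 * C ^ 2 * expWeight a (dist (pos x) O) ^ 2 *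
          (expWeight a (dist (pos y) O) * expWeight a (dist (pos z) O)) := by
        refine ENNReal.tsum_le_tsum fun z => ?_
        rw [← (hT x z).tsum_eq]
        refine enorm_tsum_le_tsum_enorm.trans (ENNReal.tsum_le_tsum fun y => ?_)
        rw [enorm_mul, enorm_mul]
        refine (mul_le_mul_right (hb.entry_mul_entry_le x y z) _).trans ?_
        rw [mul_left_comm]
        refine (mul_le_mul_right (hq x y z) _).trans (le_of_eq ?_)
        rw [tripleWeight]
        ring
    _ ≤ 2 * C ^ 2 * expWeight a (dist (pos x) O) ^ 2 * (M * M) := by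
        simp_rw [ENNReal.tsum_mul_left, ENNReal.tsum_mul_right]
        rw [ENNReal.tsum_mul_left]
        exact mul_le_mul_right (mul_le_mul' (hb.tsum_le O) (hb.tsum_le O)) _
    _ = _ := by ring

/-- The Peierls substitution gives a bounded operator. -/
lemma exists_operator (hs : ∀ x y, ‖s x y‖ = 1) :
    ∃ T : H →L[ℂ] H, (∀ x y, entry b T x y = s x y * entry b P x y) ∧ ‖T‖ ≤ (C * M : ℝ≥0) := by
  have h1 : ∀ x y, ‖s x y * entry b P x y‖ₑ ≤
      C * expWeight (4 * a) (dist (pos x) (pos y)) := fun x y => by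
    rw [enorm_mul, ← ofReal_norm (s x y), hs, ENNReal.ofReal_one, one_mul]
    exact hb.entry_le x y
  refine exists_operator_of_matrix b (fun x => ?_) (fun y => ?_)
  · rw [ENNReal.coe_mul]
    refine le_trans (ENNReal.tsum_le_tsum fun y => ?_) (hb.tsum_entry_le x)
    rw [dist_comm]
    exact h1 x y
  · rw [ENNReal.coe_mul]
    exact le_trans (ENNReal.tsum_le_tsum fun x => h1 x y) (hb.tsum_entry_le y)

/-- The Schur test excludes the default value 0 of `peierls`. -/
lemma entry_peierls (hs : ∀ x y, ‖s x y‖ = 1) (x y : ι) :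
    entry b (peierls b s P) x y = s x y * entry b P x y := by
  obtain ⟨T, hT, -⟩ := hb.exists_operator hs
  have h : ∃ T : H →L[ℂ] H, ∀ x y, entry b T x y = s x y * entry b P x y := ⟨T, hT⟩
  rw [peierls, dif_pos h]
  exact h.choose_spec x y

end DecayBounds

end Kernel

/-! ### Gauges for the half-fluxes -/

section Phases

variable {ι : Type*} {pos : ι → Plane} {F G : Set Plane} {s t : ι → ι → ℂ}

lemma IsFluxPhase.conj (hs : IsFluxPhase pos F s) (x y : ι) :
    starRingEnd ℂ (s x y) = s y x := by
  have h1 : s x y * starRingEnd ℂ (s x y) = 1 := by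
    rw [Complex.mul_conj, Complex.normSq_eq_norm_sq, hs.norm_eq_one]
    simp
  have h0 : s x y ≠ 0 := left_ne_zero_of_mul_eq_one h1
  exact mul_left_cancel₀ h0 (h1.trans (hs.swap x y).symm)

lemma IsFluxPhase.mul_eq (hs : IsFluxPhase pos F s) (x y z : ι) :
    s x y * s y z = s x z * (-1) ^ (F ∩ convexHull ℝ {pos x, pos y, pos z}).ncard := by
  rw [← hs.triangle x y z]
  linear_combination (-(s x y * s y z)) * hs.swap x z

/-- Gauge transformation of a family of phases. -/
def gauge (u : ι → ℂ) (s : ι → ι → ℂ) (x y : ι) : ℂ := u x * s x y * starRingEnd ℂ (u y)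

lemma mul_conj_of_norm {z : ℂ} (hz : ‖z‖ = 1) : z * starRingEnd ℂ z = 1 := by
  rw [Complex.mul_conj, Complex.normSq_eq_norm_sq, hz]
  simp

lemma IsFluxPhase.gauge (hs : IsFluxPhase pos F s) {u : ι → ℂ} (hu : ∀ x, ‖u x‖ = 1) :
    IsFluxPhase pos F (gauge u s) where
  norm_eq_one x y := by
    rw [HalfFlux.gauge, norm_mul, norm_mul, RCLike.norm_conj, hu, hu, hs.norm_eq_one]
    norm_num
  self x := by
    rw [HalfFlux.gauge, hs.self, mul_one, mul_conj_of_norm (hu x)]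
  swap x y := by
    have h1 := mul_conj_of_norm (hu x)
    have h2 := mul_conj_of_norm (hu y)
    have h3 := hs.swap x y
    simp only [HalfFlux.gauge]
    linear_combination (s x y * s y x * u y * starRingEnd ℂ (u y)) * h1 + (s x y * s y x) * h2 + h3
  triangle x y z := by
    have h1 := mul_conj_of_norm (hu x)
    have h2 := mul_conj_of_norm (hu y)
    have h3 := mul_conj_of_norm (hu z)
    rw [← hs.triangle x y z]
    simp only [HalfFlux.gauge]
    linear_combination (s x y * s y z * s z x) * ((u y * starRingEnd ℂ (u y) *
      (u z * starRingEnd ℂ (u z))) * h1 + (u z * starRingEnd ℂ (u z)) * h2 + h3)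

/-- Real phases that depend on the sites only. -/
structure IsSitePhase (pos : ι → Plane) (s : ι → ι → ℂ) : Prop where
  conj : ∀ x y, starRingEnd ℂ (s x y) = s x y
  congr : ∀ x x' y y', pos x = pos x' → pos y = pos y' → s x y = s x' y'

/-- Every family of flux phases is gauge equivalent to a real one that depends on the sites only. -/
lemma IsFluxPhase.exists_isSitePhase (hs : IsFluxPhase pos F s) :
    ∃ u : ι → ℂ, (∀ x, ‖u x‖ = 1) ∧ IsSitePhase pos (HalfFlux.gauge u s) := by
  rcases isEmpty_or_nonempty ι with h | ⟨⟨o⟩⟩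
  · exact ⟨fun _ => 1, fun _ => by simp, ⟨fun x => h.elim x, fun x => h.elim x⟩⟩
  -- Transport from a base orbital o replaces s x y by its loop product around the triangle o, x, y,
  -- a sign that depends on positions only.
  · have hform : ∀ x y, HalfFlux.gauge (s o) s x y =
        (-1) ^ (F ∩ convexHull ℝ {pos o, pos x, pos y}).ncard := fun x y => by
      rw [HalfFlux.gauge, hs.conj, hs.triangle]
    refine ⟨s o, hs.norm_eq_one o, ⟨fun x y => ?_, fun x x' y y' hx hy => ?_⟩⟩
    · rw [hform]
      simp
    · rw [hform, hform, hx, hy]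

/-- Two families of flux phases for the same fluxes in a convex region are gauge equivalent in that
region. -/
lemma IsFluxPhase.exists_gauge_eq (hs : IsFluxPhase pos F s) (ht : IsFluxPhase pos G t)
    (hs' : IsSitePhase pos s) (ht' : IsSitePhase pos t) {A : Set Plane} (hA : Convex ℝ A)
    (hFG : F ∩ A = G ∩ A) :
    ∃ u : ι → ℂ, (∀ x, ‖u x‖ = 1) ∧ IsSitePhase pos (HalfFlux.gauge u t) ∧
      ∀ x y, pos x ∈ A → pos y ∈ A → HalfFlux.gauge u t x y = s x y := by
  by_cases hne : ∃ o, pos o ∈ A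
  · obtain ⟨o, ho⟩ := hne
    -- The comparison of the two transports from o. Since o lies in the convex set A, the triangles
    -- o, x, y stay in A and enclose the same fluxes.
    refine ⟨fun x => s x o * t o x, fun x => by rw [norm_mul, hs.norm_eq_one, ht.norm_eq_one,
      one_mul], ⟨fun x y => ?_, fun x x' y y' hx hy => ?_⟩, fun x y hx hy => ?_⟩
    · simp only [HalfFlux.gauge, map_mul, hs'.conj, ht'.conj]
    · simp only [HalfFlux.gauge, map_mul, hs'.conj, ht'.conj]
      rw [hs'.congr x x' o o hx rfl, hs'.congr y y' o o hy rfl, ht'.congr o o x x' rfl hx,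
        ht'.congr o o y y' rfl hy, ht'.congr x x' y y' hx hy]
    · have hsub : convexHull ℝ {pos o, pos x, pos y} ⊆ A := by
        refine convexHull_min ?_ hA
        rintro _ (rfl | rfl | rfl)
        exacts [ho, hx, hy]
      have h1 := hs.triangle o x y
      have h2 := ht.triangle o x y
      rw [show F ∩ convexHull ℝ {pos o, pos x, pos y} = G ∩ convexHull ℝ {pos o, pos x, pos y} by
        rw [← Set.inter_eq_self_of_subset_right hsub, ← Set.inter_assoc, hFG, Set.inter_assoc],
        ← h2] at h1
      have h3 := hs.swap x o
      have h4 := hs.swap y o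
      simp only [HalfFlux.gauge, map_mul, hs.conj, ht.conj]
      linear_combination (-(s x o * s o y)) * h1 + (s x y * (s y o * s o y)) * h3 + s x y * h4
  · push Not at hne
    refine ⟨fun _ => 1, fun _ => by simp, ⟨fun x y => ?_, fun x x' y y' hx hy => ?_⟩,
      fun x y hx => absurd hx (hne x)⟩
    · simp [HalfFlux.gauge, ht'.conj]
    · simp [HalfFlux.gauge, ht'.congr x x' y y' hx hy]

lemma gauge_gauge (u v : ι → ℂ) (s : ι → ι → ℂ) :
    gauge u (gauge v s) = gauge (fun x => u x * v x) s := by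
  ext x y
  simp only [gauge, map_mul]
  ring

end Phases

/-! ### Half-planes around the two fluxes -/

section HalfPlanes

/-- The points closer to `O₁` than to `O₂` form a convex set. -/
lemma convex_closer (O₁ O₂ : Plane) : Convex ℝ {p : Plane | dist p O₁ ≤ dist p O₂} ∧
    Convex ℝ {p : Plane | dist p O₁ < dist p O₂} := by
  have key : ∀ p : Plane, dist p O₁ ^ 2 - dist p O₂ ^ 2 =
      2 * inner ℝ (O₂ - O₁) p - (‖O₂‖ ^ 2 - ‖O₁‖ ^ 2) := fun p => by
    rw [dist_eq_norm, dist_eq_norm, norm_sub_sq_real, norm_sub_sq_real, inner_sub_left,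
      real_inner_comm p O₁, real_inner_comm p O₂]
    ring
  have hlin : IsLinearMap ℝ fun p : Plane => inner ℝ (O₂ - O₁) p :=
    (innerₗ Plane (O₂ - O₁)).isLinear
  constructor
  · have : {p : Plane | dist p O₁ ≤ dist p O₂} =
        {p | inner ℝ (O₂ - O₁) p ≤ (‖O₂‖ ^ 2 - ‖O₁‖ ^ 2) / 2} := by
      ext p
      rw [Set.mem_ofPred_eq, Set.mem_ofPred_eq, ← pow_le_pow_iff_left₀ dist_nonneg dist_nonneg
        two_ne_zero]
      constructor <;> intro h <;> linarith [key p]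
    rw [this]
    exact convex_halfSpace_le hlin _
  · have : {p : Plane | dist p O₁ < dist p O₂} =
        {p | inner ℝ (O₂ - O₁) p < (‖O₂‖ ^ 2 - ‖O₁‖ ^ 2) / 2} := by
      ext p
      rw [Set.mem_ofPred_eq, Set.mem_ofPred_eq, ← pow_lt_pow_iff_left₀ dist_nonneg dist_nonneg
        two_ne_zero]
      constructor <;> intro h <;> linarith [key p]
    rw [this]
    exact convex_halfSpace_lt hlin _

end HalfPlanes

/-! ### Time-reversal symmetry of the Peierls substitution -/

section TimeReversal

variable {ι H : Type*} [NormedAddCommGroup H] [InnerProductSpace ℂ H] [CompleteSpace H]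
  {b : HilbertBasis ι ℂ H} {P Q : H →L[ℂ] H} {pos : ι → Plane} {s : ι → ι → ℂ}

/-- Real phases that depend on the sites only do not break the time-reversal symmetry. -/
lemma IsSitePhase.commute_antiunitary (hs : IsSitePhase pos s)
    (hQ : ∀ x y, entry b Q x y = s x y * entry b P x y) (Θ : H ≃ₗᵢ⋆[ℂ] H)
    (hsite : ∀ x y, pos x ≠ pos y → inner ℂ (b x) (Θ (b y)) = (0 : ℂ))
    (hP : ∀ v, Θ (P v) = P (Θ v)) (v : H) : Θ (Q v) = Q (Θ v) := by
  have hleft : ∀ (A : H →L[ℂ] H) (x y : ι), HasSum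
      (fun z => starRingEnd ℂ (entry b A z y) * inner ℂ (b x) (Θ (b z)))
      (inner ℂ (b x) (Θ (A (b y)))) := fun A x y => by
    have h1 := (b.hasSum_repr (A (b y))).map Θ Θ.continuous
    have h2 := (innerSL ℂ (b x)).hasSum h1
    simpa [Function.comp_def, b.repr_apply_apply, map_smulₛₗ, entry, inner_smul_right] using h2
  have hright : ∀ (A : H →L[ℂ] H) (x y : ι), HasSum
      (fun z => entry b A x z * inner ℂ (b z) (Θ (b y))) (inner ℂ (b x) (A (Θ (b y)))) :=
    fun A x y => by
    have h := b.hasSum_inner_mul_inner (ContinuousLinearMap.adjoint A (b x)) (Θ (b y))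
    simp only [ContinuousLinearMap.adjoint_inner_left] at h
    exact h
  have hbasis : ∀ y, Θ (Q (b y)) = Q (Θ (b y)) := fun y => by
    refine ext_inner_basis b fun x => ?_
    -- Θ mixes only orbitals of one site, where the phases are constant, and being real they pass
    -- through the antilinear map unchanged.
    have h1 : (inner ℂ (b x) (Θ (Q (b y))) : ℂ) = s x y * inner ℂ (b x) (Θ (P (b y))) := by
      refine (hleft Q x y).unique (((hleft P x y).mul_left (s x y)).congr_fun fun z => ?_)
      by_cases hz : pos x = pos z
      · rw [hQ, map_mul, hs.conj, hs.congr z x y y hz.symm rfl, mul_assoc]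
      · rw [hsite x z hz, mul_zero, mul_zero, mul_zero]
    have h2 : (inner ℂ (b x) (Q (Θ (b y))) : ℂ) = s x y * inner ℂ (b x) (P (Θ (b y))) := by
      refine (hright Q x y).unique (((hright P x y).mul_left (s x y)).congr_fun fun z => ?_)
      by_cases hz : pos z = pos y
      · rw [hQ, hs.congr x x z y rfl hz, mul_assoc]
      · rw [hsite z y hz, mul_zero, mul_zero, mul_zero]
    rw [h1, h2, hP]
  have h1 := ((b.hasSum_repr v).map Q Q.continuous).map Θ Θ.continuous
  have h2 := ((b.hasSum_repr v).map Θ Θ.continuous).map Q Q.continuous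
  refine h1.unique (h2.congr_fun fun y => ?_)
  simp [map_smulₛₗ, hbasis]

end TimeReversal

/-! ### Estimates for the defects -/

section Estimates

variable {ι H : Type*} [NormedAddCommGroup H] [InnerProductSpace ℂ H] [CompleteSpace H]
  {b : HilbertBasis ι ℂ H} {P Q S Q₁ Q₂ : H →L[ℂ] H} {pos : ι → Plane} {s s₁ s₂ : ι → ι → ℂ}
  {a : ℝ} {M C : ℝ≥0} {O O₁ O₂ : Plane} {F : Set Plane}

lemma enorm_neg_one_pow_sub_le (m n : ℕ) : ‖((-1) ^ m - (-1) ^ n : ℂ)‖ₑ ≤ 2 := by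
  have h : ‖((-1) ^ m - (-1) ^ n : ℂ)‖ ≤ 2 := by
    refine (norm_sub_le _ _).trans ?_
    simp
    norm_num
  rw [← ofReal_norm, ← ENNReal.ofReal_ofNat]
  exact ENNReal.ofReal_le_ofReal h

lemma IsFluxPhase.enorm_sub (hs : IsFluxPhase pos F s) (x y z : ι) :
    ‖s x y * s y z - s x z‖ₑ =
      ‖((-1) ^ (F ∩ convexHull ℝ {pos x, pos y, pos z}).ncard - (-1) ^ 0 : ℂ)‖ₑ := by
  rw [hs.mul_eq, ← mul_sub_one, enorm_mul, ← ofReal_norm (s x z), hs.norm_eq_one, pow_zero]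
  simp

lemma IsFluxPhase.enorm_sub_le (hs : IsFluxPhase pos F s) (x y z : ι) :
    ‖s x y * s y z - s x z‖ₑ ≤ 2 := by
  rw [hs.enorm_sub]
  exact enorm_neg_one_pow_sub_le _ _

lemma IsFluxPhase.sub_eq_zero (hs : IsFluxPhase pos F s) {x y z : ι}
    (h : ∀ O ∈ F, O ∉ convexHull ℝ {pos x, pos y, pos z}) : s x y * s y z - s x z = 0 := by
  rw [← enorm_eq_zero, hs.enorm_sub, (Set.disjoint_left.mpr h).inter_eq, Set.ncard_empty]
  simp

lemma IsFluxPhase.isSelfAdjoint (hs : IsFluxPhase pos F s) (hP : IsSelfAdjoint P)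
    (hQ : ∀ x y, entry b Q x y = s x y * entry b P x y) : IsSelfAdjoint Q := by
  refine ext_entry b fun x y => ?_
  have h := entry_adjoint b P x y
  rw [hP.star_eq] at h
  rw [entry_adjoint, hQ, map_mul, hs.conj, ← h, hQ]

namespace DecayBounds

variable (hb : DecayBounds pos b P a M C)
include hb

lemma tripleWeight_bound {x y z : ι} {r : ℝ} (h : O ∈ convexHull ℝ {pos x, pos y, pos z})
    (hr : r ≤ dist (pos x) (pos y) + dist (pos y) (pos z)) :
    expWeight (4 * a) (dist (pos x) (pos y) + dist (pos y) (pos z)) ≤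
      expWeight a r * tripleWeight pos a O x y z :=
  expWeight_triangle_le hb.rate_pos.le h hr

/-- The bracket s_xy s_yz - s_xz is at most 2 in modulus and vanishes for triangles without a flux;
the other triangles are controlled by their weight around the enclosed point. -/
lemma admissible (hs : IsFluxPhase pos F s) (hF : F ⊆ {O₁, O₂})
    (hQ : ∀ x y, entry b Q x y = s x y * entry b P x y) :
    Admissible b (C * M) (4 * C ^ 2 * M ^ 3) Q where
  isSelfAdjoint := hs.isSelfAdjoint hb.isStarProjection.isSelfAdjoint hQ
  norm_le := by
    obtain ⟨T, hT, hle⟩ := hb.exists_operator hs.norm_eq_one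
    rwa [ext_entry b fun x y => (hQ x y).trans (hT x y).symm]
  colSum_mul_right_le := by
    refine fun T => colSum_mul_le_of_entry (fun y => ?_) T
    rw [ENNReal.coe_mul]
    refine le_trans (ENNReal.tsum_le_tsum fun x => ?_) (hb.tsum_entry_le y)
    rw [hQ, enorm_mul, ← ofReal_norm (s y x), hs.norm_eq_one, ENNReal.ofReal_one, one_mul,
      dist_comm]
    exact hb.entry_le y x
  colSum_defect_le := by
    refine (hb.colSum_le_of_kernel (O₁ := O₁) (O₂ := O₂) (A := 2)
      (hasSum_entry_idemDefect hb.isStarProjection hQ) fun x y z => ?_).trans (le_of_eq ?_)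
    · by_cases h : ∃ O ∈ F, O ∈ convexHull ℝ {pos x, pos y, pos z}
      · obtain ⟨O, hO, h⟩ := h
        refine mul_le_mul' (hs.enorm_sub_le x y z) ?_
        refine (hb.tripleWeight_bound h (r := 0) (by positivity)).trans ?_
        rw [show expWeight a 0 = 1 by simp [expWeight], one_mul]
        rcases hF hO with rfl | rfl
        · exact le_self_add
        · exact le_add_self
      · push Not at h
        rw [hs.sub_eq_zero h, enorm_zero, zero_mul]
        exact zero_le
    · push_cast
      ring

/-- The free parameter r of the triangle bound is spent on the distance from x to O, which gives the
second power of the weight. -/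
lemma tsum_entry_idemDefect_le (hs : IsFluxPhase pos {O} s)
    (hQ : ∀ x y, entry b Q x y = s x y * entry b P x y) (x : ι) :
    ∑' z, ‖entry b (idemDefect Q) x z‖ₑ ≤
      2 * C ^ 2 * M ^ 2 * expWeight a (dist (pos x) O) ^ 2 := by
  refine hb.tsum_entry_le_of_kernel (hasSum_entry_idemDefect hb.isStarProjection hQ)
    (fun x y z => ?_) x
  by_cases h : O ∈ convexHull ℝ {pos x, pos y, pos z}
  · exact mul_le_mul' (hs.enorm_sub_le x y z)
      (hb.tripleWeight_bound h (dist_le_of_mem_triangle h).1)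
  · rw [hs.sub_eq_zero (by simpa using h), enorm_zero, zero_mul]
    exact zero_le

/-- The defect of a flux is almost annihilated by the difference of operators that agree near the
flux. -/
lemma colSum_sub_mul_le (hs : ∀ x y, ‖s x y‖ = 1) (h₁ : IsFluxPhase pos {O} s₁)
    (hS : ∀ x y, entry b S x y = s x y * entry b P x y)
    (hQ : ∀ x y, entry b Q x y = s₁ x y * entry b P x y) {A : Set Plane} {r : ℝ}
    (hA : ∀ p ∉ A, r ≤ dist p O) (heq : ∀ x y, pos x ∈ A → pos y ∈ A → s x y = s₁ x y) :
    colSum b ((S - Q) * idemDefect Q) ≤ 4 * C ^ 3 * M ^ 4 * expWeight a r := by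
  have ha := hb.rate_pos.le
  -- Columns of S - Q are not small by themselves. An entry survives only if w or x lies outside A,
  -- so the distance from O to x plus the hop from x to w is at least r; the weight at x, borrowed
  -- from the defect, turns this into exp(-a r).
  have hcol : ∀ x, expWeight a (dist (pos x) O) * ‖(S - Q) (b x)‖ₑ ≤
      2 * C * M * expWeight a r := fun x => by
    calc _ ≤ expWeight a (dist (pos x) O) * ∑' w, ‖entry b (S - Q) w x‖ₑ :=
          mul_le_mul_right (enorm_le_tsum_inner b _) _
      _ = ∑' w, expWeight a (dist (pos x) O) * ‖entry b (S - Q) w x‖ₑ :=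
          ENNReal.tsum_mul_left.symm
      _ ≤ ∑' w, 2 * C * expWeight a r * expWeight a (dist (pos w) (pos x)) := by
          refine ENNReal.tsum_le_tsum fun w => ?_
          rw [entry_sub, hS, hQ, ← sub_mul, enorm_mul]
          by_cases h : pos w ∈ A ∧ pos x ∈ A
          · rw [heq w x h.1 h.2, sub_self, enorm_zero, zero_mul, mul_zero]
            exact zero_le
          · have h2 : ‖s w x - s₁ w x‖ₑ ≤ 2 := by
              have h3 := norm_sub_le (s w x) (s₁ w x)
              rw [hs, h₁.norm_eq_one, one_add_one_eq_two] at h3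
              rw [← ofReal_norm, ← ENNReal.ofReal_ofNat]
              exact ENNReal.ofReal_le_ofReal h3
            have h3 : r ≤ dist (pos x) O + dist (pos w) (pos x) := by
              rcases not_and_or.mp h with h | h
              · linarith [hA _ h, dist_triangle (pos w) (pos x) O]
              · linarith [hA _ h, dist_nonneg (x := pos w) (y := pos x)]
            have h4 : expWeight a (dist (pos x) O) * expWeight (4 * a) (dist (pos w) (pos x)) ≤
                expWeight a r * expWeight a (dist (pos w) (pos x)) := by
              rw [expWeight_smul, expWeight_mul, expWeight_mul]
              refine expWeight_le ha ?_
              linarith [dist_nonneg (x := pos w) (y := pos x)]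
            calc _ ≤ expWeight a (dist (pos x) O) *
                  (2 * (C * expWeight (4 * a) (dist (pos w) (pos x)))) :=
                  mul_le_mul_right (mul_le_mul' h2 (hb.entry_le w x)) _
              _ = 2 * C * (expWeight a (dist (pos x) O) *
                  expWeight (4 * a) (dist (pos w) (pos x))) := by ring
              _ ≤ 2 * C * (expWeight a r * expWeight a (dist (pos w) (pos x))) :=
                  mul_le_mul_right h4 _
              _ = _ := by ring
      _ ≤ 2 * C * expWeight a r * M := by
          rw [ENNReal.tsum_mul_left]
          exact mul_le_mul_right (hb.tsum_le _) _
      _ = _ := by ring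
  calc _ ≤ ∑' x, (∑' z, ‖entry b (idemDefect Q) x z‖ₑ) * ‖(S - Q) (b x)‖ₑ :=
        colSum_mul_le_tsum b _ _
    _ ≤ ∑' x, 4 * C ^ 3 * M ^ 3 * expWeight a r * expWeight a (dist (pos x) O) := by
        refine ENNReal.tsum_le_tsum fun x => ?_
        refine (mul_le_mul_left (hb.tsum_entry_idemDefect_le h₁ hQ x) _).trans ?_
        calc _ = 2 * C ^ 2 * M ^ 2 * expWeight a (dist (pos x) O) *
              (expWeight a (dist (pos x) O) * ‖(S - Q) (b x)‖ₑ) := by ring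
          _ ≤ 2 * C ^ 2 * M ^ 2 * expWeight a (dist (pos x) O) * (2 * C * M * expWeight a r) :=
              mul_le_mul_right (hcol x) _
          _ = _ := by ring
    _ ≤ 4 * C ^ 3 * M ^ 3 * expWeight a r * M := by
        rw [ENNReal.tsum_mul_left]
        exact mul_le_mul_right (hb.tsum_le O) _
    _ = _ := by ring

/-- The defects of distant fluxes are almost orthogonal. -/
lemma colSum_defect_mul_le (h₁ : IsFluxPhase pos {O₁} s₁) (h₂ : IsFluxPhase pos {O₂} s₂)
    (hQ₁ : ∀ x y, entry b Q₁ x y = s₁ x y * entry b P x y)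
    (hQ₂ : ∀ x y, entry b Q₂ x y = s₂ x y * entry b P x y) :
    colSum b (idemDefect Q₁ * idemDefect Q₂) ≤
      4 * C ^ 4 * M ^ 5 * expWeight a (dist O₁ O₂) := by
  have ha := hb.rate_pos.le
  have hsa := isSelfAdjoint_idemDefect (h₁.isSelfAdjoint hb.isStarProjection.isSelfAdjoint hQ₁)
  calc _ ≤ ∑' x, (∑' z, ‖entry b (idemDefect Q₂) x z‖ₑ) * ‖idemDefect Q₁ (b x)‖ₑ :=
        colSum_mul_le_tsum b _ _
    _ ≤ ∑' x, 4 * C ^ 4 * M ^ 4 * expWeight a (dist O₁ O₂) * expWeight a (dist (pos x) O₁) := by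
        refine ENNReal.tsum_le_tsum fun x => ?_
        have h3 : ‖idemDefect Q₁ (b x)‖ₑ ≤
            2 * C ^ 2 * M ^ 2 * expWeight a (dist (pos x) O₁) ^ 2 := by
          refine (enorm_le_tsum_inner b _).trans
            (le_trans (le_of_eq (tsum_congr fun w => ?_)) (hb.tsum_entry_idemDefect_le h₁ hQ₁ x))
          exact norm_entry_symm hsa w x
        have h4 : expWeight a (dist (pos x) O₂) ^ 2 * expWeight a (dist (pos x) O₁) ≤
            expWeight a (dist O₁ O₂) := by
          rw [sq, expWeight_mul, expWeight_mul]
          refine expWeight_le ha ?_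
          linarith [dist_triangle_left O₁ O₂ (pos x), dist_nonneg (x := pos x) (y := O₂)]
        calc _ ≤ 2 * C ^ 2 * M ^ 2 * expWeight a (dist (pos x) O₂) ^ 2 *
              (2 * C ^ 2 * M ^ 2 * expWeight a (dist (pos x) O₁) ^ 2) :=
              mul_le_mul' (hb.tsum_entry_idemDefect_le h₂ hQ₂ x) h3
          _ = 4 * C ^ 4 * M ^ 4 * (expWeight a (dist (pos x) O₂) ^ 2 *
              expWeight a (dist (pos x) O₁)) * expWeight a (dist (pos x) O₁) := by ring
          _ ≤ _ := mul_le_mul_left (mul_le_mul_right h4 _) _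
    _ ≤ 4 * C ^ 4 * M ^ 4 * expWeight a (dist O₁ O₂) * M := by
        rw [ENNReal.tsum_mul_left]
        exact mul_le_mul_right (hb.tsum_le O₁) _
    _ = _ := by ring

end DecayBounds

end Estimates

/-! ### Two distant fluxes as a superposition, and the limit -/

section TwoFluxes

variable {ι H : Type*} [NormedAddCommGroup H] [InnerProductSpace ℂ H] [CompleteSpace H]
  {b : HilbertBasis ι ℂ H} {P Q S Q₁ Q₂ : H →L[ℂ] H} {pos : ι → Plane} {s t s₁ s₂ : ι → ι → ℂ}
  {a : ℝ} {M C : ℝ≥0} {O₁ O₂ : Plane} {F : Set Plane}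

/-- All phases are first made real and site-dependent, as time reversal requires, and those of `Q₁`
and `Q₂` are then matched to `S` on the half-planes. One half-plane is closed and the other open, so
that they partition the plane; each contains only its own flux. -/
lemma TwoFlux.exists_adapted_gauge (Φ : TwoFlux pos) (hne : Φ.O₁ ≠ Φ.O₂) :
    ∃ u u₁ u₂ : ι → ℂ, (∀ x, ‖u x‖ = 1) ∧ (∀ x, ‖u₁ x‖ = 1) ∧ (∀ x, ‖u₂ x‖ = 1) ∧
      IsSitePhase pos (gauge u Φ.s) ∧ IsSitePhase pos (gauge u₁ Φ.s₁) ∧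
      IsSitePhase pos (gauge u₂ Φ.s₂) ∧
      (∀ x y, dist (pos x) Φ.O₁ ≤ dist (pos x) Φ.O₂ → dist (pos y) Φ.O₁ ≤ dist (pos y) Φ.O₂ →
        gauge u Φ.s x y = gauge u₁ Φ.s₁ x y) ∧
      ∀ x y, dist (pos x) Φ.O₂ < dist (pos x) Φ.O₁ → dist (pos y) Φ.O₂ < dist (pos y) Φ.O₁ →
        gauge u Φ.s x y = gauge u₂ Φ.s₂ x y := by
  have hd : 0 < dist Φ.O₁ Φ.O₂ := dist_pos.mpr hne
  obtain ⟨u, hu, hsite⟩ := Φ.isFluxPhase.exists_isSitePhase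
  obtain ⟨v₁, hv₁, hsite₁⟩ := Φ.isFluxPhase₁.exists_isSitePhase
  obtain ⟨v₂, hv₂, hsite₂⟩ := Φ.isFluxPhase₂.exists_isSitePhase
  obtain ⟨w₁, hw₁, hsite₁', h₁⟩ := (Φ.isFluxPhase.gauge hu).exists_gauge_eq
    (Φ.isFluxPhase₁.gauge hv₁) hsite hsite₁ (convex_closer Φ.O₁ Φ.O₂).1 (by
      ext p
      simp only [Set.mem_inter_iff, Set.mem_insert_iff, Set.mem_singleton_iff,
        Set.mem_ofPred_eq]
      refine ⟨fun ⟨h, h'⟩ => ⟨h.resolve_right ?_, h'⟩, fun ⟨h, h'⟩ => ⟨Or.inl h, h'⟩⟩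
      rintro rfl
      rw [dist_self, dist_comm] at h'
      linarith)
  obtain ⟨w₂, hw₂, hsite₂', h₂⟩ := (Φ.isFluxPhase.gauge hu).exists_gauge_eq
    (Φ.isFluxPhase₂.gauge hv₂) hsite hsite₂ (convex_closer Φ.O₂ Φ.O₁).2 (by
      ext p
      simp only [Set.mem_inter_iff, Set.mem_insert_iff, Set.mem_singleton_iff,
        Set.mem_ofPred_eq]
      refine ⟨fun ⟨h, h'⟩ => ⟨h.resolve_left ?_, h'⟩, fun ⟨h, h'⟩ => ⟨Or.inr h, h'⟩⟩
      rintro rfl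
      rw [dist_self] at h'
      linarith)
  rw [gauge_gauge] at hsite₁' hsite₂'
  simp only [gauge_gauge] at h₁ h₂
  exact ⟨u, _, _, hu, fun x => by rw [norm_mul, hw₁, hv₁, one_mul],
    fun x => by rw [norm_mul, hw₂, hv₂, one_mul], hsite, hsite₁', hsite₂',
    fun x y hx hy => (h₁ x y hx hy).symm, fun x y hx hy => (h₂ x y hx hy).symm⟩

namespace DecayBounds

variable (hb : DecayBounds pos b P a M C)
include hb

/-- The defect of two distant fluxes is almost the sum of the defects of the single fluxes. -/
lemma colSum_defect_sub_le (hs : IsFluxPhase pos {O₁, O₂} s) (h₁ : IsFluxPhase pos {O₁} s₁)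
    (h₂ : IsFluxPhase pos {O₂} s₂) (hS : ∀ x y, entry b S x y = s x y * entry b P x y)
    (hQ₁ : ∀ x y, entry b Q₁ x y = s₁ x y * entry b P x y)
    (hQ₂ : ∀ x y, entry b Q₂ x y = s₂ x y * entry b P x y) {A B : Set Plane} {r : ℝ}
    (hAB : ∀ p, p ∈ A ∨ p ∈ B) (hA : ∀ p ∈ A, r ≤ dist p O₂) (hB : ∀ p ∈ B, r ≤ dist p O₁)
    (heqA : ∀ x y, pos x ∈ A → pos y ∈ A → s x y = s₁ x y)
    (heqB : ∀ x y, pos x ∈ B → pos y ∈ B → s x y = s₂ x y) :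
    colSum b (idemDefect S - idemDefect Q₁ - idemDefect Q₂) ≤
      12 * C ^ 2 * M ^ 3 * expWeight a r := by
  let q : ι → ι → ι → ℂ := fun x y z => (s x y * s y z - s x z) -
    (s₁ x y * s₁ y z - s₁ x z) - (s₂ x y * s₂ y z - s₂ x z)
  have hkernel : ∀ x z, HasSum (fun y => q x y z * (entry b P x y * entry b P y z))
      (entry b (idemDefect S - idemDefect Q₁ - idemDefect Q₂) x z) := fun x z => by
    have hP := hb.isStarProjection
    rw [entry_sub, entry_sub]
    refine (((hasSum_entry_idemDefect hP hS x z).sub (hasSum_entry_idemDefect hP hQ₁ x z)).sub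
      (hasSum_entry_idemDefect hP hQ₂ x z)).congr_fun fun y => ?_
    simp only [q]
    ring
  have hq : ∀ x y z, ‖q x y z‖ₑ ≤ 6 := fun x y z => by
    refine (enorm_sub_le.trans (add_le_add (enorm_sub_le.trans (add_le_add
      (hs.enorm_sub_le x y z) (h₁.enorm_sub_le x y z))) (h₂.enorm_sub_le x y z))).trans
      (le_of_eq ?_)
    norm_num
  have hdist : ∀ x y z O, O ∈ convexHull ℝ {pos x, pos y, pos z} → ∀ D : Set Plane,
      (∀ p ∈ D, r ≤ dist p O) → (pos x ∈ D ∨ pos y ∈ D ∨ pos z ∈ D) →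
      ‖q x y z‖ₑ * expWeight (4 * a) (dist (pos x) (pos y) + dist (pos y) (pos z)) ≤
        6 * expWeight a r * tripleWeight pos a O x y z := fun x y z O hO D hD h => by
    rw [mul_assoc]
    refine mul_le_mul' (hq x y z) (hb.tripleWeight_bound hO ?_)
    obtain ⟨h1, h2, h3⟩ := dist_le_of_mem_triangle hO
    rcases h with h | h | h
    exacts [(hD _ h).trans h1, (hD _ h).trans h2, (hD _ h).trans h3]
  have hzero : ∀ x y z R, q x y z = 0 → ‖q x y z‖ₑ *
      expWeight (4 * a) (dist (pos x) (pos y) + dist (pos y) (pos z)) ≤ R := fun x y z R h => by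
    rw [h, enorm_zero, zero_mul]
    exact zero_le
  refine (hb.colSum_le_of_kernel (O₁ := O₁) (O₂ := O₂) (A := 6 * expWeight a r) hkernel
    fun x y z => ?_).trans (le_of_eq (by ring))
  rw [mul_add]
  -- A triangle that contains a flux and has a vertex in the other half-plane is long, hence has
  -- small weight. Otherwise the kernel cancels: either no flux is enclosed, or all vertices lie in
  -- the half-plane of the single enclosed flux, where the gauges agree.
  by_cases hO₁ : O₁ ∈ convexHull ℝ {pos x, pos y, pos z}
  · by_cases hv : pos x ∈ B ∨ pos y ∈ B ∨ pos z ∈ B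
    · exact (hdist x y z O₁ hO₁ B hB hv).trans le_self_add
    · push Not at hv
      have hx := (hAB (pos x)).resolve_right hv.1
      have hy := (hAB (pos y)).resolve_right hv.2.1
      have hz := (hAB (pos z)).resolve_right hv.2.2
      by_cases hO₂ : O₂ ∈ convexHull ℝ {pos x, pos y, pos z}
      · exact (hdist x y z O₂ hO₂ A hA (Or.inl hx)).trans le_add_self
      · refine hzero x y z _ ?_
        simp only [q]
        rw [heqA x y hx hy, heqA y z hy hz, heqA x z hx hz, h₂.sub_eq_zero (by simpa using hO₂)]
        ring
  · by_cases hO₂ : O₂ ∈ convexHull ℝ {pos x, pos y, pos z}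
    · by_cases hv : pos x ∈ A ∨ pos y ∈ A ∨ pos z ∈ A
      · exact (hdist x y z O₂ hO₂ A hA hv).trans le_add_self
      · push Not at hv
        have hx := (hAB (pos x)).resolve_left hv.1
        have hy := (hAB (pos y)).resolve_left hv.2.1
        have hz := (hAB (pos z)).resolve_left hv.2.2
        refine hzero x y z _ ?_
        simp only [q]
        rw [heqB x y hx hy, heqB y z hy hz, heqB x z hx hz, h₁.sub_eq_zero (by simpa using hO₁)]
        ring
    · refine hzero x y z _ ?_
      simp only [q]
      rw [hs.sub_eq_zero (by simpa using ⟨hO₁, hO₂⟩), h₁.sub_eq_zero (by simpa using hO₁),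
        h₂.sub_eq_zero (by simpa using hO₂)]
      ring

lemma peierls_gauge (hs : IsFluxPhase pos F s) {u : ι → ℂ} (hu : ∀ x, ‖u x‖ = 1) :
    trv b (peierls b (gauge u s) P) = trv b (peierls b s P) ∧
      spectrum ℝ (peierls b (gauge u s) P) = spectrum ℝ (peierls b s P) := by
  have hP := hb.isStarProjection.isSelfAdjoint
  have h := hb.entry_peierls hs.norm_eq_one
  have h' := hb.entry_peierls (hs.gauge hu).norm_eq_one
  refine gauge_invariance (hs.isSelfAdjoint hP h) ((hs.gauge hu).isSelfAdjoint hP h') hu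
    fun x y => ?_
  rw [h', h, gauge]
  ring

/-- Gaps on both sides of 1/2 are enough; the pigeonhole argument provides them when applied to
three copies of the same operator. -/
lemma isTraceClass (hs : IsFluxPhase pos F s) (hF : F ⊆ {O₁, O₂}) :
    IsTraceClass b (peierls b s P - flatten (peierls b s P)) := by
  have hQ := hb.admissible hs hF (hb.entry_peierls hs.norm_eq_one)
  obtain ⟨N, cs, δ, hδ, hcs, hgap⟩ := exists_common_gap (4 * C ^ 2 * M ^ 3) (α := 1 / 2)
    (β := 3 / 4) (by norm_num) (by norm_num) le_rfl
  obtain ⟨N', as, α, hα, has, hgap'⟩ := exists_common_gap (4 * C ^ 2 * M ^ 3) (α := 1 / 4)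
    (β := 1 / 2) le_rfl (by norm_num) (by norm_num)
  obtain ⟨j, hj⟩ := hgap b _ (fun _ => peierls b s P) fun _ => hQ
  obtain ⟨i, hi⟩ := hgap' b _ (fun _ => peierls b s P) fun _ => hQ
  have hg : HasGaps (peierls b s P) (as i) α (cs j) δ :=
    ⟨hα, hδ, (has i).1, (has i).2, (hcs j).1, (hcs j).2, hi 0, hj 0⟩
  exact isTraceClass_of_colSum (hg.colSum_sub_flat hQ)

/-- Up to a gauge transformation and an exponentially small error, two distant fluxes are a
superposition of single fluxes. -/
lemma exists_superposition (Φ : TwoFlux pos) (hne : Φ.O₁ ≠ Φ.O₂) : ∃ S Q₁ Q₂ : H →L[ℂ] H,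
    Admissible b (C * M) (4 * C ^ 2 * M ^ 3) S ∧ Admissible b (C * M) (4 * C ^ 2 * M ^ 3) Q₁ ∧
    Admissible b (C * M) (4 * C ^ 2 * M ^ 3) Q₂ ∧
    IsSuperposition b ((12 * C ^ 2 * M ^ 3 + 4 * C ^ 3 * M ^ 4 + 4 * C ^ 4 * M ^ 5) *
      (Real.exp (-a * (dist Φ.O₁ Φ.O₂ / 2))).toNNReal) S Q₁ Q₂ ∧
    Φ.defect b P = trv b S - (trv b Q₁ + trv b Q₂) ∧
    spectrum ℝ Q₁ = spectrum ℝ (Φ.Q₁ b P) ∧ spectrum ℝ Q₂ = spectrum ℝ (Φ.Q₂ b P) ∧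
    ∀ Θ : H ≃ₗᵢ⋆[ℂ] H, (∀ x y, pos x ≠ pos y → inner ℂ (b x) (Θ (b y)) = (0 : ℂ)) →
      (∀ v, Θ (P v) = P (Θ v)) → (∀ v, Θ (S v) = S (Θ v)) ∧ (∀ v, Θ (Q₁ v) = Q₁ (Θ v)) ∧
        ∀ v, Θ (Q₂ v) = Q₂ (Θ v) := by
  obtain ⟨u, u₁, u₂, hu, hu₁, hu₂, hsite, hsite₁, hsite₂, heq₁, heq₂⟩ :=
    Φ.exists_adapted_gauge hne
  have hs := Φ.isFluxPhase.gauge hu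
  have h₁ := Φ.isFluxPhase₁.gauge hu₁
  have h₂ := Φ.isFluxPhase₂.gauge hu₂
  have hS := hb.entry_peierls hs.norm_eq_one
  have hQ₁ := hb.entry_peierls h₁.norm_eq_one
  have hQ₂ := hb.entry_peierls h₂.norm_eq_one
  have hε : (((12 * C ^ 2 * M ^ 3 + 4 * C ^ 3 * M ^ 4 + 4 * C ^ 4 * M ^ 5) *
      (Real.exp (-a * (dist Φ.O₁ Φ.O₂ / 2))).toNNReal : ℝ≥0) : ℝ≥0∞) =
      12 * C ^ 2 * M ^ 3 * expWeight a (dist Φ.O₁ Φ.O₂ / 2) +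
      4 * C ^ 3 * M ^ 4 * expWeight a (dist Φ.O₁ Φ.O₂ / 2) +
      4 * C ^ 4 * M ^ 5 * expWeight a (dist Φ.O₁ Φ.O₂ / 2) := by
    rw [expWeight, ENNReal.ofReal]
    push_cast
    ring
  -- A point nearer to one flux is at least half the separation away from the other; this is the d/2
  -- in the error.
  have hfar : ∀ p, dist p Φ.O₁ ≤ dist p Φ.O₂ → dist Φ.O₁ Φ.O₂ / 2 ≤ dist p Φ.O₂ := fun p h => by
    linarith [dist_triangle_left Φ.O₁ Φ.O₂ p]
  have hfar' : ∀ p, dist p Φ.O₂ ≤ dist p Φ.O₁ → dist Φ.O₁ Φ.O₂ / 2 ≤ dist p Φ.O₁ :=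
    fun p h => by linarith [dist_triangle_left Φ.O₁ Φ.O₂ p]
  refine ⟨peierls b (gauge u Φ.s) P, peierls b (gauge u₁ Φ.s₁) P, peierls b (gauge u₂ Φ.s₂) P,
    hb.admissible hs subset_rfl hS, hb.admissible (O₁ := Φ.O₁) (O₂ := Φ.O₂) h₁ (by simp) hQ₁,
    hb.admissible (O₁ := Φ.O₁) (O₂ := Φ.O₂) h₂ (by simp) hQ₂, ⟨?_, ?_, ?_, ?_⟩, ?_, ?_, ?_, ?_⟩
  · rw [hε, add_assoc]
    refine (hb.colSum_defect_sub_le hs h₁ h₂ hS hQ₁ hQ₂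
      (A := {p | dist p Φ.O₁ ≤ dist p Φ.O₂}) (B := {p | dist p Φ.O₂ < dist p Φ.O₁})
      (fun p => le_or_gt (dist p _) _) (fun p h => hfar p h) (fun p h => hfar' p (le_of_lt h))
      heq₁ heq₂).trans le_self_add
  · rw [hε, add_right_comm]
    refine (hb.colSum_sub_mul_le hs.norm_eq_one h₁ hS hQ₁
      (A := {p | dist p Φ.O₁ ≤ dist p Φ.O₂})
      (fun p h => hfar' p (le_of_not_ge h)) heq₁).trans le_add_self
  · rw [hε, add_right_comm]
    refine (hb.colSum_sub_mul_le hs.norm_eq_one h₂ hS hQ₂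
      (A := {p | dist p Φ.O₂ < dist p Φ.O₁})
      (fun p h => hfar p (le_of_not_gt h)) heq₂).trans le_add_self
  · rw [hε]
    refine (hb.colSum_defect_mul_le h₁ h₂ hQ₁ hQ₂).trans (le_trans (mul_le_mul_right
      (expWeight_le hb.rate_pos.le ?_) _) le_add_self)
    linarith [dist_nonneg (x := Φ.O₁) (y := Φ.O₂)]
  · rw [(hb.peierls_gauge Φ.isFluxPhase hu).1, (hb.peierls_gauge Φ.isFluxPhase₁ hu₁).1,
      (hb.peierls_gauge Φ.isFluxPhase₂ hu₂).1]
    rfl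
  · exact (hb.peierls_gauge Φ.isFluxPhase₁ hu₁).2
  · exact (hb.peierls_gauge Φ.isFluxPhase₂ hu₂).2
  · exact fun Θ hΘ hPΘ => ⟨hsite.commute_antiunitary hS Θ hΘ hPΘ,
      hsite₁.commute_antiunitary hQ₁ Θ hΘ hPΘ, hsite₂.commute_antiunitary hQ₂ Θ hΘ hPΘ⟩

/-- The defect of additivity is close to an integer; this integer is even for time-reversal
symmetric systems, and vanishes if there is a spectral gap. -/
lemma eventually_defect_near_int {η : ℝ≥0} (hη : 0 < η) :
    ∀ᶠ Φ in TwoFlux.farApart pos, ∃ n : ℤ, |Φ.defect b P - (n : ℝ)| ≤ (η : ℝ) ∧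
      (TimeReversalSymmetric pos b P → Even n) ∧ (Φ.GapAtHalf b P (a / 4) → n = 0) := by
  obtain ⟨ν, hν, h⟩ := exists_trv_additive (C * M) (4 * C ^ 2 * M ^ 3)
  obtain ⟨ε₀, hε₀, h⟩ := h η hη
  set K : ℝ≥0 := 12 * C ^ 2 * M ^ 3 + 4 * C ^ 3 * M ^ 4 + 4 * C ^ 4 * M ^ 5 with hK
  have hdecay : ∀ k r : ℝ, 0 < k →
      Tendsto (fun d : ℝ => r * Real.exp (-a * (d / k))) atTop (𝓝 0) := fun k r hk => by
    have h1 : Tendsto (fun d : ℝ => a / k * d) atTop atTop :=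
      tendsto_id.const_mul_atTop (div_pos hb.rate_pos hk)
    have h2 := (Real.tendsto_exp_neg_atTop_nhds_zero.comp h1).const_mul r
    rw [mul_zero] at h2
    refine h2.congr fun d => ?_
    simp only [Function.comp_apply]
    ring_nf
  have e1 : ∀ᶠ d : ℝ in atTop, K * Real.exp (-a * (d / 2)) < ε₀ :=
    (hdecay 2 K two_pos).eventually_lt_const (by exact_mod_cast hε₀)
  -- The superposition error is of order exp(-a d/2) and the gap is exp(-a d/4), so their ratio, of
  -- order exp(-a d/4), eventually drops below ν.
  have e2 : ∀ᶠ d : ℝ in atTop,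
      (80 * (((C * M : ℝ≥0) : ℝ) + 1) ^ 2 * K) * Real.exp (-a * (d / 4)) < ν :=
    (hdecay 4 _ four_pos).eventually_lt_const hν
  filter_upwards [tendsto_comap.eventually e1, tendsto_comap.eventually e2,
    tendsto_comap.eventually (eventually_gt_atTop (0 : ℝ))] with Φ hd1 hd2 hd
  obtain ⟨S, Q₁, Q₂, hS, hQ₁, hQ₂, hsup, hdefect, hsp₁, hsp₂, hΘ⟩ :=
    hb.exists_superposition Φ (dist_pos.mp hd)
  rw [← hK] at hsup
  obtain ⟨α, α', c, δ, gS, g₁, g₂, hnear, hzero⟩ := h b S Q₁ Q₂ _ hS hQ₁ hQ₂ hsup (by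
    rw [← NNReal.coe_le_coe, NNReal.coe_mul, Real.coe_toNNReal _ (Real.exp_nonneg _)]
    exact hd1.le)
  refine ⟨Module.finrank ℂ (flatten Q₁ - specProj Q₁ c δ).range
    + Module.finrank ℂ (flatten Q₂ - specProj Q₂ c δ).range
    - Module.finrank ℂ (flatten S - specProj S c δ).range, ?_, ?_, fun hgap => ?_⟩
  · rw [hdefect]
    push_cast
    exact hnear
  · rintro ⟨Θ, hsq, hsite, hP⟩
    obtain ⟨c₀, c₁, c₂⟩ := hΘ Θ hsite hP
    have := (gS.finrank_upper hS).1
    have := (g₁.finrank_upper hQ₁).1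
    have := (g₂.finrank_upper hQ₂).1
    have k₀ := even_finrank_flatten_sub (c := c) (δ := δ) hS.isSelfAdjoint Θ hsq c₀
    have k₁ := even_finrank_flatten_sub (c := c) (δ := δ) hQ₁.isSelfAdjoint Θ hsq c₁
    have k₂ := even_finrank_flatten_sub (c := c) (δ := δ) hQ₂.isSelfAdjoint Θ hsq c₂
    exact (((Int.even_coe_nat _).mpr k₁).add ((Int.even_coe_nat _).mpr k₂)).sub
      ((Int.even_coe_nat _).mpr k₀)
  · have hγ : Real.exp (-(a / 4) * dist Φ.O₁ Φ.O₂) = Real.exp (-a * (dist Φ.O₁ Φ.O₂ / 4)) := by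
      ring_nf
    rw [TwoFlux.GapAtHalf, hγ] at hgap
    rw [hzero _ (Real.exp_pos _) (fun t ht => hgap t (Or.inl (hsp₁ ▸ ht)))
      (fun t ht => hgap t (Or.inr (hsp₂ ▸ ht))) ?_]
    · push_cast
      ring
    · rw [NNReal.coe_mul K, Real.coe_toNNReal _ (Real.exp_nonneg _)]
      calc _ = Real.exp (-a * (dist Φ.O₁ Φ.O₂ / 4)) *
            ((80 * (((C * M : ℝ≥0) : ℝ) + 1) ^ 2 * K) *
              Real.exp (-a * (dist Φ.O₁ Φ.O₂ / 4))) := by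
            rw [show -a * (dist Φ.O₁ Φ.O₂ / 2) = -a * (dist Φ.O₁ Φ.O₂ / 4) +
              -a * (dist Φ.O₁ Φ.O₂ / 4) by ring, Real.exp_add]
            ring
        _ < _ := mul_lt_mul_of_pos_left hd2 (Real.exp_pos _)

end DecayBounds

/-- A function that is eventually close to multiples of `p` tends to `0` modulo `p`. -/
lemma tendsto_addCircle_zero {X : Type*} {l : Filter X} {f : X → ℝ} {p : ℝ}
    (h : ∀ η : ℝ≥0, 0 < η → ∀ᶠ x in l, ∃ n : ℤ, |f x - n * p| ≤ η) :
    Tendsto (fun x => (f x : AddCircle p)) l (𝓝 0) := by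
  rw [tendsto_zero_iff_norm_tendsto_zero, Metric.tendsto_nhds]
  intro η hη
  filter_upwards [h ⟨η / 2, by positivity⟩ (half_pos hη)] with x hx
  obtain ⟨n, hn⟩ := hx
  rw [dist_zero_right, norm_norm]
  have h1 : (f x : AddCircle p) = ((f x - n * p : ℝ) : AddCircle p) := by
    rw [AddCircle.coe_sub, ← zsmul_eq_mul, AddCircle.coe_zsmul, AddCircle.coe_period, smul_zero,
      sub_zero]
  rw [h1]
  refine (QuotientAddGroup.norm_mk_le_norm).trans_lt (lt_of_le_of_lt hn ?_)
  exact half_lt_self hη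

end TwoFluxes

end HalfFlux

open HalfFlux in
theorem mainTheorem5 {ι H : Type*} [NormedAddCommGroup H] [InnerProductSpace ℂ H] [CompleteSpace H]
    (b : HilbertBasis ι ℂ H) (pos : ι → Plane) (hpos : UniformlyLocallyFinite pos)
    (P : H →L[ℂ] H) (hP : IsStarProjection P) (hdecay : ExpDecay pos b P) :
    -- the operators `Q₁`, `Q₂`, `S` exist, and their vertex traces are well defined
    (∀ Φ : TwoFlux pos,
      (∀ x y, entry b (Φ.Q₁ b P) x y = Φ.s₁ x y * entry b P x y) ∧
      (∀ x y, entry b (Φ.Q₂ b P) x y = Φ.s₂ x y * entry b P x y) ∧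
      (∀ x y, entry b (Φ.S b P) x y = Φ.s x y * entry b P x y) ∧
      IsTraceClass b (Φ.Q₁ b P - flatten (Φ.Q₁ b P)) ∧
      IsTraceClass b (Φ.Q₂ b P - flatten (Φ.Q₂ b P)) ∧
      IsTraceClass b (Φ.S b P - flatten (Φ.S b P))) ∧
    -- additivity modulo 1
    Tendsto (fun Φ : TwoFlux pos => (Φ.defect b P : AddCircle (1 : ℝ)))
      (TwoFlux.farApart pos) (𝓝 0) ∧
    -- additivity modulo 2 for time-reversal symmetric systems
    (TimeReversalSymmetric pos b P →
      Tendsto (fun Φ : TwoFlux pos => (Φ.defect b P : AddCircle (2 : ℝ)))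
        (TwoFlux.farApart pos) (𝓝 0)) ∧
    -- additivity as real numbers when there is a spectral gap at the chemical potential
    (∃ c : ℝ, 0 < c ∧
      Tendsto (fun Φ : TwoFlux pos => Φ.defect b P)
        (TwoFlux.farApart pos ⊓ 𝓟 {Φ | Φ.GapAtHalf b P c}) (𝓝 0)) := by
  -- Since `exists_decayBounds` takes a quarter of the decay rate of `P`, the exponent a / 4 of the
  -- gap condition is a sixteenth of that rate.
  obtain ⟨a, M, C, hb⟩ := exists_decayBounds hpos hP hdecay
  refine ⟨fun Φ => ⟨hb.entry_peierls Φ.isFluxPhase₁.norm_eq_one,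
    hb.entry_peierls Φ.isFluxPhase₂.norm_eq_one, hb.entry_peierls Φ.isFluxPhase.norm_eq_one,
    hb.isTraceClass (O₁ := Φ.O₁) (O₂ := Φ.O₂) Φ.isFluxPhase₁ (by simp),
    hb.isTraceClass (O₁ := Φ.O₁) (O₂ := Φ.O₂) Φ.isFluxPhase₂ (by simp),
    hb.isTraceClass Φ.isFluxPhase subset_rfl⟩, ?_, fun hTRS => ?_, a / 4,
    by linarith [hb.rate_pos], ?_⟩
  · refine tendsto_addCircle_zero fun η hη => ?_
    filter_upwards [hb.eventually_defect_near_int hη] with Φ ⟨n, hn, _⟩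
    exact ⟨n, by rwa [mul_one]⟩
  · refine tendsto_addCircle_zero fun η hη => ?_
    filter_upwards [hb.eventually_defect_near_int hη] with Φ ⟨n, hn, heven, _⟩
    obtain ⟨m, rfl⟩ := heven hTRS
    refine ⟨m, ?_⟩
    push_cast at hn
    rwa [mul_two]
  · rw [Metric.tendsto_nhds]
    intro η hη
    rw [eventually_inf_principal]
    filter_upwards [hb.eventually_defect_near_int (η := ⟨η / 2, by positivity⟩) (half_pos hη)]
      with Φ ⟨n, hn, _, hgap⟩ hΦ
    rw [hgap hΦ, Int.cast_zero, sub_zero] at hn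
    rw [Real.dist_eq, sub_zero]
    exact hn.trans_lt (half_lt_self hη)
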